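/- Let $N\ge 3$ be an integer, $s\in(0,1)$, $2^*=\frac{2N}{N-2}$, $2^*_s=\frac{2N}{N-2s}$ and $p\in(2^*_s,2^*)$. Let $E$ be the completion of $C_0^\infty(\mathbb R^N)$ (real-valued functions) under the norm $$\|u\|_E^2=\int_{\mathbb R^N}|\nabla u|^2\,dx+\int_{\mathbb R^N}\int_{\mathbb R^N}\frac{|u(x)-u(y)|^2}{|x-y|^{N+2s}}\,dx\,dy ,$$ regarded as a space of functions in $L^{2^*}(\mathbb R^N)$, and for $u,\varphi\in E$ put $$I(u)=\tfrac12\|u\|_E^2-\tfrac1p\int_{\mathbb R^N}|u|^p\,dx,$$ $$\langle I'(u),\varphi\rangle=\int_{\mathbb R^N}\nabla u\cdot\nabla\varphi\,dx+\int_{\mathbb R^N}\int_{\mathbb R^N}\frac{(u(x)-u(y))(\varphi(x)-\varphi(y))}{|x-y|^{N+2s}}\,dx\,dy-\int_{\mathbb R^N}|u|^{p-2}u\varphi\,dx .$$ A function $u\in E$ is a (weak) solution of $$-\Delta u+(-\Delta)^su=|u|^{p-2}u\quad\text{in }\mathbb R^N \tag{P}$$ if $\langle I'(u),\varphi\rangle=0$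 for all $\varphi\in E$ (the fractional Laplacian is normalized accordingly). A ground state solution is a solution $u\neq0$ with $I(u)\le I(v)$ for every solution $v\ne0$. Let $$\mathcal N=\{u\in E\setminus\{0\}:\langle I'(u),u\rangle=0\},\qquad c=\inf_{\gamma\in\Gamma}\sup_{t\in[0,1]}I(\gamma(t)),$$ $$\Gamma=\{\gamma\in C([0,1],E):\gamma(0)=0,\ I(\gamma(1))<0\}.$$ Then (P) has a radial ground state solution $\Phi\in E$. It belongs to $\mathcal N$ and satisfies $$I(\Phi)=\inf_{u\in\mathcal N}I(u)=c .$$ -/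

import Mathlib

namespace MixedLaplacian

open MeasureTheory Filter Topology
open scoped ContDiff

/-- Euclidean space `ℝ^N` with its Euclidean norm and Lebesgue measure. -/
abbrev Space (N : ℕ) := EuclideanSpace ℝ (Fin N)

/-- The critical Sobolev exponent `2^* = 2N / (N - 2)`. -/
noncomputable def critExp (N : ℕ) : ℝ := 2 * N / (N - 2)

/-- The fractional critical Sobolev exponent `2_s^* = 2N / (N - 2s)`. -/
noncomputable def fracCritExp (N : ℕ) (s : ℝ) : ℝ := 2 * N / (N - 2 * s)

variable {N : ℕ}

/-- `C_0^∞(ℝ^N)`: smooth real functions with compact support. -/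
def IsTest (φ : Space N → ℝ) : Prop := ContDiff ℝ ∞ φ ∧ HasCompactSupport φ

/-- `G` is a square-integrable weak gradient of `u`: `∫ u ∂_v φ = - ∫ ⟨G, v⟩ φ` for all test
functions `φ` and all directions `v`. -/
structure IsWeakGradient (u : Space N → ℝ) (G : Space N → Space N) : Prop where
  locallyIntegrable : LocallyIntegrable u
  memLp : MemLp G 2
  integral_eq : ∀ φ : Space N → ℝ, IsTest φ → ∀ v : Space N,
    ∫ x, u x * fderiv ℝ φ x v = - ∫ x, inner ℝ (G x) v * φ x

/-- Weak gradients are unique almost everywhere. -/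
theorem IsWeakGradient.ae_eq {u : Space N → ℝ} {G H : Space N → Space N}
    (hG : IsWeakGradient u G) (hH : IsWeakGradient u H) : G =ᵐ[volume] H := by
  have lG : LocallyIntegrable G := hG.memLp.locallyIntegrable (by norm_num)
  have lH : LocallyIntegrable H := hH.memLp.locallyIntegrable (by norm_num)
  refine ae_eq_of_integral_contDiff_smul_eq lG lH fun g hg hc => ?_
  have iG : Integrable fun x => g x • G x :=
    lG.integrable_smul_left_of_hasCompactSupport hg.continuous hc
  have iH : Integrable fun x => g x • H x :=
    lH.integrable_smul_left_of_hasCompactSupport hg.continuous hc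
  refine ext_inner_right ℝ fun v => ?_
  have e := (hG.integral_eq g ⟨hg, hc⟩ v).symm.trans (hH.integral_eq g ⟨hg, hc⟩ v)
  have e' := neg_injective e
  have key : ∀ K : Space N → Space N, Integrable (fun x => g x • K x) →
      inner ℝ (∫ x, g x • K x) v = ∫ x, inner ℝ (K x) v * g x := by
    intro K hK
    rw [real_inner_comm, ← integral_inner hK v]
    refine integral_congr_ae (Eventually.of_forall fun x => ?_)
    simp only [inner_smul_right, real_inner_comm v, mul_comm]
  rw [key G iG, key H iH, e']

open Classical in
/-- The weak gradient `∇u` (unique up to null sets; `0` when there is none in `L²`). -/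
noncomputable def weakGrad (u : Space N → ℝ) : Space N → Space N :=
  if h : ∃ G, IsWeakGradient u G then h.choose else 0

theorem isWeakGradient_weakGrad {u : Space N → ℝ} (h : ∃ G, IsWeakGradient u G) :
    IsWeakGradient u (weakGrad u) := by
  rw [weakGrad, dif_pos h]
  exact h.choose_spec

/-- `∫ ∇u · ∇v dx`. -/
noncomputable def dirichletForm (u v : Space N → ℝ) : ℝ :=
  ∫ x, inner ℝ (weakGrad u x) (weakGrad v x)

/-- The integrand `(u(x) - u(y)) (v(x) - v(y)) / |x - y|^(N + 2s)` on `ℝ^N × ℝ^N`. -/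
noncomputable def gagliardoKernel (s : ℝ) (u v : Space N → ℝ) (z : Space N × Space N) : ℝ :=
  (u z.1 - u z.2) * (v z.1 - v z.2) / ‖z.1 - z.2‖ ^ ((N : ℝ) + 2 * s)

/-- `∬ (u(x) - u(y)) (v(x) - v(y)) / |x - y|^(N + 2s) dx dy`. -/
noncomputable def gagliardoForm (s : ℝ) (u v : Space N → ℝ) : ℝ :=
  ∫ z : Space N × Space N, gagliardoKernel s u v z

/-- The norm of the mixed Sobolev space: `‖u‖_E² = ∫ |∇u|² + ∬ |u(x) - u(y)|² / |x - y|^(N + 2s)`. -/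
noncomputable def mixedNorm (s : ℝ) (u : Space N → ℝ) : ℝ :=
  √(dirichletForm u u + gagliardoForm s u u)

/-- Membership in the mixed Sobolev space `E`, the completion of `C_0^∞(ℝ^N)` under `‖·‖_E`, realized
as a space of functions: by the Sobolev inequality a `‖·‖_E`-Cauchy sequence of test functions
converges in `L^{2^*}`, so that the completion consists of those functions of `L^{2^*}` with finite
`‖·‖_E` that are limits of test functions in `‖·‖_E`. Functions that agree almost everywhere
represent the same element. -/
structure MemE (s : ℝ) (u : Space N → ℝ) : Prop where
  memLp : MemLp u (ENNReal.ofReal (critExp N))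
  exists_weakGradient : ∃ G, IsWeakGradient u G
  integrable_gagliardo : Integrable (gagliardoKernel s u u)
  exists_approx : ∃ φ : ℕ → Space N → ℝ, (∀ n, IsTest (φ n)) ∧
    Tendsto (fun n => mixedNorm s (u - φ n)) atTop (𝓝 0)

/-- The energy functional
`I(u) = 1/2 (∫ |∇u|² + ∬ |u(x) - u(y)|² / |x - y|^(N + 2s)) - 1/p ∫ |u|^p`. -/
noncomputable def energy (s p : ℝ) (u : Space N → ℝ) : ℝ :=
  1 / 2 * (dirichletForm u u + gagliardoForm s u u) - 1 / p * ∫ x, |u x| ^ p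

/-- The derivative of the energy,
`⟨I'(u), φ⟩ = ∫ ∇u · ∇φ + ∬ (u(x) - u(y)) (φ(x) - φ(y)) / |x - y|^(N + 2s) - ∫ |u|^(p-2) u φ`. -/
noncomputable def energyDeriv (s p : ℝ) (u φ : Space N → ℝ) : ℝ :=
  dirichletForm u φ + gagliardoForm s u φ - ∫ x, |u x| ^ (p - 2) * u x * φ x

/-- Weak solutions in `E` of `-Δu + (-Δ)^s u = |u|^(p-2) u`: `⟨I'(u), φ⟩ = 0` for all `φ ∈ E`. -/
def IsWeakSolution (s p : ℝ) (u : Space N → ℝ) : Prop :=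
  MemE s u ∧ ∀ φ : Space N → ℝ, MemE s φ → energyDeriv s p u φ = 0

/-- A ground state solution: a nontrivial weak solution of least energy among all nontrivial weak
solutions. -/
def IsGroundState (s p : ℝ) (u : Space N → ℝ) : Prop :=
  IsWeakSolution s p u ∧ ¬ u =ᵐ[volume] 0 ∧
    ∀ v : Space N → ℝ, IsWeakSolution s p v → ¬ v =ᵐ[volume] 0 → energy s p u ≤ energy s p v

/-- The Nehari manifold `{u ∈ E \ {0} | ⟨I'(u), u⟩ = 0}`. -/
def nehari (N : ℕ) (s p : ℝ) : Set (Space N → ℝ) :=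
  {u | MemE s u ∧ ¬ u =ᵐ[volume] 0 ∧ energyDeriv s p u u = 0}

/-- The admissible paths `{γ ∈ C([0, 1], E) | γ(0) = 0, I(γ(1)) < 0}`; continuity is with respect to
`‖·‖_E`. -/
def admissiblePaths (N : ℕ) (s p : ℝ) : Set (unitInterval → Space N → ℝ) :=
  {γ | (∀ t, MemE s (γ t)) ∧
    (∀ t₀, Tendsto (fun t => mixedNorm s (γ t - γ t₀)) (𝓝 t₀) (𝓝 0)) ∧
    γ 0 =ᵐ[volume] 0 ∧ energy s p (γ 1) < 0}

/-- The infimum of the energy over the Nehari manifold, taken in the extended reals. -/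
noncomputable def nehariLevel (N : ℕ) (s p : ℝ) : EReal :=
  ⨅ u ∈ nehari N s p, (energy s p u : EReal)

/-- The mountain pass level `c = inf_γ sup_{t ∈ [0, 1]} I(γ(t))`, taken in the extended reals. -/
noncomputable def mountainPassLevel (N : ℕ) (s p : ℝ) : EReal :=
  ⨅ γ ∈ admissiblePaths N s p, ⨆ t : unitInterval, (energy s p (γ t) : EReal)

/-- `u` is radial: `u(x)` depends only on `|x|`. -/
def IsRadial (u : Space N → ℝ) : Prop := ∀ x y : Space N, ‖x‖ = ‖y‖ → u x = u y

end MixedLaplacian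

/-! Everything follows from one fact: the best constant of the embedding of `E` into `L^p` is
attained by a radial function (`exists_minimizer`). Let `v` be a radial minimizer of `‖u‖_E` under
`∫ |u|^p = 1`, with norm `κ`. Its Euler–Lagrange equation (`form_eq_of_minimizer`) has the
multiplier `κ²`, and the multiple `Φ = κ^(2/(p-2)) v` solves the equation. With `ρ = ‖Φ‖_E` the
sharp inequality reads `ρ^(p-2) ∫ |u|^p ≤ ‖u‖_E^p`. On the Nehari manifold `‖u‖_E² = ∫ |u|^p`, so
there the inequality says `‖u‖_E ≥ ρ`, while the energy is `(1/2 - 1/p) ‖u‖_E²`; hence `Φ` has least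
energy there, and every nontrivial solution lies there. On the sphere of radius `ρ` the energy is at
least `(1/2 - 1/p) ρ²`, and inside it the energy is nonnegative, so every admissible path crosses
the sphere; a segment through `Φ` gives equality.

The functional setting is Hilbertian: a function is encoded by its jet, the pair of its weak
gradient and its weighted difference quotient in `L²`, and the norm of `E` is the norm of the jet.
Convex combinations of tails turn bounded sequences into strongly convergent ones, which gives
closedness of `E` and lower semicontinuity of its norm along almost everywhere convergence
(`MemE.of_tendsto_of_mixedNorm_le`). The two Sobolev inequalities place `E` in `L^{2^*}` and in
`L^{2_s^*}`, hence in `L^p` between them.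

Compactness of a minimizing sequence comes from symmetrization, obtained without the theory of
decreasing rearrangement. Polarization with respect to a half-space permutes the values of a
function at pairs of mirror points; it keeps the `L^p` norm and does not increase the norm of `E`
(`MemE.polarize`). Among the nonnegative competitors supported in a fixed ball one minimizes the
second moment `∫ v |x|²`. If the half-space contains the origin in its interior, polarization
strictly lowers the moment unless it fixes the function, so the minimizer is fixed by all such
polarizations and is radial and nonincreasing (`IsPolarized.exists_radial`). Monotone functions
bounded in `L^{2_s^*}` decay uniformly at infinity, which together with local compactness gives
strong convergence in `L^p`. -/

namespace MixedLaplacian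

open MeasureTheory Filter Topology
open scoped ContDiff

variable {N : ℕ}

/-! ### Strongly convergent convex combinations in a Hilbert space -/

section ConvexCombinations

variable {H : Type*} [NormedAddCommGroup H] [InnerProductSpace ℝ H] [CompleteSpace H]

/-- A closed nonempty convex subset of a Hilbert space has an element of least norm, and the distance
to it is controlled by the excess of the norm. -/
theorem exists_least_norm {K : Set H} (ne : K.Nonempty) (hK : IsClosed K) (hc : Convex ℝ K) :
    ∃ m ∈ K, (∀ w ∈ K, ‖m‖ ≤ ‖w‖) ∧ ∀ w ∈ K, ‖m - w‖ ^ 2 ≤ 2 * (‖w‖ ^ 2 - ‖m‖ ^ 2) := by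
  obtain ⟨m, hm, e⟩ := exists_norm_eq_iInf_of_complete_convex ne hK.isComplete hc 0
  have hmin : ∀ w ∈ K, ‖m‖ ≤ ‖w‖ := by
    intro w hw
    have : (⨅ w : K, ‖0 - (w : H)‖) ≤ ‖0 - w‖ :=
      ciInf_le ⟨0, by rintro _ ⟨y, rfl⟩; positivity⟩ (⟨w, hw⟩ : K)
    rw [← e] at this
    simpa using this
  refine ⟨m, hm, hmin, fun w hw => ?_⟩
  -- The midpoint has norm at least `‖m‖`; the parallelogram law then bounds `‖m - w‖²`.
  have hmid : (1 / 2 : ℝ) • m + (1 / 2 : ℝ) • w ∈ K :=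
    hc hm hw (by norm_num) (by norm_num) (by norm_num)
  have h1 := hmin _ hmid
  rw [← smul_add, norm_smul, Real.norm_of_nonneg (by norm_num)] at h1
  have h2 := parallelogram_law_with_norm ℝ m w
  nlinarith [norm_nonneg m, norm_nonneg (m + w)]

/-- From a norm-bounded sequence in a Hilbert space one can form convex combinations of its tails
that converge in norm. The combinations are formed simultaneously in a second vector space. -/
theorem exists_convexCombination_tendsto {X : Type*} [AddCommGroup X] [Module ℝ X]
    (x : ℕ → X) (h : ℕ → H) {c : ℕ → ℝ} {C : ℝ} (hc : ∀ n, ‖h n‖ ≤ c n)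
    (hC : Tendsto c atTop (𝓝 C)) :
    ∃ (w : ℕ → X × H) (k : H),
      (∀ n, w n ∈ convexHull ℝ ((fun j => (x j, h j)) '' Set.Ici n)) ∧
      Tendsto (fun n => (w n).2) atTop (𝓝 k) ∧ ‖k‖ ≤ C := by
  -- The closed hulls of the tails decrease, so their elements of least norm have increasing,
  -- bounded norms. The excess estimate then makes these elements a Cauchy sequence.
  set K : ℕ → Set H := fun n => closure (convexHull ℝ (h '' Set.Ici n)) with hK
  have hmem : ∀ n j, n ≤ j → h j ∈ K n := fun n j hj =>
    subset_closure (subset_convexHull ℝ _ ⟨j, hj, rfl⟩)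
  have hanti : ∀ n l, n ≤ l → K l ⊆ K n := fun n l hnl =>
    closure_mono (convexHull_mono (Set.image_mono (Set.Ici_subset_Ici.2 hnl)))
  choose m hmK hmin hdist using fun n =>
    exists_least_norm ⟨h n, hmem n n le_rfl⟩ isClosed_closure (convex_convexHull ℝ (h '' Set.Ici n)).closure
  have hmono : Monotone fun n => ‖m n‖ := fun n l hnl => hmin n _ (hanti n l hnl (hmK l))
  have hle : ∀ n, ‖m n‖ ≤ C := fun n => ge_of_tendsto hC <| by
    filter_upwards [eventually_ge_atTop n] with j hj
    exact (hmin n _ (hmem n j hj)).trans (hc j)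
  have hbdd : BddAbove (Set.range fun n => ‖m n‖) := ⟨C, by rintro _ ⟨n, rfl⟩; exact hle n⟩
  set L := ⨆ n, ‖m n‖ with hLdef
  have hL : Tendsto (fun n => ‖m n‖) atTop (𝓝 L) := tendsto_atTop_ciSup hmono hbdd
  have hmL : ∀ n, ‖m n‖ ≤ L := fun n => le_ciSup hbdd n
  have key : ∀ n l, n ≤ l → dist (m n) (m l) ≤ √(2 * (L ^ 2 - ‖m n‖ ^ 2)) := by
    intro n l hnl
    rw [dist_eq_norm]
    refine Real.le_sqrt_of_sq_le ((hdist n _ (hanti n l hnl (hmK l))).trans ?_)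
    have := hmL l
    gcongr
  have hcau : CauchySeq m := by
    refine cauchySeq_of_le_tendsto_0' (fun n => √(2 * (L ^ 2 - ‖m n‖ ^ 2))) key ?_
    have : Tendsto (fun n => √(2 * (L ^ 2 - ‖m n‖ ^ 2))) atTop (𝓝 (√(2 * (L ^ 2 - L ^ 2)))) :=
      ((tendsto_const_nhds.sub (hL.pow 2)).const_mul 2).sqrt
    simpa using this
  obtain ⟨k, hk⟩ := cauchySeq_tendsto_of_complete hcau
  -- A convex combination near `m n` lifts to one of the pairs, because the hull of the second
  -- components is the projection of the hull of the pairs; the same weights then serve both spaces.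
  have hex : ∀ n, ∃ w ∈ convexHull ℝ ((fun j => (x j, h j)) '' Set.Ici n),
      dist (m n) w.2 < 1 / ((n : ℝ) + 1) := by
    intro n
    obtain ⟨y, hy, hd⟩ := Metric.mem_closure_iff.1 (hmK n) (1 / ((n : ℝ) + 1)) (by positivity)
    have : h '' Set.Ici n = (LinearMap.snd ℝ X H) '' ((fun j => (x j, h j)) '' Set.Ici n) := by
      rw [Set.image_image]; rfl
    rw [this, ← LinearMap.image_convexHull] at hy
    obtain ⟨w, hw, rfl⟩ := hy
    exact ⟨w, hw, hd⟩
  choose w hw hd using hex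
  refine ⟨w, k, hw, ?_, le_of_tendsto' hk.norm hle⟩
  have hz : Tendsto (fun n => dist (m n) (w n).2) atTop (𝓝 0) :=
    squeeze_zero (fun _ => dist_nonneg) (fun n => (hd n).le) tendsto_one_div_add_atTop_nhds_zero_nat
  exact (tendsto_iff_of_dist hz).1 hk

end ConvexCombinations

/-! ### Jets: the norm of `E` as a Hilbert space norm -/

/-- The Hilbert space of pairs of a vector field and a function of two variables. -/
abbrev JetSpace (N : ℕ) :=
  WithLp 2 (Lp (Space N) 2 (volume : Measure (Space N)) ×
    Lp ℝ 2 (volume : Measure (Space N × Space N)))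

/-- The weighted difference quotient whose square is the Gagliardo integrand. -/
noncomputable def quot (s : ℝ) (u : Space N → ℝ) (z : Space N × Space N) : ℝ :=
  (u z.1 - u z.2) / ‖z.1 - z.2‖ ^ (((N : ℝ) + 2 * s) / 2)

/-- `h` consists of the weak gradient and of the weighted difference quotient of `u`. -/
structure IsJet (s : ℝ) (u : Space N → ℝ) (h : JetSpace N) : Prop where
  grad : IsWeakGradient u h.fst
  quot_eq : h.snd =ᵐ[volume] quot s u

theorem quot_mul_quot {s : ℝ} (hs : 0 < s) (u v : Space N → ℝ) (z : Space N × Space N) :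
    quot s u z * quot s v z = gagliardoKernel s u v z := by
  rw [quot, quot, gagliardoKernel, div_mul_div_comm,
    ← Real.rpow_add_of_nonneg (norm_nonneg _) (by positivity) (by positivity), add_halves]

theorem quot_add (s : ℝ) (u v : Space N → ℝ) : quot s (u + v) = quot s u + quot s v := by
  ext z; simp only [quot, Pi.add_apply]; ring

theorem quot_smul (s : ℝ) (a : ℝ) (u : Space N → ℝ) : quot s (a • u) = a • quot s u := by
  ext z; simp only [quot, Pi.smul_apply, smul_eq_mul]; ring

theorem ae_eq_prod {u v : Space N → ℝ} (h : u =ᵐ[volume] v) :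
    ∀ᵐ z : Space N × Space N, u z.1 = v z.1 ∧ u z.2 = v z.2 :=
  (Measure.quasiMeasurePreserving_fst.ae h).and (Measure.quasiMeasurePreserving_snd.ae h)

theorem quot_congr (s : ℝ) {u v : Space N → ℝ} (h : u =ᵐ[volume] v) :
    quot s u =ᵐ[volume] quot s v := by
  filter_upwards [ae_eq_prod h] with z hz
  simp only [quot, hz.1, hz.2]

theorem aestronglyMeasurable_quot (s : ℝ) {u : Space N → ℝ} (hu : AEStronglyMeasurable u volume) :
    AEStronglyMeasurable (quot s u) volume := by
  have h1 : AEStronglyMeasurable (fun z : Space N × Space N => u z.1) volume :=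
    hu.comp_quasiMeasurePreserving Measure.quasiMeasurePreserving_fst
  have h2 : AEStronglyMeasurable (fun z : Space N × Space N => u z.2) volume :=
    hu.comp_quasiMeasurePreserving Measure.quasiMeasurePreserving_snd
  have h3 : Measurable fun z : Space N × Space N => ‖z.1 - z.2‖ ^ (((N : ℝ) + 2 * s) / 2) := by
    fun_prop
  exact ((h1.sub h2).aemeasurable.div h3.aemeasurable).aestronglyMeasurable

theorem IsTest.integrable_mul {φ u : Space N → ℝ} (hφ : IsTest φ) (hu : LocallyIntegrable u) :
    Integrable fun x => u x * φ x := by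
  have := hu.integrable_smul_left_of_hasCompactSupport hφ.1.continuous hφ.2
  simpa only [smul_eq_mul, mul_comm] using this

theorem IsTest.continuous_fderiv_apply {φ : Space N → ℝ} (hφ : IsTest φ) (v : Space N) :
    Continuous fun x => fderiv ℝ φ x v :=
  (hφ.1.continuous_fderiv (by simp)).clm_apply continuous_const

theorem IsTest.hasCompactSupport_fderiv_apply {φ : Space N → ℝ} (hφ : IsTest φ) (v : Space N) :
    HasCompactSupport fun x => fderiv ℝ φ x v := by
  exact hφ.2.fderiv_apply ℝ v

theorem IsTest.integrable_mul_fderiv {φ u : Space N → ℝ} (hφ : IsTest φ)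
    (hu : LocallyIntegrable u) (v : Space N) : Integrable fun x => u x * fderiv ℝ φ x v := by
  have := hu.integrable_smul_left_of_hasCompactSupport (hφ.continuous_fderiv_apply v)
    (hφ.hasCompactSupport_fderiv_apply v)
  simpa only [smul_eq_mul, mul_comm] using this

theorem IsTest.integrable_inner_mul {φ : Space N → ℝ} (hφ : IsTest φ) {G : Space N → Space N}
    (hG : MemLp G 2) (v : Space N) : Integrable fun x => inner ℝ (G x) v * φ x := by
  have h : LocallyIntegrable fun x => inner ℝ (G x) v :=
    (hG.inner_const v).locallyIntegrable (by norm_num)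
  exact hφ.integrable_mul h

theorem IsWeakGradient.add {u v : Space N → ℝ} {G H : Space N → Space N}
    (hu : IsWeakGradient u G) (hv : IsWeakGradient v H) : IsWeakGradient (u + v) (G + H) where
  locallyIntegrable := hu.1.add hv.1
  memLp := hu.2.add hv.2
  integral_eq φ hφ w := by
    simp only [Pi.add_apply, inner_add_left, add_mul]
    rw [integral_add (hφ.integrable_mul_fderiv hu.1 w) (hφ.integrable_mul_fderiv hv.1 w),
      integral_add (hφ.integrable_inner_mul hu.2 w) (hφ.integrable_inner_mul hv.2 w),
      hu.3 φ hφ w, hv.3 φ hφ w, neg_add]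

theorem IsWeakGradient.smul {u : Space N → ℝ} {G : Space N → Space N}
    (hu : IsWeakGradient u G) (a : ℝ) : IsWeakGradient (a • u) (a • G) where
  locallyIntegrable := hu.1.smul a
  memLp := hu.2.const_smul a
  integral_eq φ hφ w := by
    simp only [Pi.smul_apply, smul_eq_mul, inner_smul_left, mul_assoc, integral_const_mul]
    rw [hu.3 φ hφ w]
    simp

theorem LocallyIntegrable.congr_ae {u v : Space N → ℝ} (hu : LocallyIntegrable u)
    (h : u =ᵐ[volume] v) : LocallyIntegrable v := fun x => by
  obtain ⟨U, hU, hi⟩ := hu x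
  exact ⟨U, hU, hi.congr (ae_restrict_of_ae h)⟩

theorem IsWeakGradient.congr {u v : Space N → ℝ} {G H : Space N → Space N}
    (hu : IsWeakGradient u G) (h : u =ᵐ[volume] v) (hGH : G =ᵐ[volume] H) :
    IsWeakGradient v H where
  locallyIntegrable := LocallyIntegrable.congr_ae hu.1 h
  memLp := (memLp_congr_ae hGH).1 hu.2
  integral_eq φ hφ w := by
    have e1 : ∫ x, v x * fderiv ℝ φ x w = ∫ x, u x * fderiv ℝ φ x w :=
      integral_congr_ae (by filter_upwards [h] with x hx; rw [hx])
    have e2 : ∫ x, inner ℝ (H x) w * φ x = ∫ x, inner ℝ (G x) w * φ x :=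
      integral_congr_ae (by filter_upwards [hGH] with x hx; rw [hx])
    rw [e1, e2, hu.3 φ hφ w]

theorem IsJet.add {s : ℝ} {u v : Space N → ℝ} {h k : JetSpace N} (hu : IsJet s u h)
    (hv : IsJet s v k) : IsJet s (u + v) (h + k) where
  grad := (hu.1.add hv.1).congr ae_eq_rfl (Lp.coeFn_add _ _).symm
  quot_eq := by
    rw [quot_add]
    exact (Lp.coeFn_add _ _).trans (hu.2.add hv.2)

theorem IsJet.smul {s : ℝ} {u : Space N → ℝ} {h : JetSpace N} (hu : IsJet s u h) (a : ℝ) :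
    IsJet s (a • u) (a • h) where
  grad := (hu.1.smul a).congr ae_eq_rfl (Lp.coeFn_smul _ _).symm
  quot_eq := by
    rw [quot_smul]
    exact (Lp.coeFn_smul _ _).trans (hu.2.const_smul a)

theorem IsJet.sub {s : ℝ} {u v : Space N → ℝ} {h k : JetSpace N} (hu : IsJet s u h)
    (hv : IsJet s v k) : IsJet s (u - v) (h - k) := by
  have := hu.add (hv.smul (-1))
  simpa [sub_eq_add_neg] using this

theorem IsJet.congr {s : ℝ} {u v : Space N → ℝ} {h : JetSpace N} (hu : IsJet s u h)
    (huv : u =ᵐ[volume] v) : IsJet s v h :=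
  ⟨hu.1.congr huv ae_eq_rfl, hu.2.trans (quot_congr s huv)⟩

theorem IsJet.weakGrad_ae_eq {s : ℝ} {u : Space N → ℝ} {h : JetSpace N} (hu : IsJet s u h) :
    weakGrad u =ᵐ[volume] h.fst :=
  (isWeakGradient_weakGrad ⟨_, hu.1⟩).ae_eq hu.1

/-- The bridge to Hilbert space geometry: through it the norm and both bilinear forms obey the
triangle inequality and the expansion of squares. -/
theorem IsJet.form_eq {s : ℝ} (hs : 0 < s) {u v : Space N → ℝ} {h k : JetSpace N}
    (hu : IsJet s u h) (hv : IsJet s v k) :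
    dirichletForm u v + gagliardoForm s u v = inner ℝ h k := by
  rw [WithLp.prod_inner_apply, L2.inner_def, L2.inner_def, dirichletForm, gagliardoForm]
  congr 1
  · refine integral_congr_ae ?_
    filter_upwards [hu.weakGrad_ae_eq, hv.weakGrad_ae_eq] with x h1 h2
    rw [h1, h2]; rfl
  · refine integral_congr_ae ?_
    filter_upwards [hu.2, hv.2] with z h1 h2
    rw [← quot_mul_quot hs, ← h1, ← h2]
    simp [mul_comm]

theorem IsJet.mixedNorm_eq {s : ℝ} (hs : 0 < s) {u : Space N → ℝ} {h : JetSpace N}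
    (hu : IsJet s u h) : mixedNorm s u = ‖h‖ := by
  rw [mixedNorm, hu.form_eq hs hu, real_inner_self_eq_norm_sq, Real.sqrt_sq (norm_nonneg _)]

theorem IsJet.of_memLp {s : ℝ} {u : Space N → ℝ} {G : Space N → Space N}
    (hG : IsWeakGradient u G) (hq : MemLp (quot s u) 2) :
    IsJet s u (WithLp.toLp 2 (hG.memLp.toLp G, hq.toLp _)) where
  grad := hG.congr ae_eq_rfl (MemLp.coeFn_toLp hG.memLp).symm
  quot_eq := MemLp.coeFn_toLp hq

theorem IsJet.memLp_quot {s : ℝ} {u : Space N → ℝ} {h : JetSpace N} (hu : IsJet s u h) :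
    MemLp (quot s u) 2 :=
  (memLp_congr_ae hu.2).1 (Lp.memLp _)

theorem IsJet.integrable_gagliardoKernel {s : ℝ} (hs : 0 < s) {u : Space N → ℝ} {h : JetSpace N}
    (hu : IsJet s u h) : Integrable (gagliardoKernel s u u) := by
  have := hu.memLp_quot.integrable_sq
  refine this.congr (Eventually.of_forall fun z => ?_)
  simp only [sq, quot_mul_quot hs]

theorem MemE.exists_jet {s : ℝ} (hs : 0 < s) {u : Space N → ℝ} (hu : MemE s u) :
    ∃ h, IsJet s u h := by
  obtain ⟨G, hG⟩ := hu.exists_weakGradient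
  have hq : MemLp (quot s u) 2 := by
    rw [memLp_two_iff_integrable_sq (aestronglyMeasurable_quot s hu.memLp.1)]
    refine hu.integrable_gagliardo.congr (Eventually.of_forall fun z => ?_)
    simp only [sq, quot_mul_quot hs]
  exact ⟨_, IsJet.of_memLp hG hq⟩

theorem mixedNorm_zero (s : ℝ) (hs : 0 < s) : mixedNorm s (0 : Space N → ℝ) = 0 := by
  have hz : IsWeakGradient (0 : Space N → ℝ) 0 :=
    ⟨locallyIntegrable_zero, MemLp.zero, fun φ _ v => by simp⟩
  have hq : quot s (0 : Space N → ℝ) = 0 := by ext z; simp [quot]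
  have hj : IsJet s (0 : Space N → ℝ) 0 :=
    ⟨hz.congr ae_eq_rfl (Lp.coeFn_zero _ _ _).symm, by rw [hq]; exact Lp.coeFn_zero _ _ _⟩
  rw [hj.mixedNorm_eq hs, norm_zero]

theorem mixedNorm_nonneg (s : ℝ) (u : Space N → ℝ) : 0 ≤ mixedNorm s u := Real.sqrt_nonneg _

theorem mixedNorm_smul (s : ℝ) (hs : 0 < s) {u : Space N → ℝ} (hu : ∃ h, IsJet s u h) (a : ℝ) :
    mixedNorm s (a • u) = |a| * mixedNorm s u := by
  obtain ⟨h, hh⟩ := hu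
  rw [hh.mixedNorm_eq hs, (hh.smul a).mixedNorm_eq hs, norm_smul, Real.norm_eq_abs]

/-! ### Lipschitz functions with compact support have jets -/

theorem nontrivial_space (hN : 0 < N) : Nontrivial (Space N) := by
  have : Nonempty (Fin N) := ⟨⟨0, hN⟩⟩
  infer_instance

theorem norm_gradient_eq (f : Space N → ℝ) (x : Space N) : ‖gradient f x‖ = ‖fderiv ℝ f x‖ := by
  rw [gradient, LinearIsometryEquiv.norm_map]

theorem measurable_gradient (f : Space N → ℝ) : Measurable (gradient f) :=
  (InnerProductSpace.toDual ℝ (Space N)).symm.continuous.measurable.comp (measurable_fderiv ℝ f)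

theorem norm_gradient_le_indicator {f : Space N → ℝ} {K : NNReal} (hf : LipschitzWith K f)
    {S : Set (Space N)} (hS : tsupport f ⊆ S) (x : Space N) :
    ‖gradient f x‖ ≤ S.indicator (fun _ => (K : ℝ)) x := by
  rw [norm_gradient_eq]
  by_cases hx : x ∈ S
  · rw [Set.indicator_of_mem hx]
    exact norm_fderiv_le_of_lipschitz ℝ hf
  · have : fderiv ℝ f x = 0 := by
      by_contra h
      exact hx (hS (support_fderiv_subset ℝ h))
    rw [this, norm_zero, Set.indicator_of_notMem hx]

theorem memLp_gradient {f : Space N → ℝ} {K : NNReal} (hf : LipschitzWith K f)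
    (hc : HasCompactSupport f) : MemLp (gradient f) 2 := by
  have h1 : MemLp ((tsupport f).indicator fun _ => (K : ℝ)) 2 :=
    memLp_indicator_const 2 (isClosed_tsupport f).measurableSet _
      (Or.inr hc.isCompact.measure_lt_top.ne)
  refine h1.mono (measurable_gradient f).aestronglyMeasurable (Eventually.of_forall fun x => ?_)
  exact (norm_gradient_le_indicator hf subset_rfl x).trans (le_abs_self _)

/-- By Rademacher's theorem the pointwise gradient exists almost everywhere; integration by parts
for line derivatives of Lipschitz functions does the rest. -/
theorem isWeakGradient_gradient {f : Space N → ℝ} {K : NNReal} (hf : LipschitzWith K f)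
    (hc : HasCompactSupport f) : IsWeakGradient f (gradient f) where
  locallyIntegrable := hf.continuous.locallyIntegrable
  memLp := memLp_gradient hf hc
  integral_eq φ hφ v := by
    obtain ⟨D, hD⟩ := hφ.1.lipschitzWith_of_hasCompactSupport hφ.2 (by simp)
    have h := hf.integral_lineDeriv_mul_eq (μ := volume) hD hφ.2 v
    have e1 : ∫ x, lineDeriv ℝ f x v * φ x = ∫ x, inner ℝ (gradient f x) v * φ x := by
      refine integral_congr_ae ?_
      filter_upwards [hf.ae_differentiableAt (μ := volume)] with x hx
      rw [hx.lineDeriv_eq_fderiv, inner_gradient_left]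
    have e2 : ∫ x, lineDeriv ℝ φ x (-v) * f x = - ∫ x, f x * fderiv ℝ φ x v := by
      rw [← integral_neg]
      refine integral_congr_ae (Eventually.of_forall fun x => ?_)
      have : DifferentiableAt ℝ φ x := (hφ.1.differentiable (by simp)).differentiableAt
      simp only [this.lineDeriv_eq_fderiv, map_neg]
      ring
    rw [← e1, h, e2, neg_neg]

/-- In polar coordinates the integrand is `r^(1-2s)` on `(0, 1]`, integrable since `s < 1`, and
`r^(-1-2s)` beyond, integrable since `s > 0`. -/
theorem integrable_gagliardo_weight (hN : 0 < N) {s : ℝ} (hs₀ : 0 < s) (hs₁ : s < 1) :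
    Integrable fun z : Space N => min (‖z‖ ^ 2) 1 / ‖z‖ ^ ((N : ℝ) + 2 * s) := by
  have := nontrivial_space hN
  have h := integrable_fun_norm_addHaar (volume : Measure (Space N))
    (f := fun r : ℝ => min (r ^ 2) 1 / r ^ ((N : ℝ) + 2 * s))
  rw [h, finrank_euclideanSpace_fin, ← Set.Ioc_union_Ioi_eq_Ioi zero_le_one]
  have hp : ∀ r : ℝ, 0 < r → ∀ a : ℝ, r ^ (N - 1) * (r ^ a / r ^ ((N : ℝ) + 2 * s)) =
      r ^ (a - 1 - 2 * s) := by
    intro r hr a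
    rw [← Real.rpow_sub hr, ← Real.rpow_natCast, ← Real.rpow_add hr]
    congr 1
    push_cast [Nat.cast_sub (Nat.one_le_iff_ne_zero.2 hN.ne')]
    ring
  refine IntegrableOn.union ?_ ?_
  · have h1 : IntegrableOn (fun r : ℝ => r ^ (1 - 2 * s)) (Set.Ioc 0 1) := by
      rw [integrableOn_Ioc_iff_integrableOn_Ioo,
        intervalIntegral.integrableOn_Ioo_rpow_iff one_pos]
      linarith
    refine h1.congr_fun (fun r hr => ?_) measurableSet_Ioc
    have : min (r ^ 2) 1 = r ^ (2 : ℝ) := by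
      rw [Real.rpow_two, min_eq_left]
      nlinarith [hr.1, hr.2]
    simp only [smul_eq_mul, this, hp r hr.1]
    congr 1; ring
  · have h1 : IntegrableOn (fun r : ℝ => r ^ (- 1 - 2 * s)) (Set.Ioi 1) :=
      integrableOn_Ioi_rpow_of_lt (by linarith) one_pos
    refine h1.congr_fun (fun r hr => ?_) measurableSet_Ioi
    have hr : 1 < r := hr
    have : min (r ^ 2) 1 = r ^ (0 : ℝ) := by
      rw [Real.rpow_zero, min_eq_right]
      nlinarith
    simp only [smul_eq_mul, this, hp r (one_pos.trans hr)]
    congr 1; ring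

theorem measurable_gagliardoKernel (s : ℝ) {u : Space N → ℝ} (hu : Measurable u) :
    Measurable (gagliardoKernel s u u) := by
  unfold gagliardoKernel
  have h1 : Measurable fun z : Space N × Space N => u z.1 := hu.comp measurable_fst
  have h2 : Measurable fun z : Space N × Space N => u z.2 := hu.comp measurable_snd
  fun_prop

theorem gagliardoKernel_self_nonneg (s : ℝ) (u : Space N → ℝ) (z : Space N × Space N) :
    0 ≤ gagliardoKernel s u u z :=
  div_nonneg (mul_self_nonneg _) (Real.rpow_nonneg (norm_nonneg _) _)

/-- An integrable function that dominates the Gagliardo kernels of all functions with given bounds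
on the Lipschitz constant, the supremum and the support. -/
theorem exists_integrable_gagliardo_majorant (hN : 0 < N) {s : ℝ} (hs₀ : 0 < s) (hs₁ : s < 1)
    {S : Set (Space N)} (hS : IsCompact S) (K : NNReal) (M : ℝ) :
    ∃ g : Space N × Space N → ℝ, Integrable g ∧ ∀ f : Space N → ℝ, LipschitzWith K f →
      (∀ x, ‖f x‖ ≤ M) → tsupport f ⊆ S → ∀ z, gagliardoKernel s f f z ≤ g z := by
  set ψ : Space N → ℝ := fun z => min (‖z‖ ^ 2) 1 / ‖z‖ ^ ((N : ℝ) + 2 * s) with hψ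
  have iψ : Integrable ψ := integrable_gagliardo_weight hN hs₀ hs₁
  set χ : Space N → ℝ := S.indicator fun _ => (1 : ℝ) with hχ
  have iχ : Integrable χ := by
    rw [hχ, integrable_indicator_iff hS.measurableSet]
    exact integrableOn_const hS.measure_lt_top.ne
  have i1 : Integrable fun z : Space N × Space N => χ z.2 * ψ (z.1 - z.2) := by
    exact iχ.convolution_integrand (ContinuousLinearMap.mul ℝ ℝ) iψ
  have i2 : Integrable fun z : Space N × Space N => χ z.1 * ψ (z.1 - z.2) := by
    have := i1.swap
    refine this.congr (Eventually.of_forall fun z => ?_)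
    simp only [Function.comp, Prod.fst_swap, Prod.snd_swap, hψ, norm_sub_rev]
  -- A difference of values is at most `K ‖x - y‖` and at most `2 M`; squared, both bounds are
  -- covered by `C min(‖x - y‖², 1)`.
  set C : ℝ := (max (K : ℝ) (2 * M)) ^ 2
  refine ⟨_, (i1.add i2).const_mul C, fun f hf hM hfS z => ?_⟩
  rw [Pi.add_apply, ← add_mul, hψ, gagliardoKernel]
  dsimp only
  rw [← mul_div_assoc, ← mul_div_assoc]
  refine div_le_div_of_nonneg_right ?_ (by positivity)
  have hχ0 : ∀ x, 0 ≤ χ x := fun x => Set.indicator_nonneg (fun _ _ => zero_le_one) x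
  have hχ1 : ∀ x, f x ≠ 0 → χ x = 1 := fun x hx =>
    Set.indicator_of_mem (hfS (subset_tsupport f hx)) _
  by_cases h : f z.1 = 0 ∧ f z.2 = 0
  · rw [h.1, h.2]
    have := hχ0 z.1
    have := hχ0 z.2
    simp only [sub_self, mul_zero]
    positivity
  -- The kernel vanishes unless one of the two points lies in `S`.
  · have hone : 1 ≤ χ z.2 + χ z.1 := by
      rcases not_and_or.1 h with h | h
      · rw [hχ1 _ h]; linarith [hχ0 z.2]
      · rw [hχ1 _ h]; linarith [hχ0 z.1]
    have hd : (f z.1 - f z.2) * (f z.1 - f z.2) ≤ C * min (‖z.1 - z.2‖ ^ 2) 1 := by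
      rw [← sq, ← sq_abs]
      have a1 : |f z.1 - f z.2| ≤ max (K : ℝ) (2 * M) * ‖z.1 - z.2‖ := by
        have := hf.dist_le_mul z.1 z.2
        rw [Real.dist_eq, dist_eq_norm] at this
        exact this.trans (mul_le_mul_of_nonneg_right (le_max_left _ _) (norm_nonneg _))
      have a2 : |f z.1 - f z.2| ≤ max (K : ℝ) (2 * M) * 1 := by
        have h1 := hM z.1
        have h2 := hM z.2
        rw [Real.norm_eq_abs] at h1 h2
        have := abs_sub (f z.1) (f z.2)
        rw [mul_one]
        exact le_trans (by linarith) (le_max_right _ _)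
      rcases le_total (‖z.1 - z.2‖ ^ 2) 1 with h' | h'
      · rw [min_eq_left h', ← mul_pow]
        exact pow_le_pow_left₀ (abs_nonneg _) a1 2
      · rw [min_eq_right h']
        calc |f z.1 - f z.2| ^ 2 ≤ (max (K : ℝ) (2 * M) * 1) ^ 2 := pow_le_pow_left₀ (abs_nonneg _) a2 2
          _ = C * 1 := by rw [mul_one, mul_one]
    have hnn : 0 ≤ C * min (‖z.1 - z.2‖ ^ 2) 1 := by positivity
    calc _ ≤ C * min (‖z.1 - z.2‖ ^ 2) 1 := hd
      _ ≤ (χ z.2 + χ z.1) * (C * min (‖z.1 - z.2‖ ^ 2) 1) := le_mul_of_one_le_left hnn hone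
      _ = _ := by ring

theorem integrable_gagliardoKernel_of_lipschitz (hN : 0 < N) {s : ℝ} (hs₀ : 0 < s) (hs₁ : s < 1)
    {f : Space N → ℝ} {K : NNReal} (hf : LipschitzWith K f) (hc : HasCompactSupport f) :
    Integrable (gagliardoKernel s f f) := by
  obtain ⟨M, hM⟩ := hf.continuous.bounded_above_of_compact_support hc
  obtain ⟨g, hg, h⟩ := exists_integrable_gagliardo_majorant hN hs₀ hs₁ hc.isCompact K M
  refine hg.mono' (measurable_gagliardoKernel s hf.continuous.measurable).aestronglyMeasurable
    (Eventually.of_forall fun z => ?_)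
  rw [Real.norm_of_nonneg (gagliardoKernel_self_nonneg s f z)]
  exact h f hf hM subset_rfl z

theorem exists_isJet_of_integrable {s : ℝ} (hs : 0 < s) {u : Space N → ℝ} {G : Space N → Space N}
    (hG : IsWeakGradient u G) (hi : Integrable (gagliardoKernel s u u)) : ∃ h, IsJet s u h := by
  have hq : MemLp (quot s u) 2 := by
    rw [memLp_two_iff_integrable_sq
      (aestronglyMeasurable_quot s hG.locallyIntegrable.aestronglyMeasurable)]
    refine hi.congr (Eventually.of_forall fun z => ?_)
    simp only [sq, quot_mul_quot hs]
  exact ⟨_, IsJet.of_memLp hG hq⟩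

theorem exists_isJet_of_lipschitz (hN : 0 < N) {s : ℝ} (hs₀ : 0 < s) (hs₁ : s < 1)
    {f : Space N → ℝ} {K : NNReal} (hf : LipschitzWith K f) (hc : HasCompactSupport f) :
    ∃ h, IsJet s f h :=
  exists_isJet_of_integrable hs₀ (isWeakGradient_gradient hf hc)
    (integrable_gagliardoKernel_of_lipschitz hN hs₀ hs₁ hf hc)

theorem IsTest.exists_lipschitzWith {φ : Space N → ℝ} (hφ : IsTest φ) : ∃ K, LipschitzWith K φ :=
  hφ.1.lipschitzWith_of_hasCompactSupport hφ.2 (by simp)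

theorem IsTest.exists_jet (hN : 0 < N) {s : ℝ} (hs₀ : 0 < s) (hs₁ : s < 1)
    {φ : Space N → ℝ} (hφ : IsTest φ) : ∃ h, IsJet s φ h :=
  let ⟨_, hK⟩ := hφ.exists_lipschitzWith
  exists_isJet_of_lipschitz hN hs₀ hs₁ hK hφ.2

theorem IsTest.memE (hN : 0 < N) {s : ℝ} (hs₀ : 0 < s) (hs₁ : s < 1)
    {φ : Space N → ℝ} (hφ : IsTest φ) : MemE s φ where
  memLp := hφ.1.continuous.memLp_of_hasCompactSupport hφ.2
  exists_weakGradient := let ⟨_, hh⟩ := hφ.exists_jet hN hs₀ hs₁; ⟨_, hh.1⟩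
  integrable_gagliardo := let ⟨_, hh⟩ := hφ.exists_jet hN hs₀ hs₁; hh.integrable_gagliardoKernel hs₀
  exists_approx := ⟨fun _ => φ, fun _ => hφ, by
    simp only [sub_self, mixedNorm_zero s hs₀]; exact tendsto_const_nhds⟩

/-! ### Sobolev inequalities for test functions -/

section Exponents

variable {s : ℝ}

theorem two_lt_fracCritExp (hN : 3 ≤ N) (hs₀ : 0 < s) (hs₁ : s < 1) : 2 < fracCritExp N s := by
  have : (3 : ℝ) ≤ N := by exact_mod_cast hN
  rw [fracCritExp, lt_div_iff₀ (by linarith)]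
  linarith

theorem two_lt_critExp (hN : 3 ≤ N) : 2 < critExp N := by
  have : (3 : ℝ) ≤ N := by exact_mod_cast hN
  rw [critExp, lt_div_iff₀ (by linarith)]
  linarith

end Exponents

theorem eLpNorm_gradient_le {s : ℝ} (hs : 0 < s) {u : Space N → ℝ} {h : JetSpace N}
    (hu : IsJet s u h) {G : Space N → Space N} (hG : IsWeakGradient u G) :
    eLpNorm G 2 ≤ ENNReal.ofReal (mixedNorm s u) := by
  rw [hu.mixedNorm_eq hs, eLpNorm_congr_ae (hG.ae_eq hu.1),
    ← ENNReal.ofReal_toReal (Lp.eLpNorm_ne_top h.fst), ← Lp.norm_def]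
  refine ENNReal.ofReal_le_ofReal ?_
  have := WithLp.prod_norm_sq_eq_of_L2 h
  nlinarith [norm_nonneg h, norm_nonneg h.fst, sq_nonneg ‖h.snd‖]

theorem gagliardoForm_le_mixedNorm_sq {s : ℝ} (hs : 0 < s) {u : Space N → ℝ} {h : JetSpace N}
    (hu : IsJet s u h) : gagliardoForm s u u ≤ mixedNorm s u ^ 2 := by
  rw [mixedNorm, Real.sq_sqrt]
  · have : 0 ≤ dirichletForm u u := integral_nonneg fun x => real_inner_self_nonneg
    linarith
  · rw [hu.form_eq hs hu]; exact real_inner_self_nonneg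

/-- The Sobolev inequality for test functions. -/
theorem exists_eLpNorm_critExp_le (hN : 3 ≤ N) {s : ℝ} (hs₀ : 0 < s) (hs₁ : s < 1) :
    ∃ C : NNReal, ∀ φ : Space N → ℝ, IsTest φ →
      eLpNorm φ (ENNReal.ofReal (critExp N)) ≤ C * ENNReal.ofReal (mixedNorm s φ) := by
  refine ⟨SNormLESNormFDerivOfEqConst ℝ (volume : Measure (Space N)) (2 : NNReal), fun φ hφ => ?_⟩
  have hN' : (3 : ℝ) ≤ N := by exact_mod_cast hN
  obtain ⟨K, hK⟩ := hφ.exists_lipschitzWith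
  obtain ⟨h, hh⟩ := hφ.exists_jet (by omega) hs₀ hs₁
  -- The relation `1/2^* = 1/2 - 1/N` required by the Gagliardo–Nirenberg–Sobolev inequality with
  -- gradient exponent 2.
  have hp' : (((critExp N).toNNReal : NNReal) : ℝ)⁻¹ =
      ((2 : NNReal) : ℝ)⁻¹ - (Module.finrank ℝ (Space N) : ℝ)⁻¹ := by
    rw [finrank_euclideanSpace_fin, Real.coe_toNNReal _ (by linarith [two_lt_critExp hN]), critExp]
    have : (N : ℝ) - 2 ≠ 0 := by linarith
    push_cast
    field_simp
  have h1 := eLpNorm_le_eLpNorm_fderiv_of_eq (volume : Measure (Space N)) (u := φ) (p := 2)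
    (hφ.1.of_le (by exact_mod_cast le_top)) hφ.2 (by norm_num)
    (by rw [finrank_euclideanSpace_fin]; omega) hp'
  refine h1.trans ?_
  gcongr
  have h2 := eLpNorm_gradient_le hs₀ hh (isWeakGradient_gradient hK hφ.2)
  refine le_trans (le_of_eq ?_) h2
  refine eLpNorm_congr_norm_ae (Eventually.of_forall fun x => ?_)
  rw [norm_gradient_eq]

/-- Chebyshev's inequality together with the choice of a suitable ball: the inner integral of the
Gagliardo kernel bounds a power of the function. -/
theorem rpow_le_lintegral_gagliardoKernel (hN : 3 ≤ N) {s : ℝ} (hs₀ : 0 < s) (hs₁ : s < 1) :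
    ∃ c : ℝ, 0 < c ∧ ∀ u : Space N → ℝ, Measurable u →
      Integrable (fun x => |u x| ^ fracCritExp N s) → 0 < ∫ x, |u x| ^ fracCritExp N s →
      ∀ x, ENNReal.ofReal (c * (∫ x, |u x| ^ fracCritExp N s) ^ (-(2 * s / N)) *
        |u x| ^ fracCritExp N s) ≤ ∫⁻ y, ENNReal.ofReal (gagliardoKernel s u u (x, y)) := by
  have hN' : (3 : ℝ) ≤ N := by exact_mod_cast hN
  have := nontrivial_space (N := N) (by omega)
  set q := fracCritExp N s with hq
  have hq2 : 2 < q := two_lt_fracCritExp hN hs₀ hs₁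
  set β : ℝ := (volume (Metric.ball (0 : Space N) 1)).toReal with hβ
  have hβ0 : 0 < β := ENNReal.toReal_pos (Metric.measure_ball_pos _ _ one_pos).ne'
    measure_ball_lt_top.ne
  refine ⟨1 / 4 * (2 / β) ^ (-(1 + 2 * s / N)) * (2 ^ q) ^ (-(2 * s / N)), by positivity,
    fun u hu hi ha x => ?_⟩
  set a := ∫ x, |u x| ^ q with had
  rcases eq_or_ne (u x) 0 with h0 | h0
  · rw [h0, abs_zero, Real.zero_rpow (by linarith), mul_zero, ENNReal.ofReal_zero]
    exact zero_le
  set τ := |u x| with hτ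
  have hτ0 : 0 < τ := abs_pos.2 h0
  -- Chebyshev's bound for the measure of the set where `|u|` is at least half its value at `x`.
  set m : ℝ := a * (2 / τ) ^ q with hm
  have hm0 : 0 < m := by positivity
  set E : Set (Space N) := {y | τ / 2 ≤ |u y|} with hE
  have hEm : MeasurableSet E := measurableSet_le measurable_const hu.abs
  have hEvol : volume E ≤ ENNReal.ofReal m := by
    have h1 := mul_meas_ge_le_integral_of_nonneg
      (Eventually.of_forall fun y => Real.rpow_nonneg (abs_nonneg (u y)) q) hi ((τ / 2) ^ q)
    have h2 : {y | (τ / 2) ^ q ≤ |u y| ^ q} = E := by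
      ext y
      exact Real.rpow_le_rpow_iff (by positivity) (abs_nonneg _) (by linarith)
    have h3 : volume {y | (τ / 2) ^ q ≤ |u y| ^ q} < ⊤ :=
      hi.measure_ge_lt_top (by positivity)
    rw [h2] at h1 h3
    rw [← ENNReal.ofReal_toReal h3.ne]
    refine ENNReal.ofReal_le_ofReal ?_
    have h4 : (2 / τ) ^ q * (τ / 2) ^ q = 1 := by
      rw [← Real.mul_rpow (by positivity) (by positivity)]
      have : 2 / τ * (τ / 2) = 1 := by field_simp
      rw [this, Real.one_rpow]
    calc (volume E).toReal = (2 / τ) ^ q * ((τ / 2) ^ q * volume.real E) := by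
          rw [← mul_assoc, h4, one_mul]; rfl
      _ ≤ (2 / τ) ^ q * a := mul_le_mul_of_nonneg_left h1 (by positivity)
      _ = m := mul_comm _ _
  -- The ball of this radius has volume `2 m`, so at least the volume `m` of it lies where `|u|` is
  -- below `τ / 2`. There the numerator of the kernel is at least `(τ / 2)²`.
  set r : ℝ := (2 * m / β) ^ (1 / (N : ℝ)) with hr
  have hr0 : 0 < r := by positivity
  have hrN : r ^ N = 2 * m / β := by
    rw [← Real.rpow_natCast, hr, ← Real.rpow_mul (by positivity), one_div_mul_cancel (by linarith),
      Real.rpow_one]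
  have hball : volume (Metric.ball x r) = ENNReal.ofReal (2 * m) := by
    rw [Measure.addHaar_ball _ _ hr0.le, finrank_euclideanSpace_fin, hrN,
      ← ENNReal.ofReal_toReal (measure_ball_lt_top (x := (0 : Space N)) (r := 1)).ne, ← hβ,
      ← ENNReal.ofReal_mul (by positivity), div_mul_cancel₀ _ hβ0.ne']
  have hdiff : ENNReal.ofReal m ≤ volume (Metric.ball x r \ E) := by
    calc ENNReal.ofReal m = ENNReal.ofReal (2 * m) - ENNReal.ofReal m := by
          rw [← ENNReal.ofReal_sub _ hm0.le]; congr 1; ring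
      _ ≤ volume (Metric.ball x r) - volume E := by rw [hball]; gcongr
      _ ≤ _ := le_measure_sdiff
  set κ : ℝ := (τ / 2) ^ 2 / r ^ ((N : ℝ) + 2 * s) with hκ
  have hκ0 : 0 ≤ κ := by positivity
  have hker : ∀ y ∈ Metric.ball x r \ E, κ ≤ gagliardoKernel s u u (x, y) := by
    intro y hy
    have hyE : |u y| < τ / 2 := not_le.1 hy.2
    have hd : ‖x - y‖ < r := by rw [← dist_eq_norm, dist_comm]; exact hy.1
    have hne : 0 < ‖x - y‖ := by
      rw [norm_pos_iff, sub_ne_zero]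
      rintro rfl
      linarith
    have habs : τ / 2 ≤ |u x - u y| := by
      have := abs_sub_abs_le_abs_sub (u x) (u y)
      linarith
    rw [hκ, gagliardoKernel]
    dsimp only
    rw [← sq (u x - u y), ← sq_abs (u x - u y)]
    gcongr
  calc ENNReal.ofReal (1 / 4 * (2 / β) ^ (-(1 + 2 * s / N)) * (2 ^ q) ^ (-(2 * s / N)) *
        a ^ (-(2 * s / N)) * τ ^ q) = ENNReal.ofReal (κ * m) := by
        congr 1
        have e1 : r ^ ((N : ℝ) + 2 * s) = (2 / β) ^ (1 + 2 * s / N) * m ^ (1 + 2 * s / N) := by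
          rw [hr, ← Real.rpow_mul (by positivity), ← Real.mul_rpow (by positivity) hm0.le]
          congr 1
          · ring
          · field_simp
        have e2 : m ^ (-(1 + 2 * s / N)) * m = m ^ (-(2 * s / N)) := by
          nth_rewrite 2 [← Real.rpow_one m]
          rw [← Real.rpow_add hm0]; congr 1; ring
        -- The power of `τ` comes out right because `q · 2s/N = q - 2` for `q = 2N/(N - 2s)`.
        have e3 : m ^ (-(2 * s / N)) = a ^ (-(2 * s / N)) * ((2 ^ q) ^ (-(2 * s / N)) *
            τ ^ (q - 2)) := by
          rw [hm, Real.mul_rpow ha.le (by positivity), Real.div_rpow zero_le_two hτ0.le,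
            Real.div_rpow (by positivity) (by positivity), ← Real.rpow_mul hτ0.le,
            div_eq_mul_inv (((2 : ℝ) ^ q) ^ (-(2 * s / (N : ℝ)))), ← Real.rpow_neg hτ0.le]
          congr 3
          rw [hq, fracCritExp]
          have h1 : (N : ℝ) - 2 * s ≠ 0 := by linarith
          field_simp
          ring
        have e4 : τ ^ (q - 2) * τ ^ 2 = τ ^ q := by
          rw [← Real.rpow_two, ← Real.rpow_add hτ0]; congr 1; ring
        rw [hκ, e1, div_eq_mul_inv ((τ / 2) ^ 2), mul_inv, ← Real.rpow_neg (by positivity),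
          ← Real.rpow_neg hm0.le, ← e4]
        calc _ = 1 / 4 * τ ^ 2 * (2 / β) ^ (-(1 + 2 * s / N)) * (a ^ (-(2 * s / N)) *
              ((2 ^ q) ^ (-(2 * s / N)) * τ ^ (q - 2))) := by ring
          _ = _ := by rw [← e3, ← e2]; ring
    _ = ENNReal.ofReal κ * ENNReal.ofReal m := ENNReal.ofReal_mul hκ0
    _ ≤ ENNReal.ofReal κ * volume (Metric.ball x r \ E) := by gcongr
    _ = ∫⁻ _ in Metric.ball x r \ E, ENNReal.ofReal κ := (setLIntegral_const _ _).symm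
    _ ≤ ∫⁻ y in Metric.ball x r \ E, ENNReal.ofReal (gagliardoKernel s u u (x, y)) :=
        setLIntegral_mono' (measurableSet_ball.diff hEm) fun y hy =>
          ENNReal.ofReal_le_ofReal (hker y hy)
    _ ≤ _ := setLIntegral_le_lintegral _ _

/-- The fractional Sobolev inequality, for functions that are a priori in the target space. -/
theorem exists_integral_fracCritExp_le (hN : 3 ≤ N) {s : ℝ} (hs₀ : 0 < s) (hs₁ : s < 1) :
    ∃ C : ℝ, 0 < C ∧ ∀ u : Space N → ℝ, Measurable u →
      Integrable (fun x => |u x| ^ fracCritExp N s) → Integrable (gagliardoKernel s u u) →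
      (∫ x, |u x| ^ fracCritExp N s) ^ (2 / fracCritExp N s) ≤ C * gagliardoForm s u u := by
  have hN' : (3 : ℝ) ≤ N := by exact_mod_cast hN
  obtain ⟨c, hc, h⟩ := rpow_le_lintegral_gagliardoKernel hN hs₀ hs₁
  have hq2 : 2 < fracCritExp N s := two_lt_fracCritExp hN hs₀ hs₁
  refine ⟨1 / c, by positivity, fun u hu hi hk => ?_⟩
  have hG : 0 ≤ gagliardoForm s u u := integral_nonneg (gagliardoKernel_self_nonneg s u)
  have ha0 : 0 ≤ ∫ x, |u x| ^ fracCritExp N s :=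
    integral_nonneg fun x => Real.rpow_nonneg (abs_nonneg _) _
  rcases ha0.eq_or_lt with ha | ha
  · rw [← ha, Real.zero_rpow (by positivity)]
    positivity
  have hx := h u hu hi ha
  set a := ∫ x, |u x| ^ fracCritExp N s with had
  -- Integrating the pointwise bound in `x` leaves `a^(1 - 2s/N)`, and `1 - 2s/N = 2/q`. Since a
  -- negative power of `a` occurs, the case `a = 0` had to be split off.
  have e1 : ENNReal.ofReal (c * a ^ (-(2 * s / N)) * a) ≤ ENNReal.ofReal (gagliardoForm s u u) := by
    calc ENNReal.ofReal (c * a ^ (-(2 * s / N)) * a)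
        = ∫⁻ x, ENNReal.ofReal (c * a ^ (-(2 * s / N)) * |u x| ^ fracCritExp N s) := by
          rw [← ofReal_integral_eq_lintegral_ofReal (hi.const_mul _)
            (Eventually.of_forall fun x => by positivity), integral_const_mul]
      _ ≤ ∫⁻ x, ∫⁻ y, ENNReal.ofReal (gagliardoKernel s u u (x, y)) := lintegral_mono hx
      _ = ∫⁻ z, ENNReal.ofReal (gagliardoKernel s u u z) :=
          (lintegral_prod _
            (measurable_gagliardoKernel s hu).ennreal_ofReal.aemeasurable).symm
      _ = _ := (ofReal_integral_eq_lintegral_ofReal hk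
            (Eventually.of_forall (gagliardoKernel_self_nonneg s u))).symm
  rw [ENNReal.ofReal_le_ofReal_iff hG] at e1
  have e2 : a ^ (2 / fracCritExp N s) = a ^ (-(2 * s / N)) * a := by
    nth_rewrite 3 [← Real.rpow_one a]
    rw [← Real.rpow_add ha, fracCritExp]
    congr 1
    have h1 : (N : ℝ) - 2 * s ≠ 0 := by linarith
    field_simp
    ring
  rw [e2, div_mul_eq_mul_div, one_mul, le_div_iff₀ hc]
  linarith

/-! ### Limits of jets, and the structure of `E` -/

theorem one_le_ofReal_critExp (hN : 3 ≤ N) : 1 ≤ ENNReal.ofReal (critExp N) := by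
  rw [← ENNReal.ofReal_one]
  exact ENNReal.ofReal_le_ofReal (by linarith [two_lt_critExp hN])

theorem volume_univ_space (hN : 0 < N) : volume (Set.univ : Set (Space N)) = ⊤ := by
  have := nontrivial_space hN
  have : NoncompactSpace (Space N) := NormedSpace.noncompactSpace ℝ _
  exact measure_univ_of_isAddLeftInvariant _

/-- Convergence in `L^q` implies convergence of the integrals against continuous functions with
compact support. -/
theorem tendsto_integral_mul_of_tendsto_eLpNorm {q : ENNReal} (hq : 1 ≤ q)
    {f : ℕ → Space N → ℝ} {g ψ : Space N → ℝ} (hf : ∀ n, MemLp (f n) q) (hg : MemLp g q)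
    (hψ : Continuous ψ) (hc : HasCompactSupport ψ)
    (h : Tendsto (fun n => eLpNorm (f n - g) q) atTop (𝓝 0)) :
    Tendsto (fun n => ∫ x, f n x * ψ x) atTop (𝓝 (∫ x, g x * ψ x)) := by
  have : q.HolderConjugate q.conjExponent := .conjExponent hq
  have mψ : MemLp ψ q.conjExponent := hψ.memLp_of_hasCompactSupport hc
  refine tendsto_integral_of_L1' (fun x => g x * ψ x) (hg.1.mul mψ.1)
    (Eventually.of_forall fun n => ?_) ?_
  · exact memLp_one_iff_integrable.1 (mψ.mul (hf n))
  · have hb : ∀ n, eLpNorm ((fun x => f n x * ψ x) - fun x => g x * ψ x) 1 ≤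
        eLpNorm (f n - g) q * eLpNorm ψ q.conjExponent := by
      intro n
      have e : ((fun x => f n x * ψ x) - fun x => g x * ψ x) = (f n - g) • ψ := by
        ext x; simp only [Pi.sub_apply, Pi.smul_apply', smul_eq_mul]; ring
      rw [e]
      exact eLpNorm_smul_le_mul_eLpNorm mψ.1 ((hf n).1.sub hg.1)
    have hz : Tendsto (fun n => eLpNorm (f n - g) q * eLpNorm ψ q.conjExponent) atTop (𝓝 0) := by
      have := ENNReal.Tendsto.mul_const h (Or.inr mψ.eLpNorm_ne_top)
      rwa [zero_mul] at this
    exact tendsto_of_tendsto_of_tendsto_of_le_of_le tendsto_const_nhds hz (fun _ => zero_le) hb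

/-- A sequence whose jets converge and whose `L^{2^*}` distances are controlled by those of the jets
has a limit function in `L^{2^*}` whose jet is the limit of the jets. -/
theorem exists_isJet_of_tendsto (hN : 3 ≤ N) {s : ℝ} {w : ℕ → Space N → ℝ} {k : ℕ → JetSpace N}
    {h : JetSpace N} {C : NNReal} (hw : ∀ n, MemLp (w n) (ENNReal.ofReal (critExp N)))
    (hk : ∀ n, IsJet s (w n) (k n)) (hh : Tendsto k atTop (𝓝 h))
    (hC : ∀ n m, eLpNorm (w n - w m) (ENNReal.ofReal (critExp N)) ≤
      C * ENNReal.ofReal ‖k n - k m‖) :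
    ∃ v, MemLp v (ENNReal.ofReal (critExp N)) ∧ IsJet s v h ∧
      ∃ ns : ℕ → ℕ, StrictMono ns ∧ ∀ᵐ x, Tendsto (fun j => w (ns j) x) atTop (𝓝 (v x)) := by
  set q := ENNReal.ofReal (critExp N) with hq
  have hq1 : 1 ≤ q := one_le_ofReal_critExp hN
  have : Fact (1 ≤ q) := ⟨hq1⟩
  set F : ℕ → Lp ℝ q (volume : Measure (Space N)) := fun n => (hw n).toLp (w n) with hF
  have hcau : CauchySeq F := by
    have hkc := hh.cauchySeq
    rw [Metric.cauchySeq_iff] at hkc ⊢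
    intro ε hε
    -- `C + 1` in place of `C` avoids a division by zero.
    obtain ⟨n₀, hn₀⟩ := hkc (ε / (C + 1)) (by positivity)
    refine ⟨n₀, fun n hn m hm => ?_⟩
    have h1 := hn₀ n hn m hm
    have h2 : dist (F n) (F m) ≤ C * dist (k n) (k m) := by
      rw [Lp.dist_edist, Lp.edist_toLp_toLp, dist_eq_norm]
      refine ENNReal.toReal_le_of_le_ofReal (by positivity) ((hC n m).trans (le_of_eq ?_))
      rw [ENNReal.ofReal_mul C.coe_nonneg, ENNReal.ofReal_coe_nnreal]
    calc dist (F n) (F m) ≤ C * dist (k n) (k m) := h2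
      _ ≤ (C + 1) * dist (k n) (k m) := by gcongr; linarith
      _ < (C + 1) * (ε / (C + 1)) := by gcongr
      _ = ε := by field_simp
  obtain ⟨v, hv⟩ := cauchySeq_tendsto_of_complete hcau
  obtain ⟨ns, hns, hnsv⟩ := (tendstoInMeasure_of_tendsto_Lp hv).exists_seq_tendsto_ae
  have hsnd : Tendsto (fun j => (k (ns j)).snd) atTop (𝓝 h.snd) :=
    ((WithLp.sndL 2 ℝ _ _).continuous.tendsto h).comp (hh.comp hns.tendsto_atTop)
  have hfst : Tendsto (fun j => (k j).fst) atTop (𝓝 h.fst) :=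
    ((WithLp.fstL 2 ℝ _ _).continuous.tendsto h).comp hh
  -- A further subsequence along which the difference quotients also converge almost everywhere;
  -- their limit must then be the quotient of `v`.
  obtain ⟨ms, hms, hmsv⟩ := (tendstoInMeasure_of_tendsto_Lp hsnd).exists_seq_tendsto_ae
  have hae : ∀ᵐ x, Tendsto (fun j => w (ns (ms j)) x) atTop (𝓝 (v x)) := by
    have hco : ∀ᵐ x, ∀ n, F n x = w n x := ae_all_iff.2 fun n => MemLp.coeFn_toLp (hw n)
    filter_upwards [hnsv, hco] with x hx hc
    have := hx.comp hms.tendsto_atTop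
    refine this.congr fun j => ?_
    simp only [Function.comp, hc]
  have hFv : Tendsto (fun n => eLpNorm (w n - (v : Space N → ℝ)) q) atTop (𝓝 0) := by
    refine ((Lp.tendsto_Lp_iff_tendsto_eLpNorm' F v).1 hv).congr fun n => ?_
    refine eLpNorm_congr_ae ?_
    filter_upwards [MemLp.coeFn_toLp (hw n)] with x hx
    simp only [Pi.sub_apply, hF, hx]
  refine ⟨v, Lp.memLp v, ⟨⟨(Lp.memLp v).locallyIntegrable hq1, Lp.memLp _, fun φ hφ e => ?_⟩, ?_⟩,
    ns ∘ ms, hns.comp hms, hae⟩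
  · have t1 := tendsto_integral_mul_of_tendsto_eLpNorm hq1 hw (Lp.memLp v)
      (hφ.continuous_fderiv_apply e) (hφ.hasCompactSupport_fderiv_apply e) hFv
    have t2 := tendsto_integral_mul_of_tendsto_eLpNorm (q := 2) (by norm_num)
      (f := fun n x => inner ℝ ((k n).fst x) e) (g := fun x => inner ℝ (h.fst x) e)
      (fun n => (Lp.memLp _).inner_const e) ((Lp.memLp _).inner_const e) hφ.1.continuous hφ.2 (by
        have h0 := (Lp.tendsto_Lp_iff_tendsto_eLpNorm' _ h.fst).1 hfst
        have h1 := ENNReal.Tendsto.const_mul h0 (Or.inr (ENNReal.ofReal_ne_top (r := ‖e‖)))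
        rw [mul_zero] at h1
        refine tendsto_of_tendsto_of_tendsto_of_le_of_le tendsto_const_nhds h1
          (fun _ => zero_le) (fun n => ?_)
        refine eLpNorm_le_mul_eLpNorm_of_ae_le_mul (Eventually.of_forall fun x => ?_) 2
        rw [Pi.sub_apply, Pi.sub_apply, ← inner_sub_left, mul_comm]
        exact norm_inner_le_norm _ _)
    refine tendsto_nhds_unique t1 (t2.neg.congr fun n => ?_)
    exact ((hk n).1.integral_eq φ hφ e).symm
  · have hco : ∀ᵐ z, ∀ n, (k n).snd z = quot s (w n) z := ae_all_iff.2 fun n => (hk n).2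
    filter_upwards [hmsv, hco, Measure.quasiMeasurePreserving_fst.ae hae,
      Measure.quasiMeasurePreserving_snd.ae hae] with z hz hc h1 h2
    refine tendsto_nhds_unique hz ?_
    simp only [hc]
    exact (h1.sub h2).div_const _

/-- A vanishing difference quotient forces `g` to be constant, and the only constant in `L^{2^*}` of
a space of infinite measure is zero. -/
theorem ae_eq_zero_of_isJet_zero (hN : 3 ≤ N) {s : ℝ} {g : Space N → ℝ}
    (hg : MemLp g (ENNReal.ofReal (critExp N))) (h : IsJet s g 0) : g =ᵐ[volume] 0 := by
  have hq : 0 < critExp N := by linarith [two_lt_critExp hN]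
  have h1 : ∀ᵐ z : Space N × Space N, g z.1 = g z.2 := by
    have h0 : ((0 : JetSpace N).snd : Space N × Space N → ℝ) =ᵐ[volume] 0 := Lp.coeFn_zero _ _ _
    filter_upwards [h0.symm.trans h.2] with z hz
    rcases eq_or_ne z.1 z.2 with e | e
    · rw [e]
    · have hpos : 0 < ‖z.1 - z.2‖ := norm_pos_iff.2 (sub_ne_zero.2 e)
      have := hz.symm
      rw [quot, Pi.zero_apply, div_eq_zero_iff] at this
      rcases this with h | h
      · linarith
      · exact absurd h (Real.rpow_pos_of_pos hpos _).ne'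
  have h2 : ∀ᵐ x : Space N, ∀ᵐ y : Space N, g x = g y := Measure.ae_ae_of_ae_prod h1
  obtain ⟨x, hx⟩ := h2.exists
  have hm : MemLp (fun _ : Space N => g x) (ENNReal.ofReal (critExp N)) volume :=
    (memLp_congr_ae hx).2 hg
  rw [memLp_const_iff (by simpa using hq) ENNReal.ofReal_ne_top, volume_univ_space (by omega)] at hm
  have h0 : g x = 0 := hm.resolve_right (lt_irrefl _)
  filter_upwards [hx] with y hy
  rw [← hy, h0, Pi.zero_apply]

/-- Every element of `E` is the limit of test functions in `‖·‖_E` and almost everywhere. -/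
theorem MemE.exists_test_tendsto (hN : 3 ≤ N) {s : ℝ} (hs₀ : 0 < s) (hs₁ : s < 1)
    {u : Space N → ℝ} (hu : MemE s u) :
    ∃ φ : ℕ → Space N → ℝ, (∀ n, IsTest (φ n)) ∧
      Tendsto (fun n => mixedNorm s (u - φ n)) atTop (𝓝 0) ∧
      ∀ᵐ x, Tendsto (fun n => φ n x) atTop (𝓝 (u x)) := by
  obtain ⟨φ, hφ, hlim⟩ := hu.exists_approx
  obtain ⟨h, hh⟩ := hu.exists_jet hs₀
  choose k hk using fun n => (hφ n).exists_jet (by omega) hs₀ hs₁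
  obtain ⟨C, hC⟩ := exists_eLpNorm_critExp_le hN hs₀ hs₁
  have ht : Tendsto k atTop (𝓝 h) := by
    rw [tendsto_iff_norm_sub_tendsto_zero]
    refine hlim.congr fun n => ?_
    rw [(hh.sub (hk n)).mixedNorm_eq hs₀, norm_sub_rev]
  obtain ⟨v, hv, hjv, ns, hns, hae⟩ := exists_isJet_of_tendsto hN
    (fun n => ((hφ n).memE (by omega) hs₀ hs₁).memLp) hk ht (C := C) (fun n m => by
      rw [← ((hk n).sub (hk m)).mixedNorm_eq hs₀]
      exact hC _ ⟨(hφ n).1.sub (hφ m).1, (hφ n).2.sub (hφ m).2⟩)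
  -- The limit produced by completeness has the same jet as `u`, so it is `u`.
  have huv := ae_eq_zero_of_isJet_zero hN (hu.memLp.sub hv) (by simpa using hh.sub hjv)
  refine ⟨φ ∘ ns, fun n => hφ _, hlim.comp hns.tendsto_atTop, ?_⟩
  filter_upwards [hae, huv] with x hx hx'
  have : u x = v x := by simpa [sub_eq_zero] using hx'
  rw [this]
  exact hx

theorem tendsto_mixedNorm_of_sub {s : ℝ} (hs₀ : 0 < s) {u : Space N → ℝ} {φ : ℕ → Space N → ℝ}
    (hu : ∃ h, IsJet s u h) (hφ : ∀ n, ∃ h, IsJet s (φ n) h)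
    (h : Tendsto (fun n => mixedNorm s (u - φ n)) atTop (𝓝 0)) :
    Tendsto (fun n => mixedNorm s (φ n)) atTop (𝓝 (mixedNorm s u)) := by
  obtain ⟨k, hk⟩ := hu
  choose l hl using hφ
  simp only [fun n => (hl n).mixedNorm_eq hs₀, hk.mixedNorm_eq hs₀]
  refine Tendsto.norm ?_
  rw [tendsto_iff_norm_sub_tendsto_zero]
  refine h.congr fun n => ?_
  rw [(hk.sub (hl n)).mixedNorm_eq hs₀, norm_sub_rev]

/-- Fatou's lemma along approximating test functions, whose norms in `E` converge. No prior
integrability of `u` in `L^q` is needed. -/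
theorem MemE.eLpNorm_le_of_test (hN : 3 ≤ N) {s : ℝ} (hs₀ : 0 < s) (hs₁ : s < 1)
    {q : ENNReal} {C : NNReal}
    (hC : ∀ φ : Space N → ℝ, IsTest φ → eLpNorm φ q ≤ C * ENNReal.ofReal (mixedNorm s φ))
    {u : Space N → ℝ} (hu : MemE s u) : eLpNorm u q ≤ C * ENNReal.ofReal (mixedNorm s u) := by
  obtain ⟨φ, hφ, hlim, hae⟩ := hu.exists_test_tendsto hN hs₀ hs₁
  have h1 := Lp.eLpNorm_lim_le_liminf_eLpNorm (p := q)
    (fun n => (hφ n).1.continuous.aestronglyMeasurable (μ := volume)) u hae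
  have h2 := tendsto_mixedNorm_of_sub hs₀ (hu.exists_jet hs₀)
    (fun n => (hφ n).exists_jet (by omega) hs₀ hs₁) hlim
  have h3 : Tendsto (fun n => (C : ENNReal) * ENNReal.ofReal (mixedNorm s (φ n))) atTop
      (𝓝 (C * ENNReal.ofReal (mixedNorm s u))) :=
    ENNReal.Tendsto.const_mul (ENNReal.tendsto_ofReal h2) (Or.inr ENNReal.coe_ne_top)
  rw [← h3.liminf_eq]
  exact h1.trans (liminf_le_liminf (Eventually.of_forall fun n => hC _ (hφ n)))

/-- The Sobolev inequality on `E`. -/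
theorem MemE.exists_eLpNorm_critExp_le (hN : 3 ≤ N) {s : ℝ} (hs₀ : 0 < s) (hs₁ : s < 1) :
    ∃ C : NNReal, ∀ u : Space N → ℝ, MemE s u →
      eLpNorm u (ENNReal.ofReal (critExp N)) ≤ C * ENNReal.ofReal (mixedNorm s u) := by
  obtain ⟨C, hC⟩ := MixedLaplacian.exists_eLpNorm_critExp_le hN hs₀ hs₁
  exact ⟨C, fun u hu => hu.eLpNorm_le_of_test hN hs₀ hs₁ hC⟩

/-- The fractional Sobolev inequality on `E`. -/
theorem MemE.exists_eLpNorm_fracCritExp_le (hN : 3 ≤ N) {s : ℝ} (hs₀ : 0 < s) (hs₁ : s < 1) :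
    ∃ C : NNReal, ∀ u : Space N → ℝ, MemE s u →
      eLpNorm u (ENNReal.ofReal (fracCritExp N s)) ≤ C * ENNReal.ofReal (mixedNorm s u) := by
  obtain ⟨C, hC0, hC⟩ := exists_integral_fracCritExp_le hN hs₀ hs₁
  have hq : 0 < fracCritExp N s := by linarith [two_lt_fracCritExp hN hs₀ hs₁]
  refine ⟨(√C).toNNReal, fun u hu => hu.eLpNorm_le_of_test hN hs₀ hs₁ fun φ hφ => ?_⟩
  have hm : MemLp φ (ENNReal.ofReal (fracCritExp N s)) :=
    hφ.1.continuous.memLp_of_hasCompactSupport hφ.2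
  have hq0 : ENNReal.ofReal (fracCritExp N s) ≠ 0 := by simpa using hq
  obtain ⟨h, hh⟩ := hφ.exists_jet (by omega) hs₀ hs₁
  have hi := hm.integrable_norm_rpow hq0 ENNReal.ofReal_ne_top
  rw [hm.eLpNorm_eq_integral_rpow_norm hq0 ENNReal.ofReal_ne_top, ENNReal.toReal_ofReal hq.le]
  rw [ENNReal.toReal_ofReal hq.le] at hi
  have h1 := (hC φ hφ.1.continuous.measurable hi (hh.integrable_gagliardoKernel hs₀)).trans
    (mul_le_mul_of_nonneg_left (gagliardoForm_le_mixedNorm_sq hs₀ hh) hC0.le)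
  change ENNReal.ofReal _ ≤ ENNReal.ofReal (√C) * _
  rw [← ENNReal.ofReal_mul (Real.sqrt_nonneg _)]
  refine ENNReal.ofReal_le_ofReal ?_
  have ha : 0 ≤ ∫ x, |φ x| ^ fracCritExp N s :=
    integral_nonneg fun x => Real.rpow_nonneg (abs_nonneg _) _
  have h2 : ((∫ x, |φ x| ^ fracCritExp N s) ^ (fracCritExp N s)⁻¹) ^ 2 ≤
      (√C * mixedNorm s φ) ^ 2 := by
    rw [mul_pow, Real.sq_sqrt hC0.le, ← Real.rpow_natCast, ← Real.rpow_mul ha]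
    refine le_trans (le_of_eq ?_) h1
    congr 1
    push_cast
    rw [inv_mul_eq_div]
  exact le_of_abs_le (abs_le_of_sq_le_sq h2 (mul_nonneg (Real.sqrt_nonneg _) (mixedNorm_nonneg s φ)))

theorem mixedNorm_add_le {s : ℝ} (hs₀ : 0 < s) {u v : Space N → ℝ} (hu : ∃ h, IsJet s u h)
    (hv : ∃ h, IsJet s v h) : mixedNorm s (u + v) ≤ mixedNorm s u + mixedNorm s v := by
  obtain ⟨h, hh⟩ := hu
  obtain ⟨k, hk⟩ := hv
  rw [hh.mixedNorm_eq hs₀, hk.mixedNorm_eq hs₀, (hh.add hk).mixedNorm_eq hs₀]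
  exact norm_add_le _ _

theorem MemE.add (hN : 0 < N) {s : ℝ} (hs₀ : 0 < s) (hs₁ : s < 1) {u v : Space N → ℝ}
    (hu : MemE s u) (hv : MemE s v) : MemE s (u + v) := by
  obtain ⟨h, hh⟩ := hu.exists_jet hs₀
  obtain ⟨k, hk⟩ := hv.exists_jet hs₀
  refine ⟨hu.memLp.add hv.memLp, ⟨_, (hh.add hk).1⟩, (hh.add hk).integrable_gagliardoKernel hs₀, ?_⟩
  obtain ⟨φ, hφ, tφ⟩ := hu.exists_approx
  obtain ⟨ψ, hψ, tψ⟩ := hv.exists_approx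
  refine ⟨fun n => φ n + ψ n, fun n => ⟨(hφ n).1.add (hψ n).1, (hφ n).2.add (hψ n).2⟩, ?_⟩
  refine squeeze_zero (fun _ => mixedNorm_nonneg _ _) (fun n => ?_) (by simpa using tφ.add tψ)
  have e : u + v - (φ n + ψ n) = (u - φ n) + (v - ψ n) := by abel
  obtain ⟨a, ha⟩ := (hφ n).exists_jet hN hs₀ hs₁
  obtain ⟨b, hb⟩ := (hψ n).exists_jet hN hs₀ hs₁
  rw [e]
  exact mixedNorm_add_le hs₀ ⟨_, hh.sub ha⟩ ⟨_, hk.sub hb⟩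

theorem MemE.smul (hN : 0 < N) {s : ℝ} (hs₀ : 0 < s) (hs₁ : s < 1) {u : Space N → ℝ}
    (hu : MemE s u) (a : ℝ) : MemE s (a • u) := by
  obtain ⟨h, hh⟩ := hu.exists_jet hs₀
  refine ⟨hu.memLp.const_smul a, ⟨_, (hh.smul a).1⟩,
    (hh.smul a).integrable_gagliardoKernel hs₀, ?_⟩
  obtain ⟨φ, hφ, tφ⟩ := hu.exists_approx
  refine ⟨fun n => a • φ n, fun n => ⟨(hφ n).1.const_smul a, (hφ n).2.smul_left (f := fun _ => a)⟩, ?_⟩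
  have := tφ.const_mul |a|
  rw [mul_zero] at this
  refine this.congr fun n => ?_
  obtain ⟨k, hk⟩ := (hφ n).exists_jet hN hs₀ hs₁
  rw [← smul_sub, mixedNorm_smul s hs₀ ⟨_, hh.sub hk⟩]

theorem MemE.sub (hN : 0 < N) {s : ℝ} (hs₀ : 0 < s) (hs₁ : s < 1) {u v : Space N → ℝ}
    (hu : MemE s u) (hv : MemE s v) : MemE s (u - v) := by
  have := hu.add hN hs₀ hs₁ (hv.smul hN hs₀ hs₁ (-1))
  simpa [sub_eq_add_neg] using this

/-- `E` is closed: a pointwise limit of elements of `E` with converging jets belongs to `E`. -/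
theorem MemE.of_tendsto (hN : 3 ≤ N) {s : ℝ} (hs₀ : 0 < s) (hs₁ : s < 1)
    {w : ℕ → Space N → ℝ} {k : ℕ → JetSpace N} {h : JetSpace N} {v : Space N → ℝ}
    (hw : ∀ n, MemE s (w n)) (hk : ∀ n, IsJet s (w n) (k n)) (hh : Tendsto k atTop (𝓝 h))
    (hv : ∀ᵐ x, Tendsto (fun n => w n x) atTop (𝓝 (v x))) : MemE s v ∧ IsJet s v h := by
  obtain ⟨C, hC⟩ := MemE.exists_eLpNorm_critExp_le hN hs₀ hs₁
  obtain ⟨g, hg, hj, ns, hns, hae⟩ := exists_isJet_of_tendsto hN (fun n => (hw n).memLp) hk hh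
    (C := C) (fun n m => by
      rw [← ((hk n).sub (hk m)).mixedNorm_eq hs₀]
      exact hC _ ((hw n).sub (by omega) hs₀ hs₁ (hw m)))
  have hgv : g =ᵐ[volume] v := by
    filter_upwards [hae, hv] with x h1 h2
    exact tendsto_nhds_unique h1 (h2.comp hns.tendsto_atTop)
  have hjv := hj.congr hgv
  refine ⟨⟨(memLp_congr_ae hgv).1 hg, ⟨_, hjv.1⟩, hjv.integrable_gagliardoKernel hs₀, ?_⟩, hjv⟩
  -- A diagonal choice: one test function close to each `w n` approximates the limit.
  have hex : ∀ n : ℕ, ∃ φ, IsTest φ ∧ mixedNorm s (w n - φ) < 1 / ((n : ℝ) + 1) := by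
    intro n
    obtain ⟨φ, hφ, t⟩ := (hw n).exists_approx
    obtain ⟨j, hj⟩ := (t.eventually (gt_mem_nhds (show (0 : ℝ) < 1 / ((n : ℝ) + 1) by positivity))).exists
    exact ⟨φ j, hφ j, hj⟩
  choose φ hφ hd using hex
  refine ⟨φ, hφ, ?_⟩
  have t1 : Tendsto (fun n => ‖h - k n‖) atTop (𝓝 0) := by
    refine (tendsto_iff_norm_sub_tendsto_zero.1 hh).congr fun n => norm_sub_rev _ _
  refine squeeze_zero (fun _ => mixedNorm_nonneg _ _) (fun n => ?_)
    (by simpa using t1.add tendsto_one_div_add_atTop_nhds_zero_nat)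
  have e : v - φ n = (v - w n) + (w n - φ n) := by abel
  obtain ⟨b, hb⟩ := (hφ n).exists_jet (by omega) hs₀ hs₁
  rw [e]
  refine (mixedNorm_add_le hs₀ ⟨_, hjv.sub (hk n)⟩ ⟨_, (hk n).sub hb⟩).trans ?_
  rw [(hjv.sub (hk n)).mixedNorm_eq hs₀]
  simpa using (hd n).le

/-- Weak lower semicontinuity of the norm of `E` along almost everywhere converging sequences. -/
theorem MemE.of_tendsto_of_mixedNorm_le (hN : 3 ≤ N) {s : ℝ} (hs₀ : 0 < s) (hs₁ : s < 1)
    {u : ℕ → Space N → ℝ} {v : Space N → ℝ} {c : ℕ → ℝ} {C : ℝ} (hu : ∀ n, MemE s (u n))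
    (hc : ∀ n, mixedNorm s (u n) ≤ c n) (hC : Tendsto c atTop (𝓝 C))
    (hv : ∀ᵐ x, Tendsto (fun n => u n x) atTop (𝓝 (v x))) :
    MemE s v ∧ mixedNorm s v ≤ C := by
  choose h hh using fun n => (hu n).exists_jet hs₀
  obtain ⟨w, k, hw, hk, hkC⟩ := exists_convexCombination_tendsto u h
    (fun n => by rw [← (hh n).mixedNorm_eq hs₀]; exact hc n) hC
  -- Convexity of the graph of the jet map ensures that the second component of each combination is
  -- the jet of the first.
  have hconv : Convex ℝ {p : (Space N → ℝ) × JetSpace N | MemE s p.1 ∧ IsJet s p.1 p.2} := by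
    intro p hp r hr a b _ _ _
    exact ⟨(hp.1.smul (by omega) hs₀ hs₁ a).add (by omega) hs₀ hs₁ (hr.1.smul (by omega) hs₀ hs₁ b),
      (hp.2.smul a).add (hr.2.smul b)⟩
  have hmem : ∀ n, MemE s (w n).1 ∧ IsJet s (w n).1 (w n).2 := fun n =>
    convexHull_min (by rintro _ ⟨j, _, rfl⟩; exact ⟨hu j, hh j⟩) hconv (hw n)
  have hae : ∀ᵐ x, Tendsto (fun n => (w n).1 x) atTop (𝓝 (v x)) := by
    filter_upwards [hv] with x hx
    rw [Metric.tendsto_atTop] at hx ⊢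
    intro ε hε
    obtain ⟨n₀, hn₀⟩ := hx ε hε
    refine ⟨n₀, fun n hn => ?_⟩
    -- Balls being convex, combinations of tail values stay as close to `v x` as the tail values
    -- themselves.
    have hcx : Convex ℝ {p : (Space N → ℝ) × JetSpace N | p.1 x ∈ Metric.ball (v x) ε} :=
      (convex_ball (v x) ε).linear_preimage
        ((LinearMap.proj x).comp (LinearMap.fst ℝ (Space N → ℝ) (JetSpace N)))
    exact convexHull_min (by rintro _ ⟨j, hj, rfl⟩; exact hn₀ j (hn.trans hj)) hcx (hw n)
  obtain ⟨hE, hJ⟩ := MemE.of_tendsto hN hs₀ hs₁ (fun n => (hmem n).1) (fun n => (hmem n).2) hk hae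
  exact ⟨hE, by rw [hJ.mixedNorm_eq hs₀]; exact hkC⟩

theorem MemE.congr {s : ℝ} (hs₀ : 0 < s) {u v : Space N → ℝ} (hu : MemE s u)
    (h : u =ᵐ[volume] v) : MemE s v ∧ mixedNorm s v = mixedNorm s u := by
  obtain ⟨k, hk⟩ := hu.exists_jet hs₀
  have hv := hk.congr h
  refine ⟨⟨(memLp_congr_ae h).1 hu.memLp, ⟨_, hv.1⟩, hv.integrable_gagliardoKernel hs₀, ?_⟩, by
    rw [hv.mixedNorm_eq hs₀, hk.mixedNorm_eq hs₀]⟩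
  obtain ⟨φ, hφ, t⟩ := hu.exists_approx
  refine ⟨φ, hφ, t.congr fun n => ?_⟩
  have e : u - φ n =ᵐ[volume] v - φ n := h.sub ae_eq_rfl
  have e1 : quot s (u - φ n) =ᵐ[volume] quot s (v - φ n) := quot_congr s e
  -- The two weak gradients are chosen separately, so uniqueness is needed; if none exists, both
  -- take the default value 0.
  have e2 : weakGrad (u - φ n) =ᵐ[volume] weakGrad (v - φ n) := by
    by_cases hex : ∃ G, IsWeakGradient (u - φ n) G
    · have h1 := isWeakGradient_weakGrad hex
      have h2 := h1.congr e ae_eq_rfl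
      exact h2.ae_eq (isWeakGradient_weakGrad ⟨_, h2⟩)
    · have hex' : ¬ ∃ G, IsWeakGradient (v - φ n) G := fun ⟨G, hG⟩ =>
        hex ⟨G, hG.congr e.symm ae_eq_rfl⟩
      rw [weakGrad, weakGrad, dif_neg hex, dif_neg hex']
  rw [mixedNorm, mixedNorm, dirichletForm, dirichletForm, gagliardoForm, gagliardoForm]
  congr 2
  · exact integral_congr_ae (by filter_upwards [e2] with x hx; rw [hx])
  · exact integral_congr_ae (by
      filter_upwards [e1] with x hx
      rw [← quot_mul_quot hs₀, ← quot_mul_quot hs₀, hx])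

/-! ### Lipschitz functions with compact support belong to `E`; absolute values -/

/-- Mollification of a Lipschitz function with compact support. -/
theorem exists_test_approx_of_lipschitz {f : Space N → ℝ} {K : NNReal} (hf : LipschitzWith K f)
    {M R : ℝ} (hM : ∀ x, ‖f x‖ ≤ M) (hR : Function.support f ⊆ Metric.closedBall 0 R) :
    ∃ φ : ℕ → Space N → ℝ, ∀ n, IsTest (φ n) ∧ LipschitzWith K (φ n) ∧ (∀ x, ‖φ n x‖ ≤ M) ∧
      tsupport (φ n) ⊆ Metric.closedBall 0 (R + 1) ∧
      ∀ x, Tendsto (fun n => φ n x) atTop (𝓝 (f x)) := by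
  have hfc : HasCompactSupport f := HasCompactSupport.of_support_subset_isCompact
    (isCompact_closedBall 0 R) hR
  let b : ℕ → ContDiffBump (0 : Space N) := fun n =>
    ⟨1 / (2 * ((n : ℝ) + 1)), 1 / ((n : ℝ) + 1), by positivity, by
      apply one_div_lt_one_div_of_lt <;> linarith [n.cast_nonneg (α := ℝ)]⟩
  let η : ℕ → Space N → ℝ := fun n => (b n).normed volume
  have hη0 : ∀ n t, 0 ≤ η n t := fun n t => (b n).nonneg_normed t
  have hηc : ∀ n, HasCompactSupport (η n) := fun n => (b n).hasCompactSupport_normed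
  have hηd : ∀ n, ContDiff ℝ ∞ (η n) := fun n => (b n).contDiff_normed
  have hη1 : ∀ n, ∫ t, η n t = 1 := fun n => (b n).integral_normed
  have hηi : ∀ n, Integrable (η n) := fun n =>
    (hηd n).continuous.integrable_of_hasCompactSupport (hηc n)
  have hpi : ∀ n x, Integrable fun t => η n t * f (x - t) := fun n x =>
    ((hηd n).continuous.mul (hf.continuous.comp (by fun_prop))).integrable_of_hasCompactSupport
      (hηc n).mul_right
  let φ : ℕ → Space N → ℝ := fun n => convolution (η n) f (ContinuousLinearMap.lsmul ℝ ℝ) volume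
  have hφ : ∀ n x, φ n x = ∫ t, η n t * f (x - t) := fun n x => rfl
  refine ⟨φ, fun n => ⟨⟨?_, ?_⟩, ?_, fun x => ?_, ?_, fun x => ?_⟩⟩
  · exact (hηc n).contDiff_convolution_left _ (hηd n) hf.continuous.locallyIntegrable
  · exact (hηc n).convolution _ hfc
  · refine LipschitzWith.of_dist_le_mul fun x y => ?_
    rw [Real.dist_eq, hφ, hφ, ← integral_sub (hpi n x) (hpi n y)]
    refine (abs_integral_le_integral_abs).trans ?_
    have hle : ∀ t, |η n t * f (x - t) - η n t * f (y - t)| ≤ η n t * (K * dist x y) := by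
      intro t
      rw [← mul_sub, abs_mul, abs_of_nonneg (hη0 n t)]
      refine mul_le_mul_of_nonneg_left ?_ (hη0 n t)
      have := hf.dist_le_mul (x - t) (y - t)
      rwa [Real.dist_eq, dist_sub_right] at this
    refine (integral_mono ((hpi n x).sub (hpi n y)).abs ((hηi n).mul_const _) hle).trans ?_
    rw [integral_mul_const, hη1, one_mul]
  · rw [hφ]
    refine (norm_integral_le_integral_norm _).trans ?_
    have hle : ∀ t, ‖η n t * f (x - t)‖ ≤ η n t * M := by
      intro t
      rw [norm_mul, Real.norm_of_nonneg (hη0 n t)]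
      exact mul_le_mul_of_nonneg_left (hM _) (hη0 n t)
    refine (integral_mono (hpi n x).norm ((hηi n).mul_const _) hle).trans ?_
    rw [integral_mul_const, hη1, one_mul]
  · refine closure_minimal ?_ Metric.isClosed_closedBall
    refine (support_convolution_subset _).trans ?_
    rintro _ ⟨a, ha, c, hc, rfl⟩
    have h1 : ‖a‖ ≤ 1 := by
      have h2 : a ∈ Metric.ball (0 : Space N) (b n).rOut := by
        rw [← (b n).support_normed_eq (μ := volume)]; exact ha
      rw [mem_ball_zero_iff] at h2
      refine h2.le.trans ?_
      change 1 / ((n : ℝ) + 1) ≤ 1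
      rw [div_le_one (by positivity)]
      linarith [n.cast_nonneg (α := ℝ)]
    have h2 : ‖c‖ ≤ R := by simpa using hR hc
    rw [mem_closedBall_zero_iff]
    exact (norm_add_le a c).trans (by linarith)
  · exact ContDiffBump.convolution_tendsto_right_of_continuous
      (tendsto_one_div_add_atTop_nhds_zero_nat) hf.continuous x

theorem dirichletForm_eq_of_isWeakGradient {u : Space N → ℝ} {G : Space N → Space N}
    (hG : IsWeakGradient u G) : dirichletForm u u = ∫ x, ‖G x‖ ^ 2 := by
  refine integral_congr_ae ?_
  filter_upwards [(isWeakGradient_weakGrad ⟨G, hG⟩).ae_eq hG] with x hx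
  rw [hx, real_inner_self_eq_norm_sq]

theorem mixedNorm_sq {s : ℝ} (hs₀ : 0 < s) {u : Space N → ℝ} (hu : ∃ h, IsJet s u h) :
    mixedNorm s u ^ 2 = dirichletForm u u + gagliardoForm s u u := by
  obtain ⟨h, hh⟩ := hu
  rw [mixedNorm, Real.sq_sqrt]
  rw [hh.form_eq hs₀ hh]
  exact real_inner_self_nonneg

/-- A bound for the norm in `E` in terms of the Lipschitz constant, the supremum and the support. -/
theorem exists_mixedNorm_le_of_lipschitz (hN : 0 < N) {s : ℝ} (hs₀ : 0 < s) (hs₁ : s < 1)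
    {S : Set (Space N)} (hS : IsCompact S) (K : NNReal) (M : ℝ) :
    ∃ C : ℝ, ∀ f : Space N → ℝ, LipschitzWith K f → (∀ x, ‖f x‖ ≤ M) → tsupport f ⊆ S →
      mixedNorm s f ≤ C := by
  obtain ⟨g, hg, hgf⟩ := exists_integrable_gagliardo_majorant hN hs₀ hs₁ hS K M
  refine ⟨√((∫ x, S.indicator (fun _ => (K : ℝ)) x ^ 2) + ∫ z, g z), fun f hf hM hfS => ?_⟩
  have hc : HasCompactSupport f := hS.of_isClosed_subset (isClosed_tsupport f) hfS
  have hi : Integrable fun x => S.indicator (fun _ => (K : ℝ)) x ^ 2 :=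
    (memLp_indicator_const 2 hS.measurableSet (K : ℝ) (Or.inr hS.measure_lt_top.ne)).integrable_sq
  refine Real.sqrt_le_sqrt (add_le_add ?_ ?_)
  · rw [dirichletForm_eq_of_isWeakGradient (isWeakGradient_gradient hf hc)]
    refine integral_mono (memLp_gradient hf hc).norm.integrable_sq hi fun x => ?_
    exact pow_le_pow_left₀ (norm_nonneg _) (norm_gradient_le_indicator hf hfS x) 2
  · exact integral_mono (integrable_gagliardoKernel_of_lipschitz hN hs₀ hs₁ hf hc) hg
      (hgf f hf hM hfS)

/-- Lipschitz functions with compact support belong to `E`. -/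
theorem memE_of_lipschitz (hN : 3 ≤ N) {s : ℝ} (hs₀ : 0 < s) (hs₁ : s < 1)
    {f : Space N → ℝ} {K : NNReal} (hf : LipschitzWith K f) (hc : HasCompactSupport f) :
    MemE s f := by
  obtain ⟨M, hM⟩ := hf.continuous.bounded_above_of_compact_support hc
  obtain ⟨R, hR⟩ := hc.isCompact.isBounded.subset_closedBall 0
  obtain ⟨φ, hφ⟩ := exists_test_approx_of_lipschitz hf hM ((subset_tsupport f).trans hR)
  obtain ⟨C, hC⟩ := exists_mixedNorm_le_of_lipschitz (by omega : 0 < N) hs₀ hs₁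
    (isCompact_closedBall (0 : Space N) (R + 1)) K M
  -- The mollifications share Lipschitz constant, supremum bound and a compact set containing their
  -- supports, hence one bound in `E`; a bounded pointwise limit suffices. The index 0 is
  -- immaterial: the convergence clause does not depend on it.
  exact (MemE.of_tendsto_of_mixedNorm_le hN hs₀ hs₁ (c := fun _ => C)
    (fun n => (hφ n).1.memE (by omega) hs₀ hs₁)
    (fun n => hC _ (hφ n).2.1 (hφ n).2.2.1 (hφ n).2.2.2.1) tendsto_const_nhds
    (Eventually.of_forall (hφ 0).2.2.2.2)).1

/-- Where `f ≠ 0`, `|f|` is locally `f` or `-f`; at a zero of `f`, `|f|` has a minimum, so its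
derivative (or the default value) is zero. -/
theorem norm_gradient_abs_le {f : Space N → ℝ} {x : Space N} :
    ‖gradient (fun y => |f y|) x‖ ≤ ‖gradient f x‖ ∨ ¬ DifferentiableAt ℝ f x := by
  by_cases hf : DifferentiableAt ℝ f x
  · left
    rcases lt_trichotomy (f x) 0 with h | h | h
    · have e : (fun y => |f y|) =ᶠ[𝓝 x] fun y => - f y := by
        filter_upwards [hf.continuousAt.eventually (gt_mem_nhds h)] with y hy
        exact abs_of_neg hy
      rw [e.gradient_eq, norm_gradient_eq, norm_gradient_eq, fderiv_fun_neg, norm_neg]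
    · have hmin : IsLocalMin (fun y => |f y|) x :=
        Eventually.of_forall fun y => by simp only [h, abs_zero]; exact abs_nonneg _
      rw [norm_gradient_eq, hmin.fderiv_eq_zero, norm_zero]
      exact norm_nonneg _
    · have e : (fun y => |f y|) =ᶠ[𝓝 x] f := by
        filter_upwards [hf.continuousAt.eventually (lt_mem_nhds h)] with y hy
        exact abs_of_pos hy
      rw [e.gradient_eq]
  · exact Or.inr hf

theorem LipschitzWith.abs_comp {f : Space N → ℝ} {K : NNReal} (hf : LipschitzWith K f) :
    LipschitzWith K fun x => |f x| := by
  refine LipschitzWith.of_dist_le_mul fun x y => ?_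
  rw [Real.dist_eq]
  exact (abs_abs_sub_abs_le_abs_sub _ _).trans (hf.dist_le_mul x y)

theorem HasCompactSupport.abs_comp {f : Space N → ℝ} (hf : HasCompactSupport f) :
    HasCompactSupport fun x => |f x| :=
  hf.comp_left (g := fun t : ℝ => |t|) abs_zero

/-- Taking absolute values does not increase the norm of `E`. -/
theorem mixedNorm_abs_le (hN : 0 < N) {s : ℝ} (hs₀ : 0 < s) (hs₁ : s < 1)
    {f : Space N → ℝ} {K : NNReal} (hf : LipschitzWith K f) (hc : HasCompactSupport f) :
    mixedNorm s (fun x => |f x|) ≤ mixedNorm s f := by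
  have ha := LipschitzWith.abs_comp hf
  have hac := HasCompactSupport.abs_comp hc
  refine Real.sqrt_le_sqrt (add_le_add ?_ ?_)
  · rw [dirichletForm_eq_of_isWeakGradient (isWeakGradient_gradient hf hc),
      dirichletForm_eq_of_isWeakGradient (isWeakGradient_gradient ha hac)]
    refine integral_mono_ae (memLp_gradient ha hac).norm.integrable_sq
      (memLp_gradient hf hc).norm.integrable_sq ?_
    filter_upwards [hf.ae_differentiableAt (μ := volume)] with x hx
    exact pow_le_pow_left₀ (norm_nonneg _) (norm_gradient_abs_le.resolve_right (not_not.2 hx)) 2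
  · refine integral_mono (integrable_gagliardoKernel_of_lipschitz hN hs₀ hs₁ ha hac)
      (integrable_gagliardoKernel_of_lipschitz hN hs₀ hs₁ hf hc) fun z => ?_
    refine div_le_div_of_nonneg_right ?_ (by positivity)
    rw [← sq, ← sq]
    exact sq_le_sq.2 (abs_abs_sub_abs_le_abs_sub _ _)

/-! ### Polarization does not increase the norm of `E` -/

/-- The reflection across the hyperplane `⟪x, e⟫ = α`, for a unit vector `e`. -/
noncomputable def hyperRefl (e : Space N) (α : ℝ) (x : Space N) : Space N :=
  (ℝ ∙ e)ᗮ.reflection x + (2 * α) • e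

/-- The polarization of `u` with respect to the half-space `⟪x, e⟫ ≤ α`. -/
noncomputable def polarize (e : Space N) (α : ℝ) (u : Space N → ℝ) (x : Space N) : ℝ :=
  if inner ℝ x e ≤ α then max (u x) (u (hyperRefl e α x)) else min (u x) (u (hyperRefl e α x))

section Reflection

variable {e : Space N} (he : ‖e‖ = 1) {α : ℝ}
include he

theorem hyperRefl_eq (x : Space N) : hyperRefl e α x = x + (2 * (α - inner ℝ x e)) • e := by
  rw [hyperRefl, Submodule.reflection_orthogonal_apply, Submodule.reflection_singleton_apply, he,
    real_inner_comm]
  simp only [RCLike.ofReal_one, one_pow, div_one]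
  module

theorem inner_hyperRefl (x : Space N) : inner ℝ (hyperRefl e α x) e = 2 * α - inner ℝ x e := by
  rw [hyperRefl_eq he, inner_add_left, inner_smul_left, real_inner_self_eq_norm_sq, he]
  simp only [conj_trivial]
  ring

theorem hyperRefl_hyperRefl (x : Space N) : hyperRefl e α (hyperRefl e α x) = x := by
  rw [hyperRefl_eq he (hyperRefl e α x), inner_hyperRefl he, hyperRefl_eq he]
  module

theorem hyperRefl_eq_self {x : Space N} (hx : inner ℝ x e = α) : hyperRefl e α x = x := by
  rw [hyperRefl_eq he, hx, sub_self, mul_zero, zero_smul, add_zero]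

/-- The sign of the last term is the geometric input: reflecting one of two points on the same side
of the hyperplane does not bring them closer. -/
theorem norm_sub_hyperRefl_sq (x y : Space N) : ‖x - hyperRefl e α y‖ ^ 2 =
    ‖x - y‖ ^ 2 + 4 * (α - inner ℝ x e) * (α - inner ℝ y e) := by
  rw [hyperRefl_eq he, ← sub_sub, norm_sub_sq_real, norm_smul, he, inner_smul_right, inner_sub_left,
    mul_one, Real.norm_eq_abs, sq_abs]
  ring

/-- For `α > 0` reflection moves points of the half-space away from the origin; the second moment
and the support condition both rest on this. -/
theorem norm_hyperRefl_sq (x : Space N) : ‖hyperRefl e α x‖ ^ 2 =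
    ‖x‖ ^ 2 + 4 * α * (α - inner ℝ x e) := by
  have := norm_sub_hyperRefl_sq he (α := α) 0 x
  simp only [zero_sub, norm_neg, inner_zero_left, sub_zero] at this
  rw [this]

omit he in
theorem norm_hyperRefl_sub_hyperRefl (x y : Space N) :
    ‖hyperRefl e α x - hyperRefl e α y‖ = ‖x - y‖ := by
  rw [hyperRefl, hyperRefl, add_sub_add_right_eq_sub, ← map_sub, LinearIsometryEquiv.norm_map]

theorem norm_hyperRefl_sub (x y : Space N) : ‖hyperRefl e α x - y‖ = ‖x - hyperRefl e α y‖ := by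
  rw [← norm_hyperRefl_sub_hyperRefl (e := e) (α := α), hyperRefl_hyperRefl he]

omit he in
theorem isometry_hyperRefl : Isometry (hyperRefl e α) :=
  Isometry.of_dist_eq fun x y => by rw [dist_eq_norm, dist_eq_norm, norm_hyperRefl_sub_hyperRefl]

omit he in
theorem measurePreserving_hyperRefl :
    MeasurePreserving (hyperRefl e α) (volume : Measure (Space N)) volume :=
  (measurePreserving_add_right volume ((2 * α) • e)).comp
    ((ℝ ∙ e)ᗮ.reflection).measurePreserving

omit he in
theorem measurableEmbedding_hyperRefl : MeasurableEmbedding (hyperRefl e α) :=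
  isometry_hyperRefl.isClosedEmbedding.measurableEmbedding

/-- On each pair of mirror points polarization either keeps the two values or swaps them. Points on
the hyperplane are their own mirror images. -/
theorem polarize_pair (u : Space N → ℝ) (x : Space N) :
    (polarize e α u x = u x ∧ polarize e α u (hyperRefl e α x) = u (hyperRefl e α x)) ∨
      (polarize e α u x = u (hyperRefl e α x) ∧ polarize e α u (hyperRefl e α x) = u x) := by
  simp only [polarize, hyperRefl_hyperRefl he, inner_hyperRefl he]
  rcases lt_trichotomy (inner ℝ x e) α with h | h | h
  · rw [if_pos h.le, if_neg (by linarith)]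
    rcases le_total (u x) (u (hyperRefl e α x)) with h' | h'
    · right; exact ⟨max_eq_right h', min_eq_right h'⟩
    · left; exact ⟨max_eq_left h', min_eq_left h'⟩
  · left
    rw [hyperRefl_eq_self he h, if_pos h.le, if_pos (by linarith)]
    simp
  · rw [if_neg (by linarith), if_pos (by linarith)]
    rcases le_total (u x) (u (hyperRefl e α x)) with h' | h'
    · left; exact ⟨min_eq_left h', max_eq_left h'⟩
    · right; exact ⟨min_eq_right h', max_eq_right h'⟩

theorem polarize_pair_of_le {u : Space N → ℝ} {x : Space N} (hx : inner ℝ x e ≤ α) :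
    polarize e α u x = max (u x) (u (hyperRefl e α x)) ∧
      polarize e α u (hyperRefl e α x) = min (u x) (u (hyperRefl e α x)) := by
  refine ⟨if_pos hx, ?_⟩
  rcases hx.eq_or_lt with h | h
  · rw [hyperRefl_eq_self he h, min_self, polarize, if_pos hx, hyperRefl_eq_self he h, max_self]
  · rw [polarize, inner_hyperRefl he, if_neg (by linarith), hyperRefl_hyperRefl he, min_comm]

/-- On one side, maxima and minima inherit the bound. Across the hyperplane any pairing of values
may occur, but replacing `y` by its mirror image only shortens the distance to `x`. -/
theorem lipschitzWith_polarize {f : Space N → ℝ} {K : NNReal} (hf : LipschitzWith K f) :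
    LipschitzWith K (polarize e α f) := by
  have hl : ∀ x y, |f x - f y| ≤ K * ‖x - y‖ := fun x y => by
    have := hf.dist_le_mul x y; rwa [Real.dist_eq, dist_eq_norm] at this
  have key : ∀ a b c d r : ℝ, |a - c| ≤ r → |b - d| ≤ r →
      |max a b - max c d| ≤ r ∧ |min a b - min c d| ≤ r := fun a b c d r h1 h2 =>
    ⟨(abs_max_sub_max_le_max a b c d).trans (max_le h1 h2),
      (abs_min_sub_min_le_max a b c d).trans (max_le h1 h2)⟩
  have key2 : ∀ a b c d r : ℝ, |a - c| ≤ r → |b - d| ≤ r → |a - d| ≤ r → |b - c| ≤ r →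
      |max a b - min c d| ≤ r := by
    intro a b c d r h1 h2 h3 h4
    rcases max_choice a b with h | h <;> rcases min_choice c d with h' | h' <;> rw [h, h'] <;>
      assumption
  have hcross : ∀ x y : Space N, inner ℝ x e ≤ α → α < inner ℝ y e →
      |polarize e α f x - polarize e α f y| ≤ K * ‖x - y‖ := by
    intro x y hx hy
    rw [polarize, polarize, if_pos hx, if_neg hy.not_ge]
    have hd : ‖x - hyperRefl e α y‖ ≤ ‖x - y‖ := by
      refine le_of_sq_le_sq ?_ (norm_nonneg _)
      rw [norm_sub_hyperRefl_sq he]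
      nlinarith
    refine key2 _ _ _ _ _ (hl x y) ((hl _ _).trans ?_) ((hl _ _).trans ?_) ((hl _ _).trans ?_)
    · rw [norm_hyperRefl_sub_hyperRefl]
    · gcongr
    · rw [norm_hyperRefl_sub he]; gcongr
  refine LipschitzWith.of_dist_le_mul fun x y => ?_
  rw [Real.dist_eq, dist_eq_norm]
  have h1 := hl x y
  have h2 := hl (hyperRefl e α x) (hyperRefl e α y)
  rw [norm_hyperRefl_sub_hyperRefl] at h2
  by_cases hx : inner ℝ x e ≤ α <;> by_cases hy : inner ℝ y e ≤ α
  · rw [polarize, polarize, if_pos hx, if_pos hy]; exact (key _ _ _ _ _ h1 h2).1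
  · exact hcross x y hx (not_le.1 hy)
  · rw [abs_sub_comm, norm_sub_rev]; exact hcross y x hy (not_le.1 hx)
  · rw [polarize, polarize, if_neg hx, if_neg hy]; exact (key _ _ _ _ _ h1 h2).2

theorem hasCompactSupport_polarize {f : Space N → ℝ} (hf : HasCompactSupport f) :
    HasCompactSupport (polarize e α f) := by
  refine HasCompactSupport.of_support_subset_isCompact
    (hf.isCompact.union (hf.isCompact.image isometry_hyperRefl.continuous (f := hyperRefl e α)))
    fun x hx => ?_
  rcases polarize_pair he (α := α) f x with h | h
  · rw [Function.mem_support, h.1] at hx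
    exact Or.inl (subset_tsupport f hx)
  · rw [Function.mem_support, h.1] at hx
    exact Or.inr ⟨_, subset_tsupport f hx, hyperRefl_hyperRefl he x⟩

omit he in
theorem integral_eq_half_integral_add_hyperRefl {F : Space N → ℝ} (hF : Integrable F) :
    ∫ x, F x = 1 / 2 * ∫ x, (F x + F (hyperRefl e α x)) := by
  have h := (measurePreserving_hyperRefl (e := e) (α := α)).integral_comp
    measurableEmbedding_hyperRefl F
  have h' := integral_add hF
    ((measurePreserving_hyperRefl (e := e) (α := α)).integrable_comp_of_integrable hF)
  simp only [Function.comp_apply] at h'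
  rw [h', h]
  ring

theorem volume_hyperplane : volume {x : Space N | inner ℝ x e = α} = 0 := by
  have h1 : (ℝ ∙ e)ᗮ ≠ ⊤ := by
    intro h
    have : e ∈ (ℝ ∙ e)ᗮ := h ▸ Submodule.mem_top
    rw [Submodule.mem_orthogonal_singleton_iff_inner_left, real_inner_self_eq_norm_sq, he] at this
    norm_num at this
  have h2 := Measure.addHaar_submodule (volume : Measure (Space N)) _ h1
  have h3 : {x : Space N | inner ℝ x e = α} = (fun x => x + (-α) • e) ⁻¹' ((ℝ ∙ e)ᗮ : Set (Space N)) := by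
    ext x
    rw [Set.mem_preimage, SetLike.mem_coe, Submodule.mem_orthogonal_singleton_iff_inner_left,
      inner_add_left, inner_smul_left, real_inner_self_eq_norm_sq, he, Set.mem_ofPred_eq]
    simp only [conj_trivial]
    constructor <;> intro h <;> linarith
  rw [h3, measure_preimage_add_right, h2]

theorem ae_inner_ne : ∀ᵐ x : Space N, inner ℝ x e ≠ α := by
  rw [ae_iff]
  simpa using volume_hyperplane he (α := α)

omit he in
theorem norm_gradient_comp_hyperRefl (f : Space N → ℝ) (x : Space N) :
    ‖gradient (fun y => f (hyperRefl e α y)) x‖ = ‖gradient f (hyperRefl e α x)‖ := by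
  rw [norm_gradient_eq, norm_gradient_eq]
  have h1 : (fun y => f (hyperRefl e α y)) =
      (fun y => f (y + (2 * α) • e)) ∘ ((ℝ ∙ e)ᗮ.reflection).toContinuousLinearEquiv := rfl
  rw [h1, ContinuousLinearEquiv.comp_right_fderiv, fderiv_comp_add_right]
  exact ContinuousLinearMap.opNorm_comp_linearIsometryEquiv _ ((ℝ ∙ e)ᗮ.reflection)

/-- If the two values differ, polarization is locally the identity or the reflection. If they agree,
`polarize e α f - f` has a local minimum at `x` and a local maximum at its mirror image, so the
gradients coincide there. -/
theorem norm_gradient_polarize_pair {f : Space N → ℝ} (hf : Continuous f) {x : Space N}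
    (hx : inner ℝ x e < α) (h1 : DifferentiableAt ℝ f x)
    (h2 : DifferentiableAt ℝ f (hyperRefl e α x)) (h3 : DifferentiableAt ℝ (polarize e α f) x)
    (h4 : DifferentiableAt ℝ (polarize e α f) (hyperRefl e α x)) :
    ‖gradient (polarize e α f) x‖ ^ 2 + ‖gradient (polarize e α f) (hyperRefl e α x)‖ ^ 2 =
      ‖gradient f x‖ ^ 2 + ‖gradient f (hyperRefl e α x)‖ ^ 2 := by
  have hσ : Continuous (hyperRefl e α) := isometry_hyperRefl.continuous
  have n1 : ∀ᶠ y in 𝓝 x, inner ℝ y e < α :=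
    (continuous_id.inner continuous_const).continuousAt.eventually (gt_mem_nhds hx)
  have hx' : α < inner ℝ (hyperRefl e α x) e := by rw [inner_hyperRefl he]; linarith
  have n2 : ∀ᶠ y in 𝓝 (hyperRefl e α x), α < inner ℝ y e :=
    (continuous_id.inner continuous_const).continuousAt.eventually (lt_mem_nhds hx')
  have hg : Continuous fun y => f (hyperRefl e α y) := hf.comp hσ
  rcases lt_trichotomy (f x) (f (hyperRefl e α x)) with h | h | h
  · have e1 : polarize e α f =ᶠ[𝓝 x] fun y => f (hyperRefl e α y) := by
      filter_upwards [n1, hf.continuousAt.eventually_lt hg.continuousAt h] with y hy hy'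
      rw [polarize, if_pos hy.le, max_eq_right hy'.le]
    have e2 : polarize e α f =ᶠ[𝓝 (hyperRefl e α x)] fun y => f (hyperRefl e α y) := by
      have h' : f (hyperRefl e α (hyperRefl e α x)) < f (hyperRefl e α x) := by
        rwa [hyperRefl_hyperRefl he]
      filter_upwards [n2, hg.continuousAt.eventually_lt hf.continuousAt h'] with y hy hy'
      rw [polarize, if_neg hy.not_ge, min_eq_right hy'.le]
    rw [e1.gradient_eq, e2.gradient_eq, norm_gradient_comp_hyperRefl, norm_gradient_comp_hyperRefl,
      hyperRefl_hyperRefl he, add_comm]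
  · have e1 : IsLocalMin (fun y => polarize e α f y - f y) x := by
      filter_upwards [n1] with y hy
      rw [polarize, polarize, if_pos hx.le, if_pos hy.le, ← h, max_self, sub_self, sub_nonneg]
      exact le_max_left _ _
    have e2 : IsLocalMax (fun y => polarize e α f y - f y) (hyperRefl e α x) := by
      filter_upwards [n2] with y hy
      rw [polarize, polarize, if_neg hx'.not_ge, if_neg hy.not_ge, hyperRefl_hyperRefl he, ← h,
        min_self, sub_self, sub_nonpos]
      exact min_le_left _ _
    have g1 := e1.fderiv_eq_zero
    have g2 := e2.fderiv_eq_zero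
    rw [fderiv_fun_sub h3 h1, sub_eq_zero] at g1
    rw [fderiv_fun_sub h4 h2, sub_eq_zero] at g2
    simp only [norm_gradient_eq, g1, g2]
  · have e1 : polarize e α f =ᶠ[𝓝 x] f := by
      filter_upwards [n1, hg.continuousAt.eventually_lt hf.continuousAt h] with y hy hy'
      rw [polarize, if_pos hy.le, max_eq_left hy'.le]
    have e2 : polarize e α f =ᶠ[𝓝 (hyperRefl e α x)] f := by
      have h' : f (hyperRefl e α x) < f (hyperRefl e α (hyperRefl e α x)) := by
        rwa [hyperRefl_hyperRefl he]
      filter_upwards [n2, hf.continuousAt.eventually_lt hg.continuousAt h'] with y hy hy'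
      rw [polarize, if_neg hy.not_ge, min_eq_left hy'.le]
    rw [e1.gradient_eq, e2.gradient_eq]

/-- Polarization preserves the Dirichlet integral. -/
theorem dirichletForm_polarize {f : Space N → ℝ} {K : NNReal} (hf : LipschitzWith K f)
    (hc : HasCompactSupport f) :
    dirichletForm (polarize e α f) (polarize e α f) = dirichletForm f f := by
  have hp := lipschitzWith_polarize he (α := α) hf
  have hpc := hasCompactSupport_polarize he (α := α) hc
  rw [dirichletForm_eq_of_isWeakGradient (isWeakGradient_gradient hf hc),
    dirichletForm_eq_of_isWeakGradient (isWeakGradient_gradient hp hpc),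
    integral_eq_half_integral_add_hyperRefl (e := e) (α := α) (memLp_gradient hf hc).norm.integrable_sq,
    integral_eq_half_integral_add_hyperRefl (e := e) (α := α) (memLp_gradient hp hpc).norm.integrable_sq]
  congr 1
  refine integral_congr_ae ?_
  have hq := (measurePreserving_hyperRefl (e := e) (α := α)).quasiMeasurePreserving
  filter_upwards [ae_inner_ne he (α := α), hf.ae_differentiableAt (μ := volume),
    hp.ae_differentiableAt (μ := volume), hq.ae (hf.ae_differentiableAt (μ := volume)),
    hq.ae (hp.ae_differentiableAt (μ := volume))] with x hx h1 h3 h2 h4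
  rcases lt_or_gt_of_ne hx with h | h
  · exact norm_gradient_polarize_pair he hf.continuous h h1 h2 h3 h4
  · have h' : inner ℝ (hyperRefl e α x) e < α := by rw [inner_hyperRefl he]; linarith
    have := norm_gradient_polarize_pair he hf.continuous h' h2
      (by rwa [hyperRefl_hyperRefl he]) h4 (by rwa [hyperRefl_hyperRefl he])
    rw [hyperRefl_hyperRefl he] at this
    linarith

/-- The sum of the Gagliardo kernel over the four reflected copies of a point. -/
noncomputable def gagliardoQuad (s : ℝ) (e : Space N) (α : ℝ) (u : Space N → ℝ)
    (x y : Space N) : ℝ :=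
  gagliardoKernel s u u (x, y) + gagliardoKernel s u u (hyperRefl e α x, y) +
    gagliardoKernel s u u (x, hyperRefl e α y) +
    gagliardoKernel s u u (hyperRefl e α x, hyperRefl e α y)

theorem gagliardoQuad_hyperRefl_left (s : ℝ) (u : Space N → ℝ) (x y : Space N) :
    gagliardoQuad s e α u (hyperRefl e α x) y = gagliardoQuad s e α u x y := by
  simp only [gagliardoQuad, hyperRefl_hyperRefl he]; ring

theorem gagliardoQuad_hyperRefl_right (s : ℝ) (u : Space N → ℝ) (x y : Space N) :
    gagliardoQuad s e α u x (hyperRefl e α y) = gagliardoQuad s e α u x y := by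
  simp only [gagliardoQuad, hyperRefl_hyperRefl he]; ring

omit he in
-- When the pairs are oppositely ordered, the right side exceeds the left by `2 (k - l) |a - b| |c -
-- d|`; otherwise the sides agree.
theorem two_point_inequality {a b c d k l : ℝ} (hkl : l ≤ k) :
    k * (max a b - max c d) ^ 2 + l * (min a b - max c d) ^ 2 + l * (max a b - min c d) ^ 2 +
      k * (min a b - min c d) ^ 2 ≤
    k * (a - c) ^ 2 + l * (b - c) ^ 2 + l * (a - d) ^ 2 + k * (b - d) ^ 2 := by
  rcases le_total a b with h | h <;> rcases le_total c d with h' | h'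
  · rw [max_eq_right h, max_eq_right h', min_eq_left h, min_eq_left h']; linarith
  · rw [max_eq_right h, max_eq_left h', min_eq_left h, min_eq_right h']
    nlinarith [mul_nonneg (mul_nonneg (sub_nonneg.2 hkl) (sub_nonneg.2 h)) (sub_nonneg.2 h')]
  · rw [max_eq_left h, max_eq_right h', min_eq_right h, min_eq_left h']
    nlinarith [mul_nonneg (mul_nonneg (sub_nonneg.2 hkl) (sub_nonneg.2 h)) (sub_nonneg.2 h')]
  · rw [max_eq_left h, max_eq_left h', min_eq_right h, min_eq_right h']

theorem gagliardoQuad_polarize_le_of_le {s : ℝ} (hs : 0 < s) (u : Space N → ℝ) {x y : Space N}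
    (hx : inner ℝ x e ≤ α) (hy : inner ℝ y e ≤ α) :
    gagliardoQuad s e α (polarize e α u) x y ≤ gagliardoQuad s e α u x y := by
  set k := (‖x - y‖ ^ ((N : ℝ) + 2 * s))⁻¹ with hk
  set l := (‖x - hyperRefl e α y‖ ^ ((N : ℝ) + 2 * s))⁻¹ with hl
  have hq : ∀ v : Space N → ℝ, gagliardoQuad s e α v x y =
      k * (v x - v y) ^ 2 + l * (v (hyperRefl e α x) - v y) ^ 2 +
        l * (v x - v (hyperRefl e α y)) ^ 2 +
        k * (v (hyperRefl e α x) - v (hyperRefl e α y)) ^ 2 := by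
    intro v
    simp only [gagliardoQuad, gagliardoKernel, norm_hyperRefl_sub he, hyperRefl_hyperRefl he,
      div_eq_mul_inv, ← hk, ← hl]
    ring
  rw [hq, hq]
  obtain ⟨h1, h2⟩ := polarize_pair_of_le he (u := u) hx
  obtain ⟨h3, h4⟩ := polarize_pair_of_le he (u := u) hy
  -- On the diagonal `k` is the inverse of 0, that is 0, so `l ≤ k` may fail; there the four terms
  -- are compared directly.
  rcases eq_or_ne x y with rfl | hxy
  · rw [h1, h2]
    have : (u x - u (hyperRefl e α x)) ^ 2 = (max (u x) (u (hyperRefl e α x)) -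
        min (u x) (u (hyperRefl e α x))) ^ 2 := by
      rw [max_sub_min_eq_abs', sq_abs]
    have h5 : (min (u x) (u (hyperRefl e α x)) - max (u x) (u (hyperRefl e α x))) ^ 2 =
        (u (hyperRefl e α x) - u x) ^ 2 := by
      rw [← neg_sub, neg_sq, ← this]; ring
    rw [← this, h5]
    simp
  · rw [h1, h2, h3, h4]
    refine two_point_inequality ?_
    have hpos : 0 < ‖x - y‖ := norm_pos_iff.2 (sub_ne_zero.2 hxy)
    have hle : ‖x - y‖ ≤ ‖x - hyperRefl e α y‖ := by
      refine le_of_sq_le_sq ?_ (norm_nonneg _)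
      rw [norm_sub_hyperRefl_sq he]
      nlinarith
    rw [hk, hl]
    gcongr

/-- The sum over mirror copies is invariant under reflecting either point, so both may be moved into
the half-space. -/
theorem gagliardoQuad_polarize_le {s : ℝ} (hs : 0 < s) (u : Space N → ℝ) (x y : Space N) :
    gagliardoQuad s e α (polarize e α u) x y ≤ gagliardoQuad s e α u x y := by
  have hx : ∀ x : Space N, ¬ inner ℝ x e ≤ α → inner ℝ (hyperRefl e α x) e ≤ α := by
    intro x h
    rw [inner_hyperRefl he]; linarith
  by_cases h1 : inner ℝ x e ≤ α <;> by_cases h2 : inner ℝ y e ≤ α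
  · exact gagliardoQuad_polarize_le_of_le he hs u h1 h2
  · simpa only [gagliardoQuad_hyperRefl_right he] using
      gagliardoQuad_polarize_le_of_le he hs u h1 (hx y h2)
  · simpa only [gagliardoQuad_hyperRefl_left he] using
      gagliardoQuad_polarize_le_of_le he hs u (hx x h1) h2
  · simpa only [gagliardoQuad_hyperRefl_left he, gagliardoQuad_hyperRefl_right he] using
      gagliardoQuad_polarize_le_of_le he hs u (hx x h1) (hx y h2)

omit he in
theorem integrable_gagliardoQuad_and_integral_eq {s : ℝ} {u : Space N → ℝ}
    (hu : Integrable (gagliardoKernel s u u)) :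
    Integrable (fun z : Space N × Space N => gagliardoQuad s e α u z.1 z.2) ∧
      ∫ z : Space N × Space N, gagliardoQuad s e α u z.1 z.2 = 4 * gagliardoForm s u u := by
  have m0 := measurePreserving_hyperRefl (e := e) (α := α)
  have e0 := measurableEmbedding_hyperRefl (e := e) (α := α)
  have mid := MeasurePreserving.id (volume : Measure (Space N))
  have m1 := m0.prod mid
  have m2 := mid.prod m0
  have m3 := m0.prod m0
  have e1 : MeasurableEmbedding (Prod.map (hyperRefl e α) (id : Space N → Space N)) :=
    e0.prodMap .id
  have e2 : MeasurableEmbedding (Prod.map (id : Space N → Space N) (hyperRefl e α)) :=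
    MeasurableEmbedding.id.prodMap e0
  have e3 := e0.prodMap e0
  have i1 := m1.integrable_comp_of_integrable hu
  have i2 := m2.integrable_comp_of_integrable hu
  have i3 := m3.integrable_comp_of_integrable hu
  refine ⟨((hu.add i1).add i2).add i3, ?_⟩
  have := integral_add ((hu.add i1).add i2) i3
  have h1 := m1.integral_comp e1 (gagliardoKernel s u u)
  have h2 := m2.integral_comp e2 (gagliardoKernel s u u)
  have h3 := m3.integral_comp e3 (gagliardoKernel s u u)
  calc _ = ∫ z, (gagliardoKernel s u u z + gagliardoKernel s u u (Prod.map (hyperRefl e α) id z) +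
        gagliardoKernel s u u (Prod.map id (hyperRefl e α) z) +
        gagliardoKernel s u u (Prod.map (hyperRefl e α) (hyperRefl e α) z)) := rfl
    _ = gagliardoForm s u u + gagliardoForm s u u + gagliardoForm s u u + gagliardoForm s u u := by
        refine (integral_add ((hu.add i1).add i2) i3).trans ?_
        refine congrArg₂ _ ((integral_add (hu.add i1) i2).trans
          (congrArg₂ _ ((integral_add hu i1).trans (congrArg₂ _ rfl h1)) h2)) h3
    _ = _ := by ring

/-- Polarization does not increase the norm of `E`, for Lipschitz functions with compact support. -/
theorem mixedNorm_polarize_le_of_lipschitz (hN : 0 < N) {s : ℝ} (hs₀ : 0 < s) (hs₁ : s < 1)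
    {f : Space N → ℝ} {K : NNReal} (hf : LipschitzWith K f) (hc : HasCompactSupport f) :
    mixedNorm s (polarize e α f) ≤ mixedNorm s f := by
  refine Real.sqrt_le_sqrt (add_le_add (dirichletForm_polarize he hf hc).le ?_)
  obtain ⟨i1, h1⟩ := integrable_gagliardoQuad_and_integral_eq (e := e) (α := α)
    (integrable_gagliardoKernel_of_lipschitz hN hs₀ hs₁ hf hc)
  obtain ⟨i2, h2⟩ := integrable_gagliardoQuad_and_integral_eq (e := e) (α := α)
    (integrable_gagliardoKernel_of_lipschitz hN hs₀ hs₁ (lipschitzWith_polarize he (α := α) hf)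
      (hasCompactSupport_polarize he hc))
  have := integral_mono i2 i1 fun z => gagliardoQuad_polarize_le he hs₀ f z.1 z.2
  rw [h1, h2] at this
  linarith

/-- Polarization does not increase the norm of `E`. -/
theorem MemE.polarize (hN : 3 ≤ N) {s : ℝ} (hs₀ : 0 < s) (hs₁ : s < 1) {u : Space N → ℝ}
    (hu : MemE s u) :
    MemE s (polarize e α u) ∧ mixedNorm s (MixedLaplacian.polarize e α u) ≤ mixedNorm s u := by
  obtain ⟨φ, hφ, hlim, hae⟩ := hu.exists_test_tendsto hN hs₀ hs₁
  choose K hK using fun n => (hφ n).exists_lipschitzWith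
  refine MemE.of_tendsto_of_mixedNorm_le hN hs₀ hs₁
    (u := fun n => MixedLaplacian.polarize e α (φ n)) (c := fun n => mixedNorm s (φ n))
    (fun n => memE_of_lipschitz hN hs₀ hs₁ (lipschitzWith_polarize he (hK n))
      (hasCompactSupport_polarize he (hφ n).2))
    (fun n => mixedNorm_polarize_le_of_lipschitz he (by omega) hs₀ hs₁ (hK n) (hφ n).2)
    (tendsto_mixedNorm_of_sub hs₀ (hu.exists_jet hs₀)
      (fun n => (hφ n).exists_jet (by omega) hs₀ hs₁) hlim) ?_
  filter_upwards [hae, measurePreserving_hyperRefl.quasiMeasurePreserving.ae hae] with x h1 h2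
  simp only [MixedLaplacian.polarize]
  split_ifs
  · exact h1.max h2
  · exact h1.min h2

/-- Polarization preserves the integrals of functions of `u`. -/
theorem integral_comp_polarize (F : ℝ → ℝ) {u : Space N → ℝ} (hu : Integrable fun x => F (u x))
    (hp : Integrable fun x => F (polarize e α u x)) :
    ∫ x, F (polarize e α u x) = ∫ x, F (u x) := by
  rw [integral_eq_half_integral_add_hyperRefl (e := e) (α := α) hu,
    integral_eq_half_integral_add_hyperRefl (e := e) (α := α) hp]
  congr 1
  refine integral_congr_ae (Eventually.of_forall fun x => ?_)
  rcases polarize_pair he (α := α) u x with h | h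
  · simp only [h.1, h.2]
  · simp only [h.1, h.2]; ring

theorem polarize_sub_hyperRefl (u : Space N → ℝ) (x : Space N) :
    polarize e α u (hyperRefl e α x) - u (hyperRefl e α x) = - (polarize e α u x - u x) := by
  rcases polarize_pair he (α := α) u x with h | h <;> rw [h.1, h.2] <;> ring

/-- If polarization does not decrease the second moment of `u`, then `u` is invariant under it. -/
theorem polarize_ae_eq_of_moment_le (hα : 0 < α) {u : Space N → ℝ}
    (hu : Integrable fun x => u x * ‖x‖ ^ 2) (hp : Integrable fun x => polarize e α u x * ‖x‖ ^ 2)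
    (h : ∫ x, u x * ‖x‖ ^ 2 ≤ ∫ x, polarize e α u x * ‖x‖ ^ 2) : polarize e α u =ᵐ[volume] u := by
  have hd := hp.sub hu
  have h1 : ∫ x, (polarize e α u x - u x) * ‖x‖ ^ 2 = ∫ x, polarize e α u x * ‖x‖ ^ 2 -
      u x * ‖x‖ ^ 2 := by simp only [sub_mul]
  have hd' : Integrable fun x => (polarize e α u x - u x) * ‖x‖ ^ 2 := by
    refine hd.congr (Eventually.of_forall fun x => ?_)
    simp only [Pi.sub_apply]; ring
  -- The changes at mirror points are opposite, so the pair contributes a change times the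
  -- difference of the squared norms, which has a definite sign.
  have e1 : ∀ x, (polarize e α u x - u x) * ‖x‖ ^ 2 +
      (polarize e α u (hyperRefl e α x) - u (hyperRefl e α x)) * ‖hyperRefl e α x‖ ^ 2 =
      -(4 * α * ((polarize e α u x - u x) * (α - inner ℝ x e))) := by
    intro x
    rw [polarize_sub_hyperRefl he, norm_hyperRefl_sq he]; ring
  have hi : Integrable fun x => -(4 * α * ((polarize e α u x - u x) * (α - inner ℝ x e))) := by
    simp only [← e1]
    exact hd'.add (measurePreserving_hyperRefl.integrable_comp_of_integrable hd')
  have hi' : Integrable fun x => (polarize e α u x - u x) * (α - inner ℝ x e) := by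
    refine (hi.const_mul (-(4 * α)⁻¹)).congr (Eventually.of_forall fun x => ?_)
    field_simp
  have hnn : ∀ x, 0 ≤ (polarize e α u x - u x) * (α - inner ℝ x e) := by
    intro x
    rw [MixedLaplacian.polarize]
    split_ifs with hx
    · exact mul_nonneg (sub_nonneg.2 (le_max_left _ _)) (sub_nonneg.2 hx)
    · exact mul_nonneg_of_nonpos_of_nonpos (sub_nonpos.2 (min_le_left _ _)) (by linarith)
  have h2 := integral_eq_half_integral_add_hyperRefl (e := e) (α := α) hd'
  simp only [e1] at h2
  rw [h1, integral_sub hp hu, integral_neg, integral_const_mul] at h2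
  -- The moment drops by `2 α` times this nonnegative integral; since it does not drop, the integral
  -- vanishes.
  have h3 : ∫ x, (polarize e α u x - u x) * (α - inner ℝ x e) = 0 := by
    refine le_antisymm ?_ (integral_nonneg hnn)
    nlinarith
  rw [integral_eq_zero_iff_of_nonneg hnn hi'] at h3
  filter_upwards [h3, ae_inner_ne he (α := α)] with x hx hne
  rw [Pi.zero_apply, mul_eq_zero] at hx
  exact sub_eq_zero.1 (hx.resolve_right (sub_ne_zero.2 hne.symm))

end Reflection

/-! ### Critical bounds and the embedding into `L^p` -/

theorem integrable_rpow_of_memLp {q : ℝ} (hq : 0 < q) {u : Space N → ℝ}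
    (hu : MemLp u (ENNReal.ofReal q)) : Integrable fun x => |u x| ^ q := by
  have := hu.integrable_norm_rpow (by simpa using hq) ENNReal.ofReal_ne_top
  rwa [ENNReal.toReal_ofReal hq.le] at this

theorem integral_rpow_le_of_eLpNorm_le {q : ℝ} (hq : 0 < q) {u : Space N → ℝ} {B : ℝ} (hB : 0 ≤ B)
    (hu : AEStronglyMeasurable u volume) (h : eLpNorm u (ENNReal.ofReal q) ≤ ENNReal.ofReal B) :
    ∫ x, |u x| ^ q ≤ B ^ q := by
  have hm : MemLp u (ENNReal.ofReal q) := ⟨hu, h.trans_lt ENNReal.ofReal_lt_top⟩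
  rw [hm.eLpNorm_eq_integral_rpow_norm (by simpa using hq) ENNReal.ofReal_ne_top,
    ENNReal.toReal_ofReal hq.le, ENNReal.ofReal_le_ofReal_iff hB] at h
  have h0 : 0 ≤ ∫ x, |u x| ^ q := integral_nonneg fun x => Real.rpow_nonneg (abs_nonneg _) _
  calc ∫ x, |u x| ^ q = ((∫ x, |u x| ^ q) ^ q⁻¹) ^ q := by
        rw [← Real.rpow_mul h0, inv_mul_cancel₀ hq.ne', Real.rpow_one]
    _ ≤ B ^ q := Real.rpow_le_rpow (Real.rpow_nonneg h0 _) h hq.le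

theorem MemE.integrable_critExp (hN : 3 ≤ N) {s : ℝ} {u : Space N → ℝ} (hu : MemE s u) :
    Integrable fun x => |u x| ^ critExp N :=
  integrable_rpow_of_memLp (by linarith [two_lt_critExp hN]) hu.memLp

theorem MemE.integrable_fracCritExp (hN : 3 ≤ N) {s : ℝ} (hs₀ : 0 < s) (hs₁ : s < 1)
    {u : Space N → ℝ} (hu : MemE s u) : Integrable fun x => |u x| ^ fracCritExp N s := by
  obtain ⟨C, hC⟩ := MemE.exists_eLpNorm_fracCritExp_le hN hs₀ hs₁
  refine integrable_rpow_of_memLp (by linarith [two_lt_fracCritExp hN hs₀ hs₁])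
    ⟨hu.memLp.1, (hC u hu).trans_lt ?_⟩
  exact ENNReal.mul_lt_top ENNReal.coe_lt_top ENNReal.ofReal_lt_top

/-- Bounds for the integrals of the two critical powers on bounded subsets of `E`. -/
theorem exists_integral_rpow_critical_le (hN : 3 ≤ N) {s : ℝ} (hs₀ : 0 < s) (hs₁ : s < 1) (B : ℝ) :
    ∃ A : ℝ, ∀ u : Space N → ℝ, MemE s u → mixedNorm s u ≤ B →
      ∫ x, |u x| ^ critExp N ≤ A ∧ ∫ x, |u x| ^ fracCritExp N s ≤ A := by
  obtain ⟨C, hC⟩ := MemE.exists_eLpNorm_critExp_le hN hs₀ hs₁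
  obtain ⟨D, hD⟩ := MemE.exists_eLpNorm_fracCritExp_le hN hs₀ hs₁
  have key : ∀ (C : NNReal) (u : Space N → ℝ), mixedNorm s u ≤ B →
      (C : ENNReal) * ENNReal.ofReal (mixedNorm s u) ≤ ENNReal.ofReal (C * B) := by
    intro C u h
    rw [ENNReal.ofReal_mul C.coe_nonneg, ENNReal.ofReal_coe_nnreal]
    gcongr
  refine ⟨max ((C * B) ^ critExp N) ((D * B) ^ fracCritExp N s), fun u hu hB => ?_⟩
  have hB0 : 0 ≤ B := (mixedNorm_nonneg s u).trans hB
  exact ⟨(integral_rpow_le_of_eLpNorm_le (by linarith [two_lt_critExp hN]) (by positivity)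
      hu.memLp.1 ((hC u hu).trans (key C u hB))).trans (le_max_left _ _),
    (integral_rpow_le_of_eLpNorm_le (by linarith [two_lt_fracCritExp hN hs₀ hs₁]) (by positivity)
      hu.memLp.1 ((hD u hu).trans (key D u hB))).trans (le_max_right _ _)⟩

theorem rpow_le_rpow_add_rpow {t a b p : ℝ} (ht : 0 ≤ t) (ha : 0 < a) (hap : a ≤ p) (hpb : p ≤ b) :
    t ^ p ≤ t ^ a + t ^ b := by
  rcases ht.eq_or_lt with rfl | h0
  · rw [Real.zero_rpow (by linarith), Real.zero_rpow ha.ne', Real.zero_rpow (by linarith)]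
    norm_num
  rcases le_total t 1 with h | h
  · have := Real.rpow_le_rpow_of_exponent_ge h0 h hap
    have := Real.rpow_nonneg ht b
    linarith
  · have := Real.rpow_le_rpow_of_exponent_le h hpb
    have := Real.rpow_nonneg ht a
    linarith

theorem aestronglyMeasurable_abs_rpow {u : Space N → ℝ} (hu : AEStronglyMeasurable u volume)
    (p : ℝ) : AEStronglyMeasurable (fun x => |u x| ^ p) volume :=
  (hu.norm.aemeasurable.pow_const p).aestronglyMeasurable

section Subcritical

variable {s p : ℝ} (hN : 3 ≤ N) (hs₀ : 0 < s) (hs₁ : s < 1)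
  (hp₁ : fracCritExp N s < p) (hp₂ : p < critExp N)
include hN hs₀ hs₁ hp₁ hp₂

theorem MemE.integrable_rpow {u : Space N → ℝ} (hu : MemE s u) :
    Integrable fun x => |u x| ^ p := by
  have h2 := two_lt_fracCritExp hN hs₀ hs₁
  refine ((hu.integrable_fracCritExp hN hs₀ hs₁).add (hu.integrable_critExp hN)).mono'
    (aestronglyMeasurable_abs_rpow hu.memLp.1 p) (Eventually.of_forall fun x => ?_)
  rw [Real.norm_of_nonneg (Real.rpow_nonneg (abs_nonneg _) _)]
  exact rpow_le_rpow_add_rpow (abs_nonneg _) (by linarith) hp₁.le hp₂.le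

omit hs₁ hp₁ hp₂ in
theorem MemE.ae_eq_zero_of_mixedNorm_eq_zero {u : Space N → ℝ} (hu : MemE s u)
    (h : mixedNorm s u = 0) : u =ᵐ[volume] 0 := by
  obtain ⟨k, hk⟩ := hu.exists_jet hs₀
  rw [hk.mixedNorm_eq hs₀, norm_eq_zero] at h
  exact ae_eq_zero_of_isJet_zero hN hu.memLp (h ▸ hk)

/-- The embedding of `E` into `L^p` for subcritical `p`. -/
theorem exists_integral_rpow_le : ∃ C : ℝ, 0 < C ∧ ∀ u : Space N → ℝ, MemE s u →
    ∫ x, |u x| ^ p ≤ C * mixedNorm s u ^ p := by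
  have h2 := two_lt_fracCritExp hN hs₀ hs₁
  obtain ⟨A, hA⟩ := exists_integral_rpow_critical_le hN hs₀ hs₁ 1
  -- On the unit sphere `|u|^p` is dominated by the sum of the two critical powers, each with
  -- integral at most `A`; homogeneity does the rest. The maximum with 1 only makes the constant
  -- positive.
  refine ⟨max (A + A) 1, by positivity, fun u hu => ?_⟩
  rcases (mixedNorm_nonneg s u).eq_or_lt with h | h
  · have h0 := hu.ae_eq_zero_of_mixedNorm_eq_zero hN hs₀ h.symm
    have : ∫ x, |u x| ^ p = 0 := by
      refine integral_eq_zero_of_ae ?_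
      filter_upwards [h0] with x hx
      rw [hx, Pi.zero_apply, abs_zero, Real.zero_rpow (by linarith)]
    rw [this]
    positivity
  · set m := mixedNorm s u with hm
    have hv := hu.smul (by omega) hs₀ hs₁ m⁻¹
    have hv1 : mixedNorm s (m⁻¹ • u) = 1 := by
      rw [mixedNorm_smul s hs₀ (hu.exists_jet hs₀), abs_of_pos (by positivity), ← hm,
        inv_mul_cancel₀ h.ne']
    obtain ⟨h3, h4⟩ := hA _ hv hv1.le
    have h5 : ∫ x, |(m⁻¹ • u) x| ^ p ≤ A + A := by
      calc _ ≤ ∫ x, (|(m⁻¹ • u) x| ^ fracCritExp N s + |(m⁻¹ • u) x| ^ critExp N) :=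
            integral_mono (hv.integrable_rpow hN hs₀ hs₁ hp₁ hp₂)
              ((hv.integrable_fracCritExp hN hs₀ hs₁).add (hv.integrable_critExp hN))
              fun x => rpow_le_rpow_add_rpow (abs_nonneg _) (by linarith) hp₁.le hp₂.le
        _ ≤ _ := by
            rw [integral_add (hv.integrable_fracCritExp hN hs₀ hs₁) (hv.integrable_critExp hN)]
            exact add_le_add h4 h3
    have h6 : ∀ x, |u x| ^ p = |(m⁻¹ • u) x| ^ p * m ^ p := by
      intro x
      rw [← Real.mul_rpow (abs_nonneg _) h.le, Pi.smul_apply, smul_eq_mul, abs_mul,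
        abs_of_pos (inv_pos.2 h)]
      congr 1
      field_simp
    simp only [h6]
    rw [integral_mul_const]
    refine mul_le_mul_of_nonneg_right (h5.trans (le_max_left _ _)) (by positivity)

end Subcritical

/-! ### Dyadic averages and local compactness -/

/-- The half-open dyadic cube of side `2^(-k)` with index `m`. -/
def dyadicCube (k : ℕ) (m : Fin N → ℤ) : Set (Space N) :=
  {x | ∀ i, ⌊(2 : ℝ) ^ k * x i⌋ = m i}

theorem dyadicCube_eq_preimage (k : ℕ) (m : Fin N → ℤ) : dyadicCube k m =
    (WithLp.ofLp : Space N → Fin N → ℝ) ⁻¹'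
      Set.univ.pi fun i => Set.Ico ((m i : ℝ) / 2 ^ k) ((m i + 1 : ℝ) / 2 ^ k) := by
  ext x
  simp only [dyadicCube, Set.mem_ofPred_eq, Set.mem_preimage, Set.mem_pi, Set.mem_univ,
    forall_const, Set.mem_Ico, Int.floor_eq_iff]
  refine forall_congr' fun i => ?_
  rw [div_le_iff₀' (by positivity), lt_div_iff₀' (by positivity)]

theorem measurableSet_dyadicCube (k : ℕ) (m : Fin N → ℤ) : MeasurableSet (dyadicCube k m) := by
  rw [dyadicCube_eq_preimage]
  exact (PiLp.volume_preserving_ofLp (Fin N)).measurable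
    (MeasurableSet.univ_pi fun i => measurableSet_Ico)

theorem volume_dyadicCube (k : ℕ) (m : Fin N → ℤ) :
    volume (dyadicCube k m) = ENNReal.ofReal (((2 : ℝ) ^ k)⁻¹ ^ N) := by
  rw [dyadicCube_eq_preimage, (PiLp.volume_preserving_ofLp (Fin N)).measure_preimage
    (MeasurableSet.univ_pi fun i => measurableSet_Ico).nullMeasurableSet, Real.volume_pi_Ico]
  simp only [← sub_div, add_sub_cancel_left, one_div]
  rw [Finset.prod_const, Finset.card_univ, Fintype.card_fin, ENNReal.ofReal_pow (by positivity)]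

theorem norm_sub_le_of_mem_dyadicCube {k : ℕ} {m : Fin N → ℤ} {x y : Space N}
    (hx : x ∈ dyadicCube k m) (hy : y ∈ dyadicCube k m) :
    ‖x - y‖ ≤ √N * ((2 : ℝ) ^ k)⁻¹ := by
  have h : ∀ i, ‖(x - y) i‖ ^ 2 ≤ (((2 : ℝ) ^ k)⁻¹) ^ 2 := by
    intro i
    have h1 := Int.abs_sub_lt_one_of_floor_eq_floor ((hx i).trans (hy i).symm)
    rw [← mul_sub, abs_mul, abs_of_pos (by positivity : (0 : ℝ) < 2 ^ k)] at h1
    refine pow_le_pow_left₀ (norm_nonneg _) ?_ 2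
    rw [PiLp.sub_apply, Real.norm_eq_abs, inv_eq_one_div, le_div_iff₀' (by positivity)]
    exact h1.le
  rw [EuclideanSpace.norm_eq]
  calc √(∑ i, ‖(x - y) i‖ ^ 2) ≤ √(∑ _i : Fin N, (((2 : ℝ) ^ k)⁻¹) ^ 2) :=
        Real.sqrt_le_sqrt (Finset.sum_le_sum fun i _ => h i)
    _ = √N * ((2 : ℝ) ^ k)⁻¹ := by
        rw [Finset.sum_const, Finset.card_univ, Fintype.card_fin, nsmul_eq_mul,
          Real.sqrt_mul (Nat.cast_nonneg N), Real.sqrt_sq (by positivity)]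

theorem disjoint_dyadicCube {k : ℕ} {m n : Fin N → ℤ} (h : m ≠ n) :
    Disjoint (dyadicCube k m) (dyadicCube k n) :=
  Set.disjoint_left.2 fun _ hx hy => h (funext fun i => (hx i).symm.trans (hy i))

theorem exists_finset_closedBall_subset_dyadicCube (k : ℕ) (R : ℝ) :
    ∃ F : Finset (Fin N → ℤ), Metric.closedBall (0 : Space N) R ⊆ ⋃ m ∈ F, dyadicCube k m := by
  refine ⟨Fintype.piFinset fun _ => Finset.Icc ⌊-(2 ^ k * R)⌋ ⌊2 ^ k * R⌋, fun x hx => ?_⟩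
  simp only [Set.mem_iUnion]
  refine ⟨fun i => ⌊(2 : ℝ) ^ k * x i⌋, ?_, fun i => rfl⟩
  rw [Fintype.mem_piFinset]
  intro i
  have h1 : |x i| ≤ R := by
    rw [mem_closedBall_zero_iff] at hx
    exact (PiLp.norm_apply_le x i).trans hx
  rw [abs_le] at h1
  have h2 : (0 : ℝ) < 2 ^ k := by positivity
  rw [Finset.mem_Icc]
  exact ⟨Int.floor_mono (by nlinarith), Int.floor_mono (by nlinarith)⟩

/-- The second moment of a function on a set of finite measure, in terms of its oscillation and its
mean. -/
theorem integral_sq_eq_oscillation {X : Type*} [MeasurableSpace X] {μ : Measure X} [IsFiniteMeasure μ]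
    {w : X → ℝ} (hw : MemLp w 2 μ) :
    Integrable (fun z : X × X => (w z.1 - w z.2) ^ 2) (μ.prod μ) ∧
    2 * μ.real Set.univ * ∫ x, w x ^ 2 ∂μ =
      ∫ z, (w z.1 - w z.2) ^ 2 ∂(μ.prod μ) + 2 * (∫ x, w x ∂μ) ^ 2 := by
  have i2 : Integrable (fun x => w x ^ 2) μ := hw.integrable_sq
  have i1 : Integrable w μ := hw.integrable (by norm_num)
  have a1 : Integrable (fun z : X × X => w z.1 ^ 2) (μ.prod μ) := i2.comp_fst μ
  have a2 : Integrable (fun z : X × X => w z.2 ^ 2) (μ.prod μ) := i2.comp_snd μ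
  have a3 : Integrable (fun z : X × X => 2 * (w z.1 * w z.2)) (μ.prod μ) :=
    (i1.mul_prod i1).const_mul 2
  have e : (fun z : X × X => (w z.1 - w z.2) ^ 2) =
      fun z => w z.1 ^ 2 + w z.2 ^ 2 - 2 * (w z.1 * w z.2) := by
    ext z; ring
  refine ⟨by rw [e]; exact (a1.add a2).sub a3, ?_⟩
  have a12 : Integrable (fun z : X × X => w z.1 ^ 2 + w z.2 ^ 2) (μ.prod μ) := a1.add a2
  rw [e, integral_sub a12 a3, integral_add a1 a2, integral_const_mul,
    integral_prod_mul, integral_fun_fst (f := fun x => w x ^ 2),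
    integral_fun_snd (f := fun x => w x ^ 2)]
  simp only [smul_eq_mul]
  ring

/-- A fractional Poincaré inequality. Points of the cube are at distance at most `√N δ`, so the
oscillation is at most `(√N δ)^(N+2s)` times the kernel; dividing by the volume `δ^N` leaves the
small factor `δ^(2s)`. -/
theorem integral_sq_dyadicCube_le {s : ℝ} (hs₀ : 0 < s) {k : ℕ} {m : Fin N → ℤ}
    {w : Space N → ℝ} (hw : MemLp w 2 (volume.restrict (dyadicCube k m)))
    (hi : Integrable (gagliardoKernel s w w)) :
    ∫ x in dyadicCube k m, w x ^ 2 ≤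
      √N ^ ((N : ℝ) + 2 * s) * (((2 : ℝ) ^ k)⁻¹) ^ (2 * s) *
        (∫ z in dyadicCube k m ×ˢ dyadicCube k m, gagliardoKernel s w w z) +
      (2 ^ k) ^ N * (∫ x in dyadicCube k m, w x) ^ 2 := by
  set Q := dyadicCube k m with hQ
  set δ : ℝ := ((2 : ℝ) ^ k)⁻¹ with hδ
  have hδ0 : 0 < δ := by positivity
  have hQm : MeasurableSet Q := measurableSet_dyadicCube k m
  have hfin : volume Q < ⊤ := by rw [hQ, volume_dyadicCube]; exact ENNReal.ofReal_lt_top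
  have : IsFiniteMeasure (volume.restrict Q) := ⟨by rwa [Measure.restrict_apply_univ]⟩
  obtain ⟨h1, h2⟩ := integral_sq_eq_oscillation hw
  have hvol : (volume.restrict Q).real Set.univ = δ ^ N := by
    rw [measureReal_restrict_apply_univ, Measure.real, hQ, volume_dyadicCube,
      ENNReal.toReal_ofReal (by positivity)]
  rw [hvol, Measure.prod_restrict] at h2
  rw [Measure.prod_restrict] at h1
  have h3 : ∫ z in Q ×ˢ Q, (w z.1 - w z.2) ^ 2 ≤
      ∫ z in Q ×ˢ Q, (√N * δ) ^ ((N : ℝ) + 2 * s) * gagliardoKernel s w w z := by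
    refine setIntegral_mono_on h1 (hi.integrableOn.const_mul _) (hQm.prod hQm) fun z hz => ?_
    rcases eq_or_ne z.1 z.2 with e | e
    · rw [gagliardoKernel, e]; simp
    · have hpos : 0 < ‖z.1 - z.2‖ := norm_pos_iff.2 (sub_ne_zero.2 e)
      have hle : ‖z.1 - z.2‖ ≤ √N * δ := norm_sub_le_of_mem_dyadicCube hz.1 hz.2
      rw [gagliardoKernel, mul_div_assoc', le_div_iff₀ (by positivity), mul_comm, ← sq]
      gcongr
  rw [integral_const_mul] at h3
  have hN0 : (0 : ℝ) < δ ^ N := by positivity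
  have e1 : (√N * δ) ^ ((N : ℝ) + 2 * s) = δ ^ N * (√N ^ ((N : ℝ) + 2 * s) * δ ^ (2 * s)) := by
    rw [Real.mul_rpow (Real.sqrt_nonneg _) hδ0.le, Real.rpow_add hδ0, Real.rpow_natCast]; ring
  have e2 : δ ^ N * (2 ^ k) ^ N = 1 := by
    rw [← mul_pow, hδ, inv_mul_cancel₀ (by positivity), one_pow]
  have hG : 0 ≤ ∫ z in Q ×ˢ Q, gagliardoKernel s w w z :=
    integral_nonneg (gagliardoKernel_self_nonneg s w)
  rw [e1] at h3
  have hc : 0 ≤ √N ^ ((N : ℝ) + 2 * s) * δ ^ (2 * s) := by positivity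
  refine le_of_mul_le_mul_left ?_ hN0
  rw [mul_add, ← mul_assoc (δ ^ N) ((2 ^ k) ^ N), e2, one_mul]
  change ∫ z in Q ×ˢ Q, (w z.1 - w z.2) ^ 2 ≤ _ at h3
  change 2 * δ ^ N * _ = (∫ z in Q ×ˢ Q, (w z.1 - w z.2) ^ 2) + _ at h2
  nlinarith [mul_nonneg hN0.le (mul_nonneg hc hG)]

/-- On a ball, the `L²` norm is controlled by the Gagliardo seminorm, with a small constant, and by
finitely many averages. -/
theorem exists_finset_integral_sq_le {s : ℝ} (hs₀ : 0 < s) (k : ℕ) (R : ℝ) :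
    ∃ F : Finset (Fin N → ℤ), ∀ w : Space N → ℝ,
      (∀ S : Set (Space N), volume S < ⊤ → MemLp w 2 (volume.restrict S)) →
      Integrable (gagliardoKernel s w w) →
      ∫ x in Metric.closedBall 0 R, w x ^ 2 ≤
        √N ^ ((N : ℝ) + 2 * s) * (((2 : ℝ) ^ k)⁻¹) ^ (2 * s) * gagliardoForm s w w +
        (2 ^ k) ^ N * ∑ m ∈ F, (∫ x in dyadicCube k m, w x) ^ 2 := by
  obtain ⟨F, hF⟩ := exists_finset_closedBall_subset_dyadicCube (N := N) k R
  refine ⟨F, fun w hw hi => ?_⟩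
  have hfin : ∀ m : Fin N → ℤ, volume (dyadicCube k m) < ⊤ := fun m => by
    rw [volume_dyadicCube]; exact ENNReal.ofReal_lt_top
  have hio : ∀ m ∈ F, IntegrableOn (fun x => w x ^ 2) (dyadicCube k m) := fun m _ =>
    (hw _ (hfin m)).integrable_sq
  calc ∫ x in Metric.closedBall 0 R, w x ^ 2 ≤ ∫ x in ⋃ m ∈ F, dyadicCube k m, w x ^ 2 := by
        refine setIntegral_mono_set ?_ (Eventually.of_forall fun x => sq_nonneg _)
          hF.eventuallyLE
        exact integrableOn_finset_iUnion.2 hio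
    _ = ∑ m ∈ F, ∫ x in dyadicCube k m, w x ^ 2 :=
        integral_biUnion_finset F (fun m _ => measurableSet_dyadicCube k m)
          (fun m _ n _ h => disjoint_dyadicCube h) hio
    _ ≤ ∑ m ∈ F, (√N ^ ((N : ℝ) + 2 * s) * (((2 : ℝ) ^ k)⁻¹) ^ (2 * s) *
        (∫ z in dyadicCube k m ×ˢ dyadicCube k m, gagliardoKernel s w w z) +
        (2 ^ k) ^ N * (∫ x in dyadicCube k m, w x) ^ 2) :=
        Finset.sum_le_sum fun m _ => integral_sq_dyadicCube_le hs₀ (hw _ (hfin m)) hi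
    _ = √N ^ ((N : ℝ) + 2 * s) * (((2 : ℝ) ^ k)⁻¹) ^ (2 * s) *
        (∑ m ∈ F, ∫ z in dyadicCube k m ×ˢ dyadicCube k m, gagliardoKernel s w w z) +
        (2 ^ k) ^ N * ∑ m ∈ F, (∫ x in dyadicCube k m, w x) ^ 2 := by
        rw [Finset.sum_add_distrib, Finset.mul_sum, Finset.mul_sum]
    _ ≤ _ := by
        gcongr
        rw [← integral_biUnion_finset F
          (fun m _ => (measurableSet_dyadicCube k m).prod (measurableSet_dyadicCube k m))
          (fun m _ n _ h => Set.disjoint_prod.2 (Or.inl (disjoint_dyadicCube h)))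
          (fun m _ => hi.integrableOn)]
        exact setIntegral_le_integral hi (Eventually.of_forall (gagliardoKernel_self_nonneg s w))

theorem eLpNorm_two_eq_ofReal_sqrt {X : Type*} [MeasurableSpace X] {μ : Measure X} {f : X → ℝ}
    (hf : MemLp f 2 μ) : eLpNorm f 2 μ = ENNReal.ofReal (√(∫ x, f x ^ 2 ∂μ)) := by
  rw [hf.eLpNorm_eq_integral_rpow_norm (by norm_num) (by norm_num), Real.sqrt_eq_rpow]
  simp only [ENNReal.toReal_ofNat, Real.rpow_two, Real.norm_eq_abs, sq_abs, one_div]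

theorem MemE.memLp_two_restrict (hN : 3 ≤ N) {s : ℝ} {u : Space N → ℝ} (hu : MemE s u)
    {S : Set (Space N)} (hS : volume S < ⊤) : MemLp u 2 (volume.restrict S) := by
  have : IsFiniteMeasure (volume.restrict S) := ⟨by rwa [Measure.restrict_apply_univ]⟩
  refine hu.memLp.restrict S |>.mono_exponent ?_
  rw [← ENNReal.ofReal_ofNat 2]
  exact ENNReal.ofReal_le_ofReal (two_lt_critExp hN).le

/-- From `t ≤ 1 + t^{2^*}`; it keeps the averages of a bounded sequence in a compact interval. -/
theorem MemE.abs_setIntegral_le (hN : 3 ≤ N) {s : ℝ} {u : Space N → ℝ} (hu : MemE s u)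
    {S : Set (Space N)} (hS : volume S < ⊤) :
    |∫ x in S, u x| ≤ volume.real S + ∫ x, |u x| ^ critExp N := by
  have : IsFiniteMeasure (volume.restrict S) := ⟨by rwa [Measure.restrict_apply_univ]⟩
  have hi := hu.integrable_critExp hN
  have h2 := two_lt_critExp hN
  calc |∫ x in S, u x| ≤ ∫ x in S, |u x| := abs_integral_le_integral_abs
    _ ≤ ∫ x in S, (1 + |u x| ^ critExp N) := by
        refine integral_mono ((hu.memLp_two_restrict hN hS).integrable (by norm_num)).abs
          ((integrable_const 1).add hi.restrict) fun x => ?_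
        dsimp only
        rcases le_total |u x| 1 with h | h
        · have := Real.rpow_nonneg (abs_nonneg (u x)) (critExp N)
          linarith
        · have := Real.rpow_le_rpow_of_exponent_le h (by linarith : 1 ≤ critExp N)
          rw [Real.rpow_one] at this
          linarith
    _ = volume.real S + ∫ x in S, |u x| ^ critExp N := by
        rw [integral_add (integrable_const 1) hi.restrict]
        simp
    _ ≤ _ := by
        gcongr _ + ?_
        exact setIntegral_le_integral hi
          (Eventually.of_forall fun x => Real.rpow_nonneg (abs_nonneg _) _)

/-- A bounded sequence in `E` has a subsequence along which all dyadic averages converge. -/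
theorem exists_subseq_tendsto_setIntegral_dyadicCube (hN : 3 ≤ N) {s : ℝ} (hs₀ : 0 < s)
    (hs₁ : s < 1) {u : ℕ → Space N → ℝ} {B : ℝ} (hu : ∀ n, MemE s (u n))
    (hB : ∀ n, mixedNorm s (u n) ≤ B) :
    ∃ ns : ℕ → ℕ, StrictMono ns ∧ ∃ L : ℕ × (Fin N → ℤ) → ℝ, ∀ k m,
      Tendsto (fun j => ∫ x in dyadicCube k m, u (ns j) x) atTop (𝓝 (L (k, m))) := by
  obtain ⟨A, hA⟩ := exists_integral_rpow_critical_le hN hs₀ hs₁ B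
  have hfin : ∀ (k : ℕ) (m : Fin N → ℤ), volume (dyadicCube k m) < ⊤ := fun k m => by
    rw [volume_dyadicCube]; exact ENNReal.ofReal_lt_top
  -- All averages are treated at once as a point of a product of compact intervals; the index set is
  -- countable, so the product is sequentially compact.
  set S : Set (ℕ × (Fin N → ℤ) → ℝ) := Set.univ.pi fun i =>
    Set.Icc (-(volume.real (dyadicCube i.1 i.2) + A)) (volume.real (dyadicCube i.1 i.2) + A)
  have hS : IsCompact S := isCompact_univ_pi fun i => isCompact_Icc
  obtain ⟨L, -, ns, hns, h⟩ := hS.tendsto_subseq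
    (x := fun n i => ∫ x in dyadicCube i.1 i.2, u n x) fun n i _ => by
      change _ ∈ Set.Icc _ _
      rw [Set.mem_Icc, ← abs_le]
      refine ((hu n).abs_setIntegral_le hN (hfin _ _)).trans ?_
      gcongr
      exact (hA _ (hu n) (hB n)).1
  exact ⟨ns, hns, L, fun k m => (tendsto_pi_nhds.1 h (k, m))⟩

/-- Convergence of all dyadic averages of a bounded sequence in `E` makes it a Cauchy sequence in
`L²` of every ball. -/
theorem cauchy_integral_sq_of_tendsto_dyadicCube (hN : 3 ≤ N) {s : ℝ} (hs₀ : 0 < s)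
    (hs₁ : s < 1) {u : ℕ → Space N → ℝ} {B : ℝ} (hu : ∀ n, MemE s (u n))
    (hB : ∀ n, mixedNorm s (u n) ≤ B) {L : ℕ × (Fin N → ℤ) → ℝ}
    (hL : ∀ k m, Tendsto (fun j => ∫ x in dyadicCube k m, u j x) atTop (𝓝 (L (k, m))))
    (R : ℝ) {ε : ℝ} (hε : 0 < ε) :
    ∃ n₀, ∀ i j, n₀ ≤ i → n₀ ≤ j →
      ∫ x in Metric.closedBall 0 R, (u i x - u j x) ^ 2 < ε := by
  have hfin : ∀ (k : ℕ) (m : Fin N → ℤ), volume (dyadicCube k m) < ⊤ := fun k m => by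
    rw [volume_dyadicCube]; exact ENNReal.ofReal_lt_top
  have hk : Tendsto (fun k : ℕ => √N ^ ((N : ℝ) + 2 * s) * (((2 : ℝ) ^ k)⁻¹) ^ (2 * s) *
      (2 * B) ^ 2) atTop (𝓝 0) := by
    have h1 : Tendsto (fun k : ℕ => ((2 : ℝ) ^ k)⁻¹) atTop (𝓝 0) :=
      (tendsto_pow_atTop_atTop_of_one_lt (by norm_num)).inv_tendsto_atTop
    have h2 := h1.rpow_const (p := 2 * s) (Or.inr (by positivity))
    rw [Real.zero_rpow (by positivity)] at h2
    simpa using (h2.const_mul (√N ^ ((N : ℝ) + 2 * s))).mul_const ((2 * B) ^ 2)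
  -- Cubes this fine make the seminorm term small for all pairs at once; only finitely many averages
  -- then remain to be controlled.
  obtain ⟨k, hk⟩ := (hk.eventually (gt_mem_nhds (half_pos hε))).exists
  obtain ⟨F, hF⟩ := exists_finset_integral_sq_le (N := N) hs₀ k R
  have ht : Tendsto (fun p : ℕ × ℕ => (2 ^ k : ℝ) ^ N * ∑ m ∈ F,
      ((∫ x in dyadicCube k m, u p.1 x) - ∫ x in dyadicCube k m, u p.2 x) ^ 2) atTop (𝓝 0) := by
    rw [← prod_atTop_atTop_eq]
    have : Tendsto (fun p : ℕ × ℕ => (2 ^ k : ℝ) ^ N * ∑ m ∈ F,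
      ((∫ x in dyadicCube k m, u p.1 x) - ∫ x in dyadicCube k m, u p.2 x) ^ 2) (atTop ×ˢ atTop)
        (𝓝 ((2 ^ k : ℝ) ^ N * ∑ m ∈ F, (L (k, m) - L (k, m)) ^ 2)) :=
      (tendsto_finsetSum F fun m _ => (((hL k m).comp tendsto_fst).sub
        ((hL k m).comp tendsto_snd)).pow 2).const_mul _
    simpa using this
  obtain ⟨n₀, hn₀⟩ := eventually_atTop_prod_self.1 (ht.eventually (gt_mem_nhds (half_pos hε)))
  refine ⟨n₀, fun i j hi hj => ?_⟩
  have hw := (hu i).sub (by omega) hs₀ hs₁ (hu j)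
  have h1 := hF (u i - u j) (fun S hS => hw.memLp_two_restrict hN hS) hw.integrable_gagliardo
  have h2 : gagliardoForm s (u i - u j) (u i - u j) ≤ (2 * B) ^ 2 := by
    obtain ⟨h, hh⟩ := hw.exists_jet hs₀
    refine (gagliardoForm_le_mixedNorm_sq hs₀ hh).trans (pow_le_pow_left₀ (mixedNorm_nonneg _ _) ?_ 2)
    obtain ⟨a, ha⟩ := (hu i).exists_jet hs₀
    obtain ⟨b, hb⟩ := (hu j).exists_jet hs₀
    have h3 := hB i
    have h4 := hB j
    rw [ha.mixedNorm_eq hs₀] at h3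
    rw [hb.mixedNorm_eq hs₀] at h4
    rw [(ha.sub hb).mixedNorm_eq hs₀]
    exact (norm_sub_le a b).trans (by linarith)
  have h3 : ∀ m, ∫ x in dyadicCube k m, (u i - u j) x =
      (∫ x in dyadicCube k m, u i x) - ∫ x in dyadicCube k m, u j x := fun m => by
    have := hfin k m
    have : IsFiniteMeasure (volume.restrict (dyadicCube k m)) :=
      ⟨by rwa [Measure.restrict_apply_univ]⟩
    exact integral_sub (((hu i).memLp_two_restrict hN (hfin k m)).integrable (by norm_num))
      (((hu j).memLp_two_restrict hN (hfin k m)).integrable (by norm_num))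
  simp only [h3] at h1
  have h4 := hn₀ i j hi hj
  have h5 : √N ^ ((N : ℝ) + 2 * s) * (((2 : ℝ) ^ k)⁻¹) ^ (2 * s) *
      gagliardoForm s (u i - u j) (u i - u j) ≤ √N ^ ((N : ℝ) + 2 * s) *
        (((2 : ℝ) ^ k)⁻¹) ^ (2 * s) * (2 * B) ^ 2 := by gcongr
  simp only [Pi.sub_apply] at h1
  linarith

/-- Local compactness of bounded sequences in `E`. -/
theorem exists_subseq_tendsto (hN : 3 ≤ N) {s : ℝ} (hs₀ : 0 < s) (hs₁ : s < 1)
    {u : ℕ → Space N → ℝ} {B : ℝ} (hu : ∀ n, MemE s (u n)) (hB : ∀ n, mixedNorm s (u n) ≤ B) :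
    ∃ ns : ℕ → ℕ, StrictMono ns ∧ ∃ v, MemE s v ∧ mixedNorm s v ≤ B ∧
      (∀ᵐ x, Tendsto (fun j => u (ns j) x) atTop (𝓝 (v x))) ∧
      ∀ R : ℝ, Tendsto (fun j => ∫ x in Metric.closedBall 0 R, (u (ns j) x - v x) ^ 2)
        atTop (𝓝 0) := by
  obtain ⟨ns, hns, L, hL⟩ := exists_subseq_tendsto_setIntegral_dyadicCube hN hs₀ hs₁ hu hB
  have hcau := fun (R : ℝ) {ε : ℝ} (hε : 0 < ε) => cauchy_integral_sq_of_tendsto_dyadicCube hN hs₀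
    hs₁ (fun n => hu (ns n)) (fun n => hB (ns n)) hL R hε
  have hball : ∀ R : ℝ, volume (Metric.closedBall (0 : Space N) R) < ⊤ := fun R =>
    measure_closedBall_lt_top
  have hdiff : ∀ i j (R : ℝ), MemLp (u i - u j) 2
      (volume.restrict (Metric.closedBall (0 : Space N) R)) := fun i j R =>
    ((hu i).memLp_two_restrict hN (hball R)).sub ((hu j).memLp_two_restrict hN (hball R))
  -- Errors `(1/2)^k` on the ball of radius `k` are summable, so the extracted sequence converges
  -- almost everywhere on every ball.
  obtain ⟨ms, hms, hdiag⟩ := extraction_forall_of_eventually'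
    (P := fun k n => ∀ i j, n ≤ i → n ≤ j → eLpNorm (u (ns i) - u (ns j)) 2
      (volume.restrict (Metric.closedBall (0 : Space N) k)) < ENNReal.ofReal ((1 / 2) ^ k))
    fun k => by
      obtain ⟨n₀, hn₀⟩ := hcau k (ε := ((1 / 2 : ℝ) ^ k) ^ 2) (by positivity)
      refine ⟨n₀, fun n hn i j hi hj => ?_⟩
      rw [eLpNorm_two_eq_ofReal_sqrt (hdiff _ _ _), ENNReal.ofReal_lt_ofReal_iff (by positivity),
        Real.sqrt_lt' (by positivity)]
      exact hn₀ i j (hn.trans hi) (hn.trans hj)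
  set w : ℕ → Space N → ℝ := fun j => u (ns (ms j)) with hw
  have hmeas : ∀ j (R : ℝ), AEStronglyMeasurable (w j)
      (volume.restrict (Metric.closedBall (0 : Space N) R)) := fun j R => (hu _).memLp.1.restrict
  have hsum : ∑' i : ℕ, ENNReal.ofReal ((1 / 2 : ℝ) ^ i) ≠ ⊤ := by
    rw [← ENNReal.ofReal_tsum_of_nonneg (fun i => by positivity) summable_geometric_two]
    exact ENNReal.ofReal_ne_top
  -- Shifting the index by `R` makes the estimate on the ball of radius `n + R` available, which
  -- contains the fixed ball.
  have hwc : ∀ R n i j : ℕ, n ≤ i → n ≤ j → eLpNorm (w (i + R) - w (j + R)) 2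
      (volume.restrict (Metric.closedBall (0 : Space N) R)) < ENNReal.ofReal ((1 / 2) ^ n) := by
    intro R n i j hi hj
    refine lt_of_le_of_lt (eLpNorm_mono_measure _ (Measure.restrict_mono
      (Metric.closedBall_subset_closedBall (by exact_mod_cast Nat.le_add_left R n)) le_rfl))
      ((hdiag (n + R) _ _ (hms.monotone (by omega)) (hms.monotone (by omega))).trans_le
        (ENNReal.ofReal_le_ofReal ?_))
    exact pow_le_pow_of_le_one (by norm_num) (by norm_num) (Nat.le_add_right n R)
  have hex : ∀ R : ℕ, ∀ᵐ x ∂volume.restrict (Metric.closedBall (0 : Space N) R),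
      ∃ l, Tendsto (fun j => w j x) atTop (𝓝 l) := by
    intro R
    filter_upwards [Lp.ae_tendsto_of_cauchy_eLpNorm (fun j => hmeas (j + R) R) (by norm_num) hsum
      (hwc R)] with x ⟨l, hl⟩
    exact ⟨l, (tendsto_add_atTop_iff_nat R).1 hl⟩
  have hae : ∀ᵐ x, ∃ l, Tendsto (fun j => w j x) atTop (𝓝 l) := by
    have h1 := ae_all_iff.2 fun R : ℕ =>
      (ae_restrict_iff' (Metric.isClosed_closedBall.measurableSet)).1 (hex R)
    filter_upwards [h1] with x hx
    obtain ⟨R, hR⟩ := exists_nat_ge ‖x‖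
    exact hx R (by simpa using hR)
  set v : Space N → ℝ := fun x => limUnder atTop fun j => w j x with hv
  have hlim : ∀ᵐ x, Tendsto (fun j => w j x) atTop (𝓝 (v x)) := by
    filter_upwards [hae] with x hx using tendsto_nhds_limUnder hx
  obtain ⟨hvE, hvB⟩ := MemE.of_tendsto_of_mixedNorm_le hN hs₀ hs₁ (u := w) (c := fun _ => B)
    (fun j => hu _) (fun j => hB _) tendsto_const_nhds hlim
  refine ⟨ns ∘ ms, hns.comp hms, v, hvE, hvB, hlim, fun R => ?_⟩
  obtain ⟨R', hR'⟩ := exists_nat_ge R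
  have h1 : Tendsto (fun j => eLpNorm (w j - v) 2
      (volume.restrict (Metric.closedBall (0 : Space N) R'))) atTop (𝓝 0) := by
    refine (tendsto_add_atTop_iff_nat R').1 ?_
    exact Lp.cauchy_tendsto_of_tendsto (fun j => hmeas (j + R') R') v hsum (hwc R')
      (ae_restrict_of_ae (hlim.mono fun x hx => (tendsto_add_atTop_iff_nat R').2 hx))
  have hml : ∀ j (R : ℝ), MemLp (w j - v) 2 (volume.restrict (Metric.closedBall (0 : Space N) R)) :=
    fun j R => ((hu _).memLp_two_restrict hN (hball R)).sub (hvE.memLp_two_restrict hN (hball R))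
  have h2 : Tendsto (fun j => ∫ x in Metric.closedBall (0 : Space N) R', (w j x - v x) ^ 2)
      atTop (𝓝 0) := by
    have h3 := ((ENNReal.tendsto_toReal ENNReal.zero_ne_top).comp h1).pow 2
    simp only [ENNReal.toReal_zero, ne_eq, OfNat.ofNat_ne_zero, not_false_eq_true, zero_pow] at h3
    refine h3.congr fun j => ?_
    rw [Function.comp, eLpNorm_two_eq_ofReal_sqrt (hml j R'),
      ENNReal.toReal_ofReal (Real.sqrt_nonneg _),
      Real.sq_sqrt (integral_nonneg fun x => sq_nonneg _)]
    rfl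
  refine squeeze_zero (fun j => integral_nonneg fun x => sq_nonneg _) (fun j => ?_) h2
  exact setIntegral_mono_set (hml j R').integrable_sq (Eventually.of_forall fun x => sq_nonneg _)
    (Metric.closedBall_subset_closedBall hR').eventuallyLE

/-! ### Polarized functions are radial and nonincreasing -/

/-- The function `v` decreases along all reflections that move points away from the origin. -/
def IsPolarized (v : Space N → ℝ) : Prop :=
  ∀ (e : Space N) (α : ℝ), ‖e‖ = 1 → 0 < α → polarize e α v =ᵐ[volume] v

/-- Data of the perpendicular bisector of `x` and `y`, the hyperplane whose reflection exchanges
them; `x` lies at distance `‖y - x‖ / 2` from it. -/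
theorem hyperRefl_bisector {x y : Space N} (hxy : x ≠ y) :
    ‖(‖y - x‖⁻¹ • (y - x) : Space N)‖ = 1 ∧
    (∀ z : Space N, inner ℝ z (‖y - x‖⁻¹ • (y - x)) = ‖y - x‖⁻¹ * inner ℝ z (y - x)) ∧
    (‖y‖ ^ 2 - ‖x‖ ^ 2) / (2 * ‖y - x‖) - inner ℝ x (‖y - x‖⁻¹ • (y - x)) = ‖y - x‖ / 2 := by
  have hd : 0 < ‖y - x‖ := norm_pos_iff.2 (sub_ne_zero.2 hxy.symm)
  have h1 : ∀ z : Space N, inner ℝ z (‖y - x‖⁻¹ • (y - x)) = ‖y - x‖⁻¹ * inner ℝ z (y - x) :=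
    fun z => inner_smul_right _ _ _
  refine ⟨by rw [norm_smul, norm_inv, norm_norm, inv_mul_cancel₀ hd.ne'], h1, ?_⟩
  have h2 : ‖y - x‖ ^ 2 = ‖y‖ ^ 2 - ‖x‖ ^ 2 - 2 * inner ℝ x (y - x) := by
    rw [norm_sub_sq_real, inner_sub_right, real_inner_self_eq_norm_sq, real_inner_comm]; ring
  rw [h1]
  field_simp
  linarith

/-- Integrals of a polarized function over small balls decrease with the norm of the center. -/
theorem IsPolarized.setIntegral_closedBall_le {v : Space N → ℝ} (hv : IsPolarized v)
    (hl : LocallyIntegrable v) {x y : Space N} (hxy : ‖x‖ < ‖y‖) {r : ℝ} (hr : r < ‖y - x‖ / 2) :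
    ∫ z in Metric.closedBall y r, v z ≤ ∫ z in Metric.closedBall x r, v z := by
  have hne : x ≠ y := fun h => by rw [h] at hxy; exact lt_irrefl _ hxy
  have hd : 0 < ‖y - x‖ := norm_pos_iff.2 (sub_ne_zero.2 hne.symm)
  obtain ⟨he, -, h2⟩ := hyperRefl_bisector hne
  set e : Space N := ‖y - x‖⁻¹ • (y - x) with he_def
  set α : ℝ := (‖y‖ ^ 2 - ‖x‖ ^ 2) / (2 * ‖y - x‖) with hα
  have hα0 : 0 < α := div_pos (by nlinarith [norm_nonneg x]) (by positivity)
  have hσ : hyperRefl e α x = y := by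
    rw [hyperRefl_eq he, h2, he_def, smul_smul]
    have : 2 * (‖y - x‖ / 2) * ‖y - x‖⁻¹ = 1 := by field_simp
    rw [this, one_smul]; abel
  have hpre : hyperRefl e α ⁻¹' Metric.closedBall y r = Metric.closedBall x r := by
    ext z
    rw [Set.mem_preimage, Metric.mem_closedBall, Metric.mem_closedBall, ← hσ,
      isometry_hyperRefl.dist_eq]
  -- The radius is below the distance from `x` to the bisector, so the ball stays in the half-space,
  -- where a polarized function dominates its reflection.
  have hH : ∀ z ∈ Metric.closedBall x r, inner ℝ z e ≤ α := by
    intro z hz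
    have h3 : inner ℝ (z - x) e ≤ ‖z - x‖ * ‖e‖ := real_inner_le_norm _ _
    rw [he, mul_one, inner_sub_left] at h3
    rw [Metric.mem_closedBall, dist_eq_norm] at hz
    linarith
  rw [← measurePreserving_hyperRefl.setIntegral_preimage_emb measurableEmbedding_hyperRefl v
    (Metric.closedBall y r), hpre]
  have hi : IntegrableOn (fun z => v (hyperRefl e α z)) (Metric.closedBall x r) := by
    rw [← hpre]
    exact (measurePreserving_hyperRefl.integrableOn_comp_preimage
      measurableEmbedding_hyperRefl).2 (hl.integrableOn_isCompact (isCompact_closedBall y r))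
  refine setIntegral_mono_on_ae hi (hl.integrableOn_isCompact (isCompact_closedBall x r))
    measurableSet_closedBall ?_
  filter_upwards [hv e α he hα0] with z hz hzx
  rw [← hz, polarize, if_pos (hH z hzx)]
  exact le_max_right _ _

/-- Dominated convergence: the indicators of the balls converge off the sphere, a null set. -/
theorem continuousAt_setIntegral_closedBall (hN : 0 < N) {v : Space N → ℝ}
    (hl : LocallyIntegrable v) (y : Space N) (r : ℝ) :
    ContinuousAt (fun c => ∫ z in Metric.closedBall c r, v z) y := by
  have := nontrivial_space hN
  have e : (fun c => ∫ z in Metric.closedBall c r, v z) =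
      fun c => ∫ z, (Metric.closedBall c r).indicator v z := by
    ext c; rw [integral_indicator measurableSet_closedBall]
  rw [e]
  refine continuousAt_of_dominated (bound := (Metric.closedBall y (r + 1)).indicator fun z => ‖v z‖)
    (Eventually.of_forall fun c => hl.aestronglyMeasurable.indicator measurableSet_closedBall)
    ?_ ?_ ?_
  · filter_upwards [Metric.ball_mem_nhds y one_pos] with c hc
    refine Eventually.of_forall fun z => ?_
    rw [norm_indicator_eq_indicator_norm]
    refine Set.indicator_le_indicator_of_subset ?_ (fun _ => norm_nonneg _) z
    exact Metric.closedBall_subset_closedBall' (by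
      have := Metric.mem_ball.1 hc
      linarith)
  · rw [integrable_indicator_iff measurableSet_closedBall]
    exact (hl.integrableOn_isCompact (isCompact_closedBall y _)).norm
  · have h0 : ∀ᵐ z : Space N, z ∉ Metric.sphere y r :=
      measure_eq_zero_iff_ae_notMem.1 (Measure.addHaar_sphere volume y r)
    filter_upwards [h0] with z hz
    rw [Metric.mem_sphere] at hz
    have hc : ContinuousAt (fun c : Space N => dist z c) y := by fun_prop
    rcases lt_or_gt_of_ne hz with h | h
    · refine (continuousAt_const (y := v z)).congr ?_
      filter_upwards [hc.eventually (gt_mem_nhds h)] with c hc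
      rw [Set.indicator_of_mem (Metric.mem_closedBall.2 hc.le)]
    · refine (continuousAt_const (y := (0 : ℝ))).congr ?_
      filter_upwards [hc.eventually (lt_mem_nhds h)] with c hc
      rw [Set.indicator_of_notMem (fun hm => hc.not_ge (Metric.mem_closedBall.1 hm))]

/-- For equal norms the bisector passes through the origin and the strict case does not apply;
pushing `y` outwards and letting it return gives the inequality by continuity. -/
theorem IsPolarized.setIntegral_closedBall_le_of_norm_eq (hN : 0 < N) {v : Space N → ℝ}
    (hv : IsPolarized v) (hl : LocallyIntegrable v) {x y : Space N} (hxy : ‖x‖ = ‖y‖) {r : ℝ}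
    (hr : r < ‖y - x‖ / 2) :
    ∫ z in Metric.closedBall y r, v z ≤ ∫ z in Metric.closedBall x r, v z := by
  rcases eq_or_ne x y with rfl | hne
  · exact le_rfl
  have hy : y ≠ 0 := by
    rintro rfl
    rw [norm_zero, norm_eq_zero] at hxy
    exact hne hxy
  have hy0 : 0 < ‖y‖ := norm_pos_iff.2 hy
  have hcont : ContinuousAt (fun t : ℝ => (1 + t) • y) 0 := by fun_prop
  have hlim : Tendsto (fun t : ℝ => ∫ z in Metric.closedBall ((1 + t) • y) r, v z) (𝓝[>] 0)
      (𝓝 (∫ z in Metric.closedBall y r, v z)) := by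
    have h1 : ContinuousAt (fun c => ∫ z in Metric.closedBall c r, v z) ((1 + (0 : ℝ)) • y) :=
      continuousAt_setIntegral_closedBall hN hl _ r
    have h2 := (ContinuousAt.comp (f := fun t : ℝ => (1 + t) • y) h1 hcont).tendsto
    simp only [Function.comp_def, add_zero, one_smul] at h2
    exact h2.mono_left nhdsWithin_le_nhds
  have hd : ContinuousAt (fun t : ℝ => ‖(1 + t) • y - x‖ / 2) 0 := by fun_prop
  have hr' : r < ‖(1 + (0 : ℝ)) • y - x‖ / 2 := by simpa using hr
  refine le_of_tendsto hlim ?_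
  filter_upwards [nhdsWithin_le_nhds (hd.eventually (lt_mem_nhds hr')), self_mem_nhdsWithin]
    with t ht ht0
  refine hv.setIntegral_closedBall_le hl ?_ ht
  have ht0 : 0 < t := ht0
  rw [norm_smul, Real.norm_of_nonneg (by linarith), hxy]
  nlinarith

/-- A polarized function has a representative that is radial; it is nonincreasing almost
everywhere. -/
theorem IsPolarized.exists_radial (hN : 0 < N) {v : Space N → ℝ} (hv : IsPolarized v)
    (hl : LocallyIntegrable v) :
    ∃ Φ : Space N → ℝ, Φ =ᵐ[volume] v ∧ IsRadial Φ ∧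
      ∀ᵐ y, ∀ᵐ x : Space N, ‖x‖ < ‖y‖ → Φ y ≤ Φ x := by
  have := nontrivial_space hN
  set A : ℕ → Space N → ℝ := fun n x => ⨍ z in Metric.closedBall x (1 / ((n : ℝ) + 1)), v z with hA
  have hr : Tendsto (fun n : ℕ => 1 / ((n : ℝ) + 1)) atTop (𝓝 0) :=
    tendsto_one_div_add_atTop_nhds_zero_nat
  have hAle : ∀ x y (n : ℕ), ∫ z in Metric.closedBall y (1 / ((n : ℝ) + 1)), v z ≤
      ∫ z in Metric.closedBall x (1 / ((n : ℝ) + 1)), v z → A n y ≤ A n x := by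
    intro x y n h
    simp only [hA, setAverage_eq, Measure.real, smul_eq_mul]
    rw [Measure.addHaar_closedBall_center volume y, Measure.addHaar_closedBall_center volume x]
    exact mul_le_mul_of_nonneg_left h (by positivity)
  have hsmall : ∀ x y : Space N, x ≠ y → ∀ᶠ n : ℕ in atTop, 1 / ((n : ℝ) + 1) < ‖y - x‖ / 2 :=
    fun x y h => hr.eventually (gt_mem_nhds (half_pos (norm_pos_iff.2 (sub_ne_zero.2 h.symm))))
  have hleb : ∀ᵐ x, Tendsto (fun n => A n x) atTop (𝓝 (v x)) := by
    filter_upwards [IsUnifLocDoublingMeasure.ae_tendsto_average volume hl 1] with x hx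
    refine hx (fun _ => x) (fun n : ℕ => 1 / ((n : ℝ) + 1)) ?_ ?_
    · exact tendsto_nhdsWithin_iff.2 ⟨hr, Eventually.of_forall fun n => by
        change (0 : ℝ) < 1 / ((n : ℝ) + 1); positivity⟩
    · exact Eventually.of_forall fun n => Metric.mem_closedBall_self (by positivity)
  -- The upper limit of the averages is defined everywhere, so radiality holds at every point; by
  -- Lebesgue differentiation it equals `v` almost everywhere.
  refine ⟨fun x => limsup (fun n => A n x) atTop, ?_, ?_, ?_⟩
  · filter_upwards [hleb] with x hx using hx.limsup_eq
  · intro x y hxy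
    rcases eq_or_ne x y with rfl | hne
    · rfl
    refine limsup_congr ?_
    filter_upwards [hsmall x y hne] with n hn
    refine le_antisymm (hAle _ _ _ ?_) (hAle _ _ _ ?_)
    · exact hv.setIntegral_closedBall_le_of_norm_eq hN hl hxy.symm (by rwa [norm_sub_rev])
    · exact hv.setIntegral_closedBall_le_of_norm_eq hN hl hxy hn
  · filter_upwards [hleb] with y hy
    filter_upwards [hleb] with x hx hlt
    rw [hy.limsup_eq, hx.limsup_eq]
    refine le_of_tendsto_of_tendsto hy hx ?_
    filter_upwards [hsmall x y (fun h => by rw [h] at hlt; exact lt_irrefl _ hlt)] with n hn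
    exact hAle _ _ _ (hv.setIntegral_closedBall_le hl hlt hn)

/-! ### From local `L²` convergence to `L^p` convergence -/

theorem exists_rpow_le_mul_rpow_add {p q : ℝ} (h2 : 2 < p) (hpq : p < q) {ε : ℝ} (hε : 0 < ε) :
    ∃ C : ℝ, 0 ≤ C ∧ ∀ t : ℝ, 0 ≤ t → t ^ p ≤ ε * t ^ q + C * t ^ 2 := by
  -- The threshold with `M^(p-q) = ε`: beyond it the `q`-th power absorbs `t^p`, below it the square
  -- does.
  set M : ℝ := ε ^ (1 / (p - q)) with hM
  have hM0 : 0 < M := by positivity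
  have hMε : M ^ (p - q) = ε := by
    rw [hM, ← Real.rpow_mul hε.le, one_div_mul_cancel (by linarith), Real.rpow_one]
  refine ⟨M ^ (p - 2), by positivity, fun t ht => ?_⟩
  rcases ht.eq_or_lt with rfl | h0
  · rw [Real.zero_rpow (by linarith), Real.zero_rpow (by linarith)]; simp
  have h1 : 0 ≤ ε * t ^ q := by positivity
  have h3 : 0 ≤ M ^ (p - 2) * t ^ 2 := by positivity
  rcases le_total M t with h | h
  · have : t ^ p ≤ ε * t ^ q := by
      have e : t ^ p = t ^ (p - q) * t ^ q := by rw [← Real.rpow_add h0]; congr 1; ring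
      rw [e, ← hMε]
      exact mul_le_mul_of_nonneg_right
        (Real.rpow_le_rpow_of_nonpos hM0 h (by linarith)) (by positivity)
    linarith
  · have : t ^ p ≤ M ^ (p - 2) * t ^ 2 := by
      have e : t ^ p = t ^ (p - 2) * t ^ 2 := by
        rw [← Real.rpow_two, ← Real.rpow_add h0]; congr 1; ring
      rw [e]
      exact mul_le_mul_of_nonneg_right (Real.rpow_le_rpow ht h (by linarith)) (by positivity)
    linarith

section Subcritical

variable {s p : ℝ} (hN : 3 ≤ N) (hs₀ : 0 < s) (hs₁ : s < 1)
  (hp₁ : fracCritExp N s < p) (hp₂ : p < critExp N)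
include hN hs₀ hs₁ hp₁ hp₂

/-- Local `L²` convergence of bounded sequences in `E` improves to local `L^p` convergence. -/
theorem tendsto_setIntegral_rpow {w : ℕ → Space N → ℝ} {B R : ℝ} (hw : ∀ n, MemE s (w n))
    (hB : ∀ n, mixedNorm s (w n) ≤ B)
    (h : Tendsto (fun n => ∫ x in Metric.closedBall 0 R, w n x ^ 2) atTop (𝓝 0)) :
    Tendsto (fun n => ∫ x in Metric.closedBall 0 R, |w n x| ^ p) atTop (𝓝 0) := by
  have h2 := two_lt_fracCritExp hN hs₀ hs₁
  obtain ⟨A, hA⟩ := exists_integral_rpow_critical_le hN hs₀ hs₁ B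
  have hA0 : 0 ≤ A := le_trans (integral_nonneg fun x => Real.rpow_nonneg (abs_nonneg _) _)
    (hA _ (hw 0) (hB 0)).1
  have hnn : ∀ n, 0 ≤ ∫ x in Metric.closedBall 0 R, |w n x| ^ p := fun n =>
    integral_nonneg fun x => Real.rpow_nonneg (abs_nonneg _) _
  rw [Metric.tendsto_atTop]
  intro ε hε
  obtain ⟨C, hC0, hC⟩ := exists_rpow_le_mul_rpow_add (p := p) (q := critExp N) (by linarith) hp₂
    (ε := ε / (2 * (A + 1))) (by positivity)
  have ht : Tendsto (fun n => C * ∫ x in Metric.closedBall 0 R, w n x ^ 2) atTop (𝓝 0) := by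
    simpa using h.const_mul C
  obtain ⟨n₀, hn₀⟩ := eventually_atTop.1 (ht.eventually (gt_mem_nhds (half_pos hε)))
  refine ⟨n₀, fun n hn => ?_⟩
  rw [Real.dist_eq, sub_zero, abs_of_nonneg (hnn n)]
  have i1 := ((hw n).integrable_critExp hN).integrableOn (s := Metric.closedBall 0 R)
  have i2 : IntegrableOn (fun x => w n x ^ 2) (Metric.closedBall 0 R) :=
    ((hw n).memLp_two_restrict hN measure_closedBall_lt_top).integrable_sq
  have h3 : ∫ x in Metric.closedBall 0 R, |w n x| ^ critExp N ≤ A :=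
    (setIntegral_le_integral ((hw n).integrable_critExp hN)
      (Eventually.of_forall fun x => Real.rpow_nonneg (abs_nonneg _) _)).trans
      (hA _ (hw n) (hB n)).1
  calc ∫ x in Metric.closedBall 0 R, |w n x| ^ p
      ≤ ∫ x in Metric.closedBall 0 R, (ε / (2 * (A + 1)) * |w n x| ^ critExp N + C * w n x ^ 2) := by
        refine integral_mono ((hw n).integrable_rpow hN hs₀ hs₁ hp₁ hp₂).restrict
          ((i1.const_mul _).add (i2.const_mul _)) fun x => ?_
        have := hC |w n x| (abs_nonneg _)
        rwa [sq_abs] at this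
    _ = ε / (2 * (A + 1)) * (∫ x in Metric.closedBall 0 R, |w n x| ^ critExp N) +
        C * ∫ x in Metric.closedBall 0 R, w n x ^ 2 := by
        rw [integral_add (i1.const_mul _) (i2.const_mul _), integral_const_mul, integral_const_mul]
    _ ≤ ε / (2 * (A + 1)) * (A + 1) + C * ∫ x in Metric.closedBall 0 R, w n x ^ 2 := by
        gcongr; linarith
    _ < ε := by
        have e : ε / (2 * (A + 1)) * (A + 1) = ε / 2 := by field_simp
        have := hn₀ n hn
        rw [e]; linarith

theorem MemE.memLp_subcritical {u : Space N → ℝ} (hu : MemE s u) :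
    MemLp u (ENNReal.ofReal p) := by
  have h2 := two_lt_fracCritExp hN hs₀ hs₁
  rw [← integrable_norm_rpow_iff hu.memLp.1 (by simp; linarith) ENNReal.ofReal_ne_top,
    ENNReal.toReal_ofReal (by linarith)]
  exact hu.integrable_rpow hN hs₀ hs₁ hp₁ hp₂

/-- Convergence in `L^p`, in terms of integrals. -/
theorem tendsto_eLpNorm_of_tendsto_integral {u : ℕ → Space N → ℝ} {v : Space N → ℝ}
    (hu : ∀ n, MemE s (u n)) (hv : MemE s v)
    (h : Tendsto (fun n => ∫ x, |u n x - v x| ^ p) atTop (𝓝 0)) :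
    Tendsto (fun n => eLpNorm (u n - v) (ENNReal.ofReal p)) atTop (𝓝 0) := by
  have h2 := two_lt_fracCritExp hN hs₀ hs₁
  have hp0 : 0 < p := by linarith
  have h3 := ENNReal.tendsto_ofReal (h.rpow_const (p := p⁻¹) (Or.inr (by positivity)))
  rw [Real.zero_rpow (by positivity), ENNReal.ofReal_zero] at h3
  refine h3.congr fun n => ?_
  have hm := ((hu n).sub (by omega) hs₀ hs₁ hv).memLp_subcritical hN hs₀ hs₁ hp₁ hp₂
  rw [hm.eLpNorm_eq_integral_rpow_norm (by simpa using hp0) ENNReal.ofReal_ne_top,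
    ENNReal.toReal_ofReal hp0.le]
  rfl

theorem tendsto_integral_rpow_of_tendsto {u : ℕ → Space N → ℝ} {v : Space N → ℝ}
    (hu : ∀ n, MemE s (u n)) (hv : MemE s v)
    (h : Tendsto (fun n => ∫ x, |u n x - v x| ^ p) atTop (𝓝 0)) :
    Tendsto (fun n => ∫ x, |u n x| ^ p) atTop (𝓝 (∫ x, |v x| ^ p)) := by
  have h2 := two_lt_fracCritExp hN hs₀ hs₁
  have hp0 : 0 < p := by linarith
  have : Fact (1 ≤ ENNReal.ofReal p) := ⟨by
    rw [← ENNReal.ofReal_one]; exact ENNReal.ofReal_le_ofReal (by linarith)⟩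
  have hm : ∀ {w : Space N → ℝ}, MemE s w → MemLp w (ENNReal.ofReal p) := fun hw =>
    hw.memLp_subcritical hN hs₀ hs₁ hp₁ hp₂
  have h3 : Tendsto (fun n => (hm (hu n)).toLp (u n)) atTop (𝓝 ((hm hv).toLp v)) :=
    (Lp.tendsto_Lp_iff_tendsto_eLpNorm'' _ _ _ _).2
      (tendsto_eLpNorm_of_tendsto_integral hN hs₀ hs₁ hp₁ hp₂ hu hv h)
  have key : ∀ {w : Space N → ℝ} (hw : MemE s w), ‖(hm hw).toLp w‖ ^ p = ∫ x, |w x| ^ p := by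
    intro w hw
    have h0 : 0 ≤ ∫ x, |w x| ^ p := integral_nonneg fun x => Real.rpow_nonneg (abs_nonneg _) _
    rw [Lp.norm_toLp, (hm hw).eLpNorm_eq_integral_rpow_norm (by simpa using hp0)
      ENNReal.ofReal_ne_top, ENNReal.toReal_ofReal hp0.le, ENNReal.toReal_ofReal
      (Real.rpow_nonneg (integral_nonneg fun x => Real.rpow_nonneg (norm_nonneg _) _) _)]
    simp only [Real.norm_eq_abs]
    rw [← Real.rpow_mul h0, inv_mul_cancel₀ hp0.ne', Real.rpow_one]
  have h4 := h3.norm.rpow_const (p := p) (Or.inr hp0.le)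
  rw [key hv] at h4
  exact h4.congr fun n => key (hu n)

end Subcritical

theorem MemE.abs_mixedNorm_sub_le {s : ℝ} (hs₀ : 0 < s) {u v : Space N → ℝ} (hu : MemE s u)
    (hv : MemE s v) : |mixedNorm s u - mixedNorm s v| ≤ mixedNorm s (u - v) := by
  obtain ⟨h, hh⟩ := hu.exists_jet hs₀
  obtain ⟨k, hk⟩ := hv.exists_jet hs₀
  rw [hh.mixedNorm_eq hs₀, hk.mixedNorm_eq hs₀, (hh.sub hk).mixedNorm_eq hs₀]
  exact abs_norm_sub_norm_le h k

theorem MemE.mixedNorm_sub_le {s : ℝ} (hs₀ : 0 < s) {u v : Space N → ℝ} (hu : MemE s u)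
    (hv : MemE s v) : mixedNorm s (u - v) ≤ mixedNorm s u + mixedNorm s v := by
  obtain ⟨h, hh⟩ := hu.exists_jet hs₀
  obtain ⟨k, hk⟩ := hv.exists_jet hs₀
  rw [hh.mixedNorm_eq hs₀, hk.mixedNorm_eq hs₀, (hh.sub hk).mixedNorm_eq hs₀]
  exact norm_sub_le h k

theorem MemE.locallyIntegrable (hN : 3 ≤ N) {s : ℝ} {u : Space N → ℝ} (hu : MemE s u) :
    LocallyIntegrable u :=
  hu.memLp.locallyIntegrable (one_le_ofReal_critExp hN)

/-! ### Symmetrization by minimizing the second moment -/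

/-- A continuous compactly supported function that agrees with `‖x‖²` on the ball of radius `R`. -/
noncomputable def momentWeight (R : ℝ) (x : Space N) : ℝ :=
  ‖x‖ ^ 2 * max 0 (min 1 (R + 1 - ‖x‖))

theorem continuous_momentWeight (R : ℝ) : Continuous (momentWeight (N := N) R) := by
  unfold momentWeight; fun_prop

theorem hasCompactSupport_momentWeight (R : ℝ) : HasCompactSupport (momentWeight (N := N) R) := by
  refine HasCompactSupport.intro (isCompact_closedBall 0 (R + 1)) fun x hx => ?_
  rw [Metric.mem_closedBall, dist_zero_right, not_le] at hx
  rw [momentWeight, max_eq_left, mul_zero]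
  exact (min_le_right _ _).trans (by linarith)

/-- The nonnegative functions of `E`, supported in the ball of radius `R`, with the same `L^p` norm
as `f` and no larger norm in `E`. -/
structure IsRearrangement (s p R : ℝ) (f v : Space N → ℝ) : Prop where
  memE : MemE s v
  norm_le : mixedNorm s v ≤ mixedNorm s f
  integral_eq : ∫ x, |v x| ^ p = ∫ x, |f x| ^ p
  nonneg : ∀ᵐ x, 0 ≤ v x
  eq_zero : ∀ᵐ x : Space N, R < ‖x‖ → v x = 0

namespace IsRearrangement

variable {s p R : ℝ} {f v : Space N → ℝ}

/-- The support condition lets a compactly supported weight replace `‖x‖²`, so that the moment is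
continuous under `L^p` convergence. -/
theorem moment_ae_eq (hv : IsRearrangement s p R f v) :
    (fun x => v x * ‖x‖ ^ 2) =ᵐ[volume] fun x => v x * momentWeight R x := by
  filter_upwards [hv.eq_zero] with x hx
  rcases lt_or_ge R ‖x‖ with h | h
  · rw [hx h, zero_mul, zero_mul]
  · rw [momentWeight, min_eq_left (by linarith), max_eq_right zero_le_one, mul_one]

theorem integrable_moment (hN : 3 ≤ N) (hv : IsRearrangement s p R f v) :
    Integrable fun x => v x * ‖x‖ ^ 2 := by
  refine Integrable.congr ?_ hv.moment_ae_eq.symm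
  simpa only [smul_eq_mul, mul_comm] using
    (hv.memE.locallyIntegrable hN).integrable_smul_left_of_hasCompactSupport
      (continuous_momentWeight R) (hasCompactSupport_momentWeight R)

theorem moment_nonneg (hv : IsRearrangement s p R f v) : 0 ≤ ∫ x, v x * ‖x‖ ^ 2 := by
  refine integral_nonneg_of_ae ?_
  filter_upwards [hv.nonneg] with x hx using mul_nonneg hx (sq_nonneg _)

variable (hN : 3 ≤ N) (hs₀ : 0 < s) (hs₁ : s < 1)
include hN hs₀ hs₁

theorem polarize (hp₁ : fracCritExp N s < p) (hp₂ : p < critExp N)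
    (hv : IsRearrangement s p R f v) {e : Space N} {α : ℝ} (he : ‖e‖ = 1) (hα : 0 < α) :
    IsRearrangement s p R f (MixedLaplacian.polarize e α v) := by
  obtain ⟨h1, h2⟩ := hv.memE.polarize (α := α) he hN hs₀ hs₁
  have hσ := (measurePreserving_hyperRefl (e := e) (α := α)).quasiMeasurePreserving
  have hnn := hσ.ae hv.nonneg
  refine ⟨h1, h2.trans hv.norm_le, ?_, ?_, ?_⟩
  · rw [← hv.integral_eq]
    exact integral_comp_polarize he (fun t => |t| ^ p)
      (hv.memE.integrable_rpow hN hs₀ hs₁ hp₁ hp₂) (h1.integrable_rpow hN hs₀ hs₁ hp₁ hp₂)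
  · filter_upwards [hv.nonneg, hnn] with x hx hx'
    rcases polarize_pair he v x (α := α) with h | h
    · rw [h.1]; exact hx
    · rw [h.1]; exact hx'
  · filter_upwards [hv.eq_zero, hσ.ae hv.eq_zero, hnn] with x hx hx' hn hR
    rw [MixedLaplacian.polarize, hx hR]
    -- In the half-space the mirror point is farther still from the origin and carries the value 0;
    -- outside it the minimum of 0 and a nonnegative value is 0.
    split_ifs with hxe
    · rw [hx', max_self]
      refine hR.trans_le (le_of_sq_le_sq ?_ (norm_nonneg _))
      rw [norm_hyperRefl_sq he]
      nlinarith
    · exact min_eq_left hn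

/-- Each polarization of a moment minimizer is again a competitor, so it cannot lower the moment,
and the equality case makes it trivial. -/
theorem isPolarized (hp₁ : fracCritExp N s < p) (hp₂ : p < critExp N)
    (hv : IsRearrangement s p R f v)
    (hmin : ∀ w, IsRearrangement s p R f w → ∫ x, v x * ‖x‖ ^ 2 ≤ ∫ x, w x * ‖x‖ ^ 2) :
    IsPolarized v := by
  intro e α he hα
  have hw := hv.polarize hN hs₀ hs₁ hp₁ hp₂ he hα
  exact polarize_ae_eq_of_moment_le he hα (hv.integrable_moment hN) (hw.integrable_moment hN)
    (hmin _ hw)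

/-- Rearrangements are sequentially compact. -/
theorem exists_subseq_tendsto (hp₁ : fracCritExp N s < p) (hp₂ : p < critExp N)
    {u : ℕ → Space N → ℝ} (hu : ∀ n, IsRearrangement s p R f (u n)) :
    ∃ ns : ℕ → ℕ, StrictMono ns ∧ ∃ v, IsRearrangement s p R f v ∧
      Tendsto (fun j => ∫ x, u (ns j) x * ‖x‖ ^ 2) atTop (𝓝 (∫ x, v x * ‖x‖ ^ 2)) := by
  have h2 := two_lt_fracCritExp hN hs₀ hs₁
  obtain ⟨ns, hns, v, hv, hvB, hae, hL2⟩ := MixedLaplacian.exists_subseq_tendsto hN hs₀ hs₁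
    (fun n => (hu n).memE) (fun n => (hu n).norm_le)
  have hall := ae_all_iff.2 fun j => (hu (ns j)).eq_zero
  have h0 : ∀ᵐ x : Space N, R < ‖x‖ → v x = 0 := by
    filter_upwards [hae, hall] with x hx hz hR
    refine tendsto_nhds_unique hx ?_
    simp only [hz _ hR, tendsto_const_nhds_iff]
  -- All functions vanish outside one ball, so local convergence is global and the constraint on the
  -- `L^p` norm survives the limit.
  have hLp : Tendsto (fun j => ∫ x, |u (ns j) x - v x| ^ p) atTop (𝓝 0) := by
    refine (tendsto_setIntegral_rpow hN hs₀ hs₁ hp₁ hp₂ (w := fun j => u (ns j) - v)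
      (B := mixedNorm s f + mixedNorm s f) (R := R)
      (fun j => (hu (ns j)).memE.sub (by omega) hs₀ hs₁ hv)
      (fun j => ((hu (ns j)).memE.mixedNorm_sub_le hs₀ hv).trans
        (add_le_add (hu (ns j)).norm_le hvB)) (hL2 R)).congr fun j => ?_
    refine setIntegral_eq_integral_of_ae_compl_eq_zero ?_
    filter_upwards [(hu (ns j)).eq_zero, h0] with x hx hx' hR
    rw [Metric.mem_closedBall, dist_zero_right, not_le] at hR
    rw [Pi.sub_apply, hx hR, hx' hR, sub_zero, abs_zero, Real.zero_rpow (by linarith)]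
  have hvK : IsRearrangement s p R f v := by
    refine ⟨hv, hvB, ?_, ?_, h0⟩
    · refine tendsto_nhds_unique (tendsto_integral_rpow_of_tendsto hN hs₀ hs₁ hp₁ hp₂
        (fun j => (hu (ns j)).memE) hv hLp) ?_
      simp only [(hu _).integral_eq, tendsto_const_nhds_iff]
    · filter_upwards [hae, ae_all_iff.2 fun j => (hu (ns j)).nonneg] with x hx hz
      exact ge_of_tendsto' hx hz
  refine ⟨ns, hns, v, hvK, ?_⟩
  have h3 := tendsto_integral_mul_of_tendsto_eLpNorm (q := ENNReal.ofReal p)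
    (by rw [← ENNReal.ofReal_one]; exact ENNReal.ofReal_le_ofReal (by linarith))
    (fun j => (hu (ns j)).memE.memLp_subcritical hN hs₀ hs₁ hp₁ hp₂)
    (hv.memLp_subcritical hN hs₀ hs₁ hp₁ hp₂) (continuous_momentWeight R)
    (hasCompactSupport_momentWeight R)
    (tendsto_eLpNorm_of_tendsto_integral hN hs₀ hs₁ hp₁ hp₂ (fun j => (hu (ns j)).memE) hv hLp)
  rw [← integral_congr_ae hvK.moment_ae_eq] at h3
  exact h3.congr fun j => (integral_congr_ae (hu (ns j)).moment_ae_eq).symm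

/-- Some rearrangement is polarized. -/
theorem exists_isPolarized (hp₁ : fracCritExp N s < p) (hp₂ : p < critExp N)
    (hf : IsRearrangement s p R f f) : ∃ v, IsRearrangement s p R f v ∧ IsPolarized v := by
  set M : Set ℝ := (fun v : Space N → ℝ => ∫ x, v x * ‖x‖ ^ 2) '' {v | IsRearrangement s p R f v}
    with hM
  have hbdd : BddBelow M := ⟨0, by rintro _ ⟨v, hv, rfl⟩; exact hv.moment_nonneg⟩
  obtain ⟨m, -, hm, hmM⟩ := exists_seq_tendsto_sInf (S := M) ⟨_, f, hf, rfl⟩ hbdd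
  choose u hu hum using hmM
  obtain ⟨ns, hns, v, hv, hlim⟩ := exists_subseq_tendsto hN hs₀ hs₁ hp₁ hp₂ hu
  refine ⟨v, hv, hv.isPolarized hN hs₀ hs₁ hp₁ hp₂ fun w hw => ?_⟩
  have h1 : ∫ x, v x * ‖x‖ ^ 2 = sInf M := by
    refine tendsto_nhds_unique hlim ?_
    exact (hm.comp hns.tendsto_atTop).congr fun j => (hum (ns j)).symm
  rw [h1]
  exact csInf_le hbdd ⟨w, hw, rfl⟩

end IsRearrangement

/-- Symmetrization of test functions. -/
theorem IsTest.exists_symmetrization (hN : 3 ≤ N) {s p : ℝ} (hs₀ : 0 < s) (hs₁ : s < 1)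
    (hp₁ : fracCritExp N s < p) (hp₂ : p < critExp N) {φ : Space N → ℝ} (hφ : IsTest φ) :
    ∃ Φ : Space N → ℝ, MemE s Φ ∧ mixedNorm s Φ ≤ mixedNorm s φ ∧
      ∫ x, |Φ x| ^ p = ∫ x, |φ x| ^ p ∧ IsRadial Φ ∧ (∀ᵐ x, 0 ≤ Φ x) ∧
      ∀ᵐ y, ∀ᵐ x : Space N, ‖x‖ < ‖y‖ → Φ y ≤ Φ x := by
  obtain ⟨K, hK⟩ := hφ.exists_lipschitzWith
  obtain ⟨R, hR⟩ := hφ.2.isCompact.isBounded.subset_closedBall (0 : Space N)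
  obtain ⟨v, hv, hvp⟩ := IsRearrangement.exists_isPolarized (R := R) (f := fun x => |φ x|)
    hN hs₀ hs₁ hp₁ hp₂
    { memE := memE_of_lipschitz hN hs₀ hs₁ (LipschitzWith.abs_comp hK)
        (HasCompactSupport.abs_comp hφ.2)
      norm_le := le_rfl
      integral_eq := rfl
      nonneg := Eventually.of_forall fun x => abs_nonneg _
      eq_zero := Eventually.of_forall fun x hx => by
        rw [image_eq_zero_of_notMem_tsupport (f := φ), abs_zero]
        intro hm
        have := hR hm
        rw [Metric.mem_closedBall, dist_zero_right] at this
        exact hx.not_ge this }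
  obtain ⟨Φ, hΦ, hrad, hmono⟩ := hvp.exists_radial (by omega) (hv.memE.locallyIntegrable hN)
  obtain ⟨hE, hn⟩ := hv.memE.congr hs₀ hΦ.symm
  refine ⟨Φ, hE, ?_, ?_, hrad, ?_, hmono⟩
  · rw [hn]
    exact hv.norm_le.trans (mixedNorm_abs_le (by omega) hs₀ hs₁ hK hφ.2)
  · have h1 : ∫ x, |Φ x| ^ p = ∫ x, |v x| ^ p :=
      integral_congr_ae (hΦ.mono fun x hx => by simp only [hx])
    rw [h1, hv.integral_eq]
    simp only [abs_abs]
  · filter_upwards [hΦ, hv.nonneg] with x hx h0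
    rw [hx]; exact h0

/-! ### Decay at infinity and the optimal embedding constant -/

theorem tendsto_measureReal_ball_atTop (hN : 0 < N) :
    Tendsto (fun R : ℝ => volume.real (Metric.ball (0 : Space N) R)) atTop atTop := by
  have := nontrivial_space hN
  have h1 : 0 < volume.real (Metric.ball (0 : Space N) 1) :=
    ENNReal.toReal_pos (Metric.measure_ball_pos volume 0 one_pos).ne' measure_ball_lt_top.ne
  refine ((tendsto_pow_atTop hN.ne').atTop_mul_const h1).congr' ?_
  filter_upwards [eventually_ge_atTop 0] with R hR
  rw [Measure.real, Measure.real, Measure.addHaar_ball volume (0 : Space N) hR, ENNReal.toReal_mul,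
    ENNReal.toReal_ofReal (by positivity), finrank_euclideanSpace_fin]

/-- Pointwise decay of functions that decrease with the norm. -/
theorem ae_rpow_mul_measureReal_ball_le {q A : ℝ} (hq : 0 < q) {Φ : Space N → ℝ}
    (hi : Integrable fun x => |Φ x| ^ q) (hA : ∫ x, |Φ x| ^ q ≤ A) (h0 : ∀ᵐ x, 0 ≤ Φ x)
    (hm : ∀ᵐ y, ∀ᵐ x : Space N, ‖x‖ < ‖y‖ → Φ y ≤ Φ x) :
    ∀ᵐ y : Space N, |Φ y| ^ q * volume.real (Metric.ball (0 : Space N) ‖y‖) ≤ A := by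
  filter_upwards [h0, hm] with y hy hmy
  have h1 : ∫ _ in Metric.ball (0 : Space N) ‖y‖, |Φ y| ^ q ≤
      ∫ x in Metric.ball (0 : Space N) ‖y‖, |Φ x| ^ q := by
    refine setIntegral_mono_on_ae (integrableOn_const measure_ball_lt_top.ne) hi.integrableOn
      measurableSet_ball ?_
    filter_upwards [hmy] with x hx hxy
    have h2 := hx (by simpa using hxy)
    rw [abs_of_nonneg hy, abs_of_nonneg (hy.trans h2)]
    exact Real.rpow_le_rpow hy h2 hq.le
  rw [setIntegral_const, smul_eq_mul, mul_comm] at h1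
  exact h1.trans ((setIntegral_le_integral hi
    (Eventually.of_forall fun x => Real.rpow_nonneg (abs_nonneg _) _)).trans hA)

section Subcritical

variable {s p : ℝ} (hN : 3 ≤ N) (hs₀ : 0 < s) (hs₁ : s < 1)
  (hp₁ : fracCritExp N s < p) (hp₂ : p < critExp N)
include hN hs₀ hs₁ hp₁ hp₂

/-- Local convergence and uniform decay at infinity imply convergence in `L^p`. -/
theorem tendsto_integral_rpow_of_decay {w : ℕ → Space N → ℝ} {A B : ℝ} (hw : ∀ n, MemE s (w n))
    (hB : ∀ n, mixedNorm s (w n) ≤ B)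
    (h : ∀ R : ℝ, Tendsto (fun n => ∫ x in Metric.closedBall 0 R, w n x ^ 2) atTop (𝓝 0))
    (hA : ∀ n, ∀ᵐ y : Space N,
      |w n y| ^ fracCritExp N s * volume.real (Metric.ball (0 : Space N) ‖y‖) ≤ A) :
    Tendsto (fun n => ∫ x, |w n x| ^ p) atTop (𝓝 0) := by
  have h2 := two_lt_fracCritExp hN hs₀ hs₁
  set q := fracCritExp N s with hq
  have hq0 : 0 < q := by linarith
  -- Chosen so that `|w|^p = (|w|^q)^θ |w|^q`: far out the first factor is uniformly small and the
  -- second has bounded integral.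
  set θ : ℝ := (p - q) / q with hθ
  have hθ0 : 0 < θ := div_pos (by linarith) hq0
  obtain ⟨D, hD⟩ := exists_integral_rpow_critical_le hN hs₀ hs₁ B
  have hlim : Tendsto (fun R : ℝ => (A / volume.real (Metric.ball (0 : Space N) R)) ^ θ * D)
      atTop (𝓝 0) := by
    have h3 := ((tendsto_measureReal_ball_atTop (N := N) (by omega)).const_div_atTop A).rpow_const
      (p := θ) (Or.inr hθ0.le)
    rw [Real.zero_rpow hθ0.ne'] at h3
    simpa using h3.mul_const D
  rw [Metric.tendsto_atTop]
  intro ε hε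
  obtain ⟨R, hR, hR0⟩ := ((hlim.eventually (gt_mem_nhds (half_pos hε))).and
    (eventually_gt_atTop 0)).exists
  obtain ⟨n₀, hn₀⟩ := eventually_atTop.1 ((tendsto_setIntegral_rpow hN hs₀ hs₁ hp₁ hp₂ hw hB
    (h R)).eventually (gt_mem_nhds (half_pos hε)))
  refine ⟨n₀, fun n hn => ?_⟩
  rw [Real.dist_eq, sub_zero, abs_of_nonneg
    (integral_nonneg fun x => Real.rpow_nonneg (abs_nonneg _) _)]
  have ip := (hw n).integrable_rpow hN hs₀ hs₁ hp₁ hp₂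
  have iq := (hw n).integrable_fracCritExp hN hs₀ hs₁
  have hV : 0 < volume.real (Metric.ball (0 : Space N) R) :=
    ENNReal.toReal_pos (Metric.measure_ball_pos volume 0 hR0).ne' measure_ball_lt_top.ne
  have htail : ∫ x in (Metric.closedBall (0 : Space N) R)ᶜ, |w n x| ^ p ≤
      (A / volume.real (Metric.ball (0 : Space N) R)) ^ θ * D := by
    have hA0 : 0 ≤ A := by
      obtain ⟨y, hy⟩ := (hA n).exists
      exact le_trans (by positivity) hy
    calc ∫ x in (Metric.closedBall (0 : Space N) R)ᶜ, |w n x| ^ p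
        ≤ ∫ x in (Metric.closedBall (0 : Space N) R)ᶜ,
          (A / volume.real (Metric.ball (0 : Space N) R)) ^ θ * |w n x| ^ q := by
          refine setIntegral_mono_on_ae ip.integrableOn (iq.const_mul _).integrableOn
            measurableSet_closedBall.compl ?_
          filter_upwards [hA n] with x hx hxR
          rw [Set.mem_compl_iff, Metric.mem_closedBall, dist_zero_right, not_le] at hxR
          have h4 : |w n x| ^ q ≤ A / volume.real (Metric.ball (0 : Space N) R) := by
            rw [le_div_iff₀ hV]
            refine le_trans (mul_le_mul_of_nonneg_left ?_ (by positivity)) hx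
            exact measureReal_mono (Metric.ball_subset_ball hxR.le) measure_ball_lt_top.ne
          have e : |w n x| ^ p = (|w n x| ^ q) ^ θ * |w n x| ^ q := by
            rw [← Real.rpow_mul (abs_nonneg _), ← Real.rpow_add_of_nonneg (abs_nonneg _)
              (by positivity) hq0.le]
            congr 1; rw [hθ]; field_simp; ring
          rw [e]
          gcongr
      _ ≤ (A / volume.real (Metric.ball (0 : Space N) R)) ^ θ * D := by
          rw [integral_const_mul]
          refine mul_le_mul_of_nonneg_left ?_ (by positivity)
          exact (setIntegral_le_integral iq
            (Eventually.of_forall fun x => Real.rpow_nonneg (abs_nonneg _) _)).trans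
            (hD _ (hw n) (hB n)).2
  rw [← integral_add_compl measurableSet_closedBall ip (s := Metric.closedBall (0 : Space N) R)]
  have := hn₀ n hn
  linarith

/-- The differences need not be monotone, but both terms are nonnegative, so `|u n - v|` is at most
the larger of them and inherits the decay bound. -/
theorem tendsto_integral_rpow_sub_of_symmetric {u : ℕ → Space N → ℝ} {v : Space N → ℝ} {B : ℝ}
    (hu : ∀ n, MemE s (u n)) (hB : ∀ n, mixedNorm s (u n) ≤ B) (hv : MemE s v)
    (hae : ∀ᵐ x, Tendsto (fun n => u n x) atTop (𝓝 (v x)))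
    (h : ∀ R : ℝ, Tendsto (fun n => ∫ x in Metric.closedBall 0 R, (u n x - v x) ^ 2) atTop (𝓝 0))
    (h0 : ∀ n, ∀ᵐ x, 0 ≤ u n x)
    (hm : ∀ n, ∀ᵐ y, ∀ᵐ x : Space N, ‖x‖ < ‖y‖ → u n y ≤ u n x) :
    Tendsto (fun n => ∫ x, |u n x - v x| ^ p) atTop (𝓝 0) := by
  have h2 := two_lt_fracCritExp hN hs₀ hs₁
  have hq0 : 0 < fracCritExp N s := by linarith
  obtain ⟨A, hA⟩ := exists_integral_rpow_critical_le hN hs₀ hs₁ B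
  have hdec := ae_all_iff.2 fun n => ae_rpow_mul_measureReal_ball_le hq0
    ((hu n).integrable_fracCritExp hN hs₀ hs₁) (hA _ (hu n) (hB n)).2 (h0 n) (hm n)
  have h0' := ae_all_iff.2 h0
  refine tendsto_integral_rpow_of_decay hN hs₀ hs₁ hp₁ hp₂ (w := fun n => u n - v) (A := A)
    (B := B + mixedNorm s v) (fun n => (hu n).sub (by omega) hs₀ hs₁ hv)
    (fun n => ((hu n).mixedNorm_sub_le hs₀ hv).trans (by have := hB n; linarith)) h fun n => ?_
  filter_upwards [hdec, h0', hae] with y hy hy0 hlim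
  have hvy0 : 0 ≤ v y := ge_of_tendsto' hlim hy0
  have hvy : |v y| ^ fracCritExp N s * volume.real (Metric.ball (0 : Space N) ‖y‖) ≤ A :=
    le_of_tendsto' (((hlim.abs).rpow_const (Or.inr hq0.le)).mul_const _) hy
  have hun : 0 ≤ u n y := hy0 n
  rw [Pi.sub_apply]
  rcases le_total (u n y) (v y) with hle | hle
  · refine le_trans ?_ hvy
    have : |u n y - v y| ≤ |v y| := by
      rw [abs_of_nonneg hvy0, abs_of_nonpos (by linarith)]
      linarith
    gcongr
  · refine le_trans ?_ (hy n)
    have : |u n y - v y| ≤ |u n y| := by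
      rw [abs_of_nonneg hun, abs_of_nonneg (by linarith)]
      linarith
    gcongr

omit hN hs₀ hs₁ hp₁ hp₂ in
theorem integral_abs_smul_rpow (a : ℝ) (u : Space N → ℝ) :
    ∫ x, |(a • u) x| ^ p = |a| ^ p * ∫ x, |u x| ^ p := by
  rw [← integral_const_mul]
  refine integral_congr_ae (Eventually.of_forall fun x => ?_)
  simp only [Pi.smul_apply, smul_eq_mul, abs_mul]
  exact Real.mul_rpow (abs_nonneg _) (abs_nonneg _)

omit hp₂ in
theorem exists_memE_integral_eq_one : ∃ u : Space N → ℝ, MemE s u ∧ ∫ x, |u x| ^ p = 1 := by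
  have h2 := two_lt_fracCritExp hN hs₀ hs₁
  have hp0 : 0 < p := by linarith
  let f : ContDiffBump (0 : Space N) := ⟨1, 2, one_pos, one_lt_two⟩
  have hf : IsTest (f : Space N → ℝ) := ⟨f.contDiff, f.hasCompactSupport⟩
  have hpos : 0 < ∫ x, |f x| ^ p := by
    refine Continuous.integral_pos_of_hasCompactSupport_nonneg_nonzero (x := (0 : Space N)) ?_ ?_
      (fun x => Real.rpow_nonneg (abs_nonneg _) _) ?_
    · exact (f.continuous.abs).rpow_const fun x => Or.inr hp0.le
    · exact f.hasCompactSupport.comp_left (g := fun t : ℝ => |t| ^ p)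
        (by rw [abs_zero, Real.zero_rpow hp0.ne'])
    · have : f (0 : Space N) = 1 := f.one_of_mem_closedBall (Metric.mem_closedBall_self (by
        change (0 : ℝ) ≤ 1; norm_num))
      rw [this]; simp
  have hE : MemE s (f : Space N → ℝ) := hf.memE (by omega) hs₀ hs₁
  refine ⟨(∫ x, |f x| ^ p) ^ (-p⁻¹) • (f : Space N → ℝ), hE.smul (by omega) hs₀ hs₁ _, ?_⟩
  rw [integral_abs_smul_rpow, abs_of_pos (by positivity), ← Real.rpow_mul hpos.le,
    neg_mul, inv_mul_cancel₀ hp0.ne', Real.rpow_neg_one, inv_mul_cancel₀ hpos.ne']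

/-- Approximation by symmetric functions without increase of the norm. -/
theorem MemE.exists_symmetric_approx {u : Space N → ℝ} (hu : MemE s u) {ε : ℝ} (hε : 0 < ε) :
    ∃ Φ : Space N → ℝ, MemE s Φ ∧ mixedNorm s Φ ≤ mixedNorm s u + ε ∧
      |(∫ x, |Φ x| ^ p) - ∫ x, |u x| ^ p| < ε ∧ IsRadial Φ ∧ (∀ᵐ x, 0 ≤ Φ x) ∧
      ∀ᵐ y, ∀ᵐ x : Space N, ‖x‖ < ‖y‖ → Φ y ≤ Φ x := by
  have h2 := two_lt_fracCritExp hN hs₀ hs₁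
  have hp0 : 0 < p := by linarith
  obtain ⟨φ, hφ, hlim, -⟩ := hu.exists_test_tendsto hN hs₀ hs₁
  have hφE : ∀ n, MemE s (φ n) := fun n => (hφ n).memE (by omega) hs₀ hs₁
  obtain ⟨C, hC0, hC⟩ := exists_integral_rpow_le hN hs₀ hs₁ hp₁ hp₂
  have hLp : Tendsto (fun n => ∫ x, |φ n x - u x| ^ p) atTop (𝓝 0) := by
    have h3 := (hlim.rpow_const (p := p) (Or.inr hp0.le)).const_mul C
    rw [Real.zero_rpow hp0.ne', mul_zero] at h3
    refine squeeze_zero (fun n => integral_nonneg fun x => Real.rpow_nonneg (abs_nonneg _) _)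
      (fun n => ?_) h3
    have := hC (u - φ n) (hu.sub (by omega) hs₀ hs₁ (hφE n))
    simpa only [Pi.sub_apply, abs_sub_comm] using this
  have h4 := tendsto_integral_rpow_of_tendsto hN hs₀ hs₁ hp₁ hp₂ hφE hu hLp
  obtain ⟨n, hn, hn'⟩ := ((Metric.tendsto_nhds.1 h4 ε hε).and
    (hlim.eventually (gt_mem_nhds hε))).exists
  obtain ⟨Φ, h5, h6, h7, h8⟩ := (hφ n).exists_symmetrization hN hs₀ hs₁ hp₁ hp₂
  refine ⟨Φ, h5, ?_, ?_, h8⟩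
  · have := (abs_le.1 (hu.abs_mixedNorm_sub_le hs₀ (hφE n))).1
    linarith
  · rw [h7]; exact hn

/-- The best constant in the embedding of `E` into `L^p` is attained by a radial function. -/
theorem exists_minimizer : ∃ v : Space N → ℝ, MemE s v ∧ IsRadial v ∧ ∫ x, |v x| ^ p = 1 ∧
    ∀ u : Space N → ℝ, MemE s u → mixedNorm s v ^ p * ∫ x, |u x| ^ p ≤ mixedNorm s u ^ p := by
  have h2 := two_lt_fracCritExp hN hs₀ hs₁
  have hp0 : 0 < p := by linarith
  set Q : Set ℝ := mixedNorm s '' {u : Space N → ℝ | MemE s u ∧ ∫ x, |u x| ^ p = 1} with hQ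
  have hbdd : BddBelow Q := ⟨0, by rintro _ ⟨u, -, rfl⟩; exact mixedNorm_nonneg s u⟩
  have hne : Q.Nonempty := by
    obtain ⟨u, hu⟩ := exists_memE_integral_eq_one hN hs₀ hs₁ hp₁
    exact ⟨_, u, hu, rfl⟩
  obtain ⟨m, hanti, hm, hmQ⟩ := exists_seq_tendsto_sInf hne hbdd
  choose w hw hwm using hmQ
  -- Only test functions were symmetrized, so the constraint holds up to `1/(n+1)`; it becomes exact
  -- in the limit.
  have happ := fun n : ℕ => (hw n).1.exists_symmetric_approx hN hs₀ hs₁ hp₁ hp₂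
    (ε := 1 / ((n : ℝ) + 1)) (by positivity)
  choose u huE hun hui hrad hu0 humono using happ
  have hc : Tendsto (fun n : ℕ => m n + 1 / ((n : ℝ) + 1)) atTop (𝓝 (sInf Q)) := by
    simpa using hm.add tendsto_one_div_add_atTop_nhds_zero_nat
  have hcn : ∀ n, mixedNorm s (u n) ≤ m n + 1 / ((n : ℝ) + 1) := fun n => by
    rw [← hwm n]; exact hun n
  have hB : ∀ n, mixedNorm s (u n) ≤ m 0 + 1 := fun n => by
    refine (hcn n).trans (add_le_add (hanti (Nat.zero_le n)) ?_)
    rw [div_le_one (by positivity)]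
    have : (0 : ℝ) ≤ n := n.cast_nonneg
    linarith
  obtain ⟨ns, hns, v₀, hv₀, -, hae, hL2⟩ := exists_subseq_tendsto hN hs₀ hs₁ huE hB
  -- An everywhere defined version of the limit, radial at every point.
  set v : Space N → ℝ := fun x => limsup (fun j => u (ns j) x) atTop with hvdef
  have hvv : v₀ =ᵐ[volume] v := hae.mono fun x hx => hx.limsup_eq.symm
  have hvrad : IsRadial v := fun x y hxy => by
    simp only [hvdef, hrad _ x y hxy]
  have hvE := (hv₀.congr hs₀ hvv).1
  have hnorm : mixedNorm s v ≤ sInf Q := by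
    rw [(hv₀.congr hs₀ hvv).2]
    exact (MemE.of_tendsto_of_mixedNorm_le hN hs₀ hs₁ (fun j => huE (ns j)) (fun j => hcn (ns j))
      (hc.comp hns.tendsto_atTop) hae).2
  have hLp := tendsto_integral_rpow_sub_of_symmetric hN hs₀ hs₁ hp₁ hp₂ (fun j => huE (ns j))
    (fun j => hB (ns j)) hv₀ hae hL2 (fun j => hu0 (ns j)) (fun j => humono (ns j))
  have hint : ∫ x, |v x| ^ p = 1 := by
    have e : ∫ x, |v x| ^ p = ∫ x, |v₀ x| ^ p :=
      integral_congr_ae (hvv.mono fun x hx => by simp only [hx])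
    rw [e]
    refine tendsto_nhds_unique (tendsto_integral_rpow_of_tendsto hN hs₀ hs₁ hp₁ hp₂
      (fun j => huE (ns j)) hv₀ hLp) ?_
    refine Tendsto.comp (g := fun n => ∫ x, |u n x| ^ p) ?_ hns.tendsto_atTop
    rw [tendsto_iff_dist_tendsto_zero]
    refine squeeze_zero (fun n => dist_nonneg) (fun n => ?_)
      tendsto_one_div_add_atTop_nhds_zero_nat
    have := hui n
    rw [(hw n).2] at this
    exact this.le
  refine ⟨v, hvE, hvrad, hint, fun u hu => ?_⟩
  have hI : 0 ≤ ∫ x, |u x| ^ p := integral_nonneg fun x => Real.rpow_nonneg (abs_nonneg _) _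
  rcases hI.eq_or_lt with h0 | h0
  · rw [← h0, mul_zero]
    exact Real.rpow_nonneg (mixedNorm_nonneg s u) _
  set I := ∫ x, |u x| ^ p with hIdef
  have h3 : mixedNorm s (I ^ (-p⁻¹) • u) ∈ Q := by
    refine ⟨_, ⟨hu.smul (by omega) hs₀ hs₁ _, ?_⟩, rfl⟩
    rw [integral_abs_smul_rpow, abs_of_pos (by positivity), ← Real.rpow_mul hI,
      neg_mul, inv_mul_cancel₀ hp0.ne', Real.rpow_neg_one, inv_mul_cancel₀ h0.ne']
  have h4 := hnorm.trans (csInf_le hbdd h3)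
  rw [mixedNorm_smul s hs₀ (hu.exists_jet hs₀), abs_of_pos (by positivity)] at h4
  have h5 := Real.rpow_le_rpow (mixedNorm_nonneg s v) h4 hp0.le
  rw [Real.mul_rpow (by positivity) (mixedNorm_nonneg s u), ← Real.rpow_mul hI, neg_mul,
    inv_mul_cancel₀ hp0.ne', Real.rpow_neg_one, inv_mul_eq_div, le_div_iff₀ h0] at h5
  exact h5

end Subcritical

/-! ### The Euler–Lagrange equation and its rescaling -/

theorem abs_rpow_sub_two_mul_self {p : ℝ} (hp : 2 < p) (t : ℝ) :
    |t| ^ (p - 2) * t * t = |t| ^ p := by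
  rcases eq_or_ne t 0 with rfl | h
  · rw [mul_zero, abs_zero, Real.zero_rpow (by linarith)]
  · rw [mul_assoc, ← abs_mul_abs_self t, ← sq, ← Real.rpow_two, ← Real.rpow_add (abs_pos.2 h)]
    congr 1; ring

/-- The tangent line inequality for `|t|^p`. -/
theorem abs_rpow_add_le {p : ℝ} (hp : 2 < p) (a b : ℝ) :
    |a| ^ p + p * (|a| ^ (p - 2) * a * b) ≤ |a + b| ^ p := by
  have hp0 : 0 < p := by linarith
  have h1 : |a| ^ (p - 2) * a * (a + b) ≤ |a| ^ (p - 1) * |a + b| := by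
    calc |a| ^ (p - 2) * a * (a + b) ≤ |a| ^ (p - 2) * |a * (a + b)| := by
          rw [mul_assoc]; gcongr; exact le_abs_self _
      _ = |a| ^ (p - 2) * |a| ^ (1 : ℝ) * |a + b| := by rw [abs_mul, Real.rpow_one]; ring
      _ = |a| ^ (p - 1) * |a + b| := by
          rw [← Real.rpow_add_of_nonneg (abs_nonneg a) (by linarith) zero_le_one]
          congr 2; ring
  have h2 := Real.geom_mean_le_arith_mean2_weighted (w₁ := 1 - p⁻¹) (w₂ := p⁻¹)
    (p₁ := |a| ^ p) (p₂ := |a + b| ^ p)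
    (sub_nonneg.2 (inv_le_one_of_one_le₀ (by linarith))) (by positivity) (by positivity)
    (by positivity) (by ring)
  rw [← Real.rpow_mul (abs_nonneg a), ← Real.rpow_mul (abs_nonneg (a + b)),
    mul_inv_cancel₀ hp0.ne', Real.rpow_one, mul_sub, mul_one, mul_inv_cancel₀ hp0.ne'] at h2
  have h3 := mul_le_mul_of_nonneg_left (h1.trans h2) hp0.le
  have h4 := abs_rpow_sub_two_mul_self hp a
  have e : p * ((1 - p⁻¹) * |a| ^ p + p⁻¹ * |a + b| ^ p) = (p - 1) * |a| ^ p + |a + b| ^ p := by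
    field_simp
  rw [e, mul_add, h4] at h3
  linarith

theorem abs_rpow_mul_mul_le {p : ℝ} (hp : 2 < p) (a b : ℝ) :
    |(|a| ^ (p - 2) * a * b)| ≤ |a| ^ p + |b| ^ p := by
  have h1 : |(|a| ^ (p - 2) * a * b)| = |a| ^ (p - 2) * |a| * |b| := by
    rw [abs_mul, abs_mul, abs_of_nonneg (Real.rpow_nonneg (abs_nonneg a) _)]
  have key : ∀ t : ℝ, |t| ^ (p - 2) * |t| * |t| = |t| ^ p := fun t => by
    simpa only [abs_abs] using abs_rpow_sub_two_mul_self hp |t|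
  rw [h1]
  rcases le_total |b| |a| with h | h
  · calc |a| ^ (p - 2) * |a| * |b| ≤ |a| ^ (p - 2) * |a| * |a| := by gcongr
      _ = |a| ^ p := key a
      _ ≤ _ := le_add_of_nonneg_right (by positivity)
  · calc |a| ^ (p - 2) * |a| * |b| ≤ |b| ^ (p - 2) * |b| * |b| := by
          gcongr
      _ = |b| ^ p := key b
      _ ≤ _ := le_add_of_nonneg_left (by positivity)

/-- Along a ray through a Nehari element the energy peaks at that element, `a = 1`; this is weighted
AM-GM applied to `a^p` and 1. -/
theorem one_half_mul_sq_sub_le {p : ℝ} (hp : 2 < p) {a : ℝ} (ha : 0 ≤ a) :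
    1 / 2 * a ^ 2 - 1 / p * a ^ p ≤ 1 / 2 - 1 / p := by
  have hp0 : 0 < p := by linarith
  have h1 := Real.geom_mean_le_arith_mean2_weighted (w₁ := 2 / p) (w₂ := 1 - 2 / p)
    (p₁ := a ^ p) (p₂ := 1) (by positivity) (sub_nonneg.2 ((div_le_one hp0).2 hp.le))
    (by positivity) zero_le_one (by ring)
  rw [← Real.rpow_mul ha, mul_div_cancel₀ _ hp0.ne', Real.one_rpow, mul_one, mul_one,
    Real.rpow_two] at h1
  have e : 2 / p = 2 * (1 / p) := by ring
  rw [e] at h1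
  linarith

theorem energy_eq {s p : ℝ} (hs₀ : 0 < s) {u : Space N → ℝ} (hu : MemE s u) :
    energy s p u = 1 / 2 * mixedNorm s u ^ 2 - 1 / p * ∫ x, |u x| ^ p := by
  rw [energy, mixedNorm_sq hs₀ (hu.exists_jet hs₀)]

theorem energyDeriv_self {s p : ℝ} (hs₀ : 0 < s) (hp : 2 < p) {u : Space N → ℝ} (hu : MemE s u) :
    energyDeriv s p u u = mixedNorm s u ^ 2 - ∫ x, |u x| ^ p := by
  rw [energyDeriv, mixedNorm_sq hs₀ (hu.exists_jet hs₀)]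
  simp only [abs_rpow_sub_two_mul_self hp]

section Subcritical

variable {s p : ℝ} (hN : 3 ≤ N) (hs₀ : 0 < s) (hs₁ : s < 1)
  (hp₁ : fracCritExp N s < p) (hp₂ : p < critExp N)
include hN hs₀ hs₁ hp₁ hp₂

theorem MemE.integrable_rpow_mul_mul {u φ : Space N → ℝ} (hu : MemE s u) (hφ : MemE s φ) :
    Integrable fun x => |u x| ^ (p - 2) * u x * φ x := by
  have h2 := two_lt_fracCritExp hN hs₀ hs₁
  refine ((hu.integrable_rpow hN hs₀ hs₁ hp₁ hp₂).add
    (hφ.integrable_rpow hN hs₀ hs₁ hp₁ hp₂)).mono'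
    (((aestronglyMeasurable_abs_rpow hu.memLp.1 _).mul hu.memLp.1).mul hφ.memLp.1)
    (Eventually.of_forall fun x => ?_)
  rw [Real.norm_eq_abs]
  exact abs_rpow_mul_mul_le (by linarith) _ _

theorem MemE.integral_rpow_add_le {u φ : Space N → ℝ} (hu : MemE s u) (hφ : MemE s φ) (t : ℝ) :
    (∫ x, |u x| ^ p) + p * t * ∫ x, |u x| ^ (p - 2) * u x * φ x ≤
      ∫ x, |(u + t • φ) x| ^ p := by
  have h2 := two_lt_fracCritExp hN hs₀ hs₁
  have i1 := hu.integrable_rpow hN hs₀ hs₁ hp₁ hp₂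
  have i2 := (hu.integrable_rpow_mul_mul hN hs₀ hs₁ hp₁ hp₂ hφ).const_mul (p * t)
  rw [← integral_const_mul, ← integral_add i1 i2]
  refine integral_mono (i1.add i2)
    ((hu.add (by omega) hs₀ hs₁ (hφ.smul (by omega) hs₀ hs₁ t)).integrable_rpow
      hN hs₀ hs₁ hp₁ hp₂) fun x => ?_
  have := abs_rpow_add_le (p := p) (by linarith) (u x) (t * φ x)
  simp only [Pi.add_apply, Pi.smul_apply, smul_eq_mul]
  linarith

/-- The Euler–Lagrange equation of the minimization problem for the embedding constant. -/
theorem form_eq_of_minimizer {v φ : Space N → ℝ} (hv : MemE s v) (hint : ∫ x, |v x| ^ p = 1)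
    (hpos : 0 < mixedNorm s v)
    (hmin : ∀ u : Space N → ℝ, MemE s u → mixedNorm s v ^ p * ∫ x, |u x| ^ p ≤ mixedNorm s u ^ p)
    (hφ : MemE s φ) : dirichletForm v φ + gagliardoForm s v φ =
      mixedNorm s v ^ 2 * ∫ x, |v x| ^ (p - 2) * v x * φ x := by
  have h2 := two_lt_fracCritExp hN hs₀ hs₁
  have hp0 : 0 < p := by linarith
  obtain ⟨h, hh⟩ := hv.exists_jet hs₀
  obtain ⟨k, hk⟩ := hφ.exists_jet hs₀
  have hκ := hh.mixedNorm_eq hs₀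
  rw [hh.form_eq hs₀ hk, hκ]
  rw [hκ] at hpos hmin
  set A := ∫ x, |v x| ^ (p - 2) * v x * φ x with hA
  -- The tangent line replaces the `L^p` integral from below, so that integral need not be
  -- differentiated. The difference is nonnegative and vanishes at `t = 0`, hence has zero
  -- derivative there; the norm enters through its square to be differentiable.
  have hF : ∀ t : ℝ, 0 ≤ (‖h + t • k‖ ^ 2) ^ (p / 2) - ‖h‖ ^ p * (1 + p * t * A) := by
    intro t
    have h3 := hmin _ (hv.add (by omega) hs₀ hs₁ (hφ.smul (by omega) hs₀ hs₁ t))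
    rw [(hh.add (hk.smul t)).mixedNorm_eq hs₀] at h3
    have h4 := hv.integral_rpow_add_le hN hs₀ hs₁ hp₁ hp₂ hφ t
    rw [hint] at h4
    rw [← Real.rpow_natCast ‖h + t • k‖, ← Real.rpow_mul (norm_nonneg _)]
    have e : ((2 : ℕ) : ℝ) * (p / 2) = p := by push_cast; ring
    rw [e, sub_nonneg]
    exact (mul_le_mul_of_nonneg_left h4 (by positivity)).trans h3
  have hexp : ∀ t : ℝ, ‖h + t • k‖ ^ 2 = ‖h‖ ^ 2 + 2 * t * inner ℝ h k + t ^ 2 * ‖k‖ ^ 2 := by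
    intro t
    rw [norm_add_sq_real, inner_smul_right, norm_smul, mul_pow, Real.norm_eq_abs, sq_abs]
    ring
  have hd1 : HasDerivAt (fun t : ℝ => ‖h + t • k‖ ^ 2) (2 * inner ℝ h k) 0 := by
    simp only [hexp]
    exact ((((hasDerivAt_id' (0 : ℝ)).const_mul 2).mul_const (inner ℝ h k)).const_add (‖h‖ ^ 2)
      |>.add (((hasDerivAt_id' (0 : ℝ)).fun_pow 2).mul_const (‖k‖ ^ 2))).congr_deriv (by simp)
  have hd2 := hd1.rpow_const (p := p / 2) (Or.inr (by linarith))
  have hd3 : HasDerivAt (fun t : ℝ => ‖h‖ ^ p * (1 + p * t * A)) (‖h‖ ^ p * (p * A)) 0 := by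
    have := ((((hasDerivAt_id (0 : ℝ)).const_mul p).mul_const A).const_add 1).const_mul (‖h‖ ^ p)
    simpa using this
  have hloc : IsLocalMin
      (fun t : ℝ => (‖h + t • k‖ ^ 2) ^ (p / 2) - ‖h‖ ^ p * (1 + p * t * A)) 0 := by
    refine Eventually.of_forall fun t => le_trans (le_of_eq ?_) (hF t)
    simp only [zero_smul, add_zero, mul_zero, zero_mul, mul_one]
    rw [← Real.rpow_natCast ‖h‖, ← Real.rpow_mul (norm_nonneg _)]
    have e : ((2 : ℕ) : ℝ) * (p / 2) = p := by push_cast; ring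
    rw [e, sub_self]
  have hz := hloc.hasDerivAt_eq_zero (hd2.sub hd3)
  simp only [zero_smul, add_zero] at hz
  have e1 : (‖h‖ ^ 2) ^ (p / 2 - 1) = ‖h‖ ^ (p - 2) := by
    rw [← Real.rpow_natCast ‖h‖, ← Real.rpow_mul (norm_nonneg _)]
    congr 1; push_cast; ring
  have e2 : ‖h‖ ^ p = ‖h‖ ^ (p - 2) * ‖h‖ ^ 2 := by
    rw [← Real.rpow_two, ← Real.rpow_add hpos]; congr 1; ring
  rw [e1, e2] at hz
  have h5 : 0 < ‖h‖ ^ (p - 2) := by positivity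
  have h6 : (p * ‖h‖ ^ (p - 2)) * (inner ℝ h k - ‖h‖ ^ 2 * A) = 0 := by linarith
  exact sub_eq_zero.1 ((mul_eq_zero.1 h6).resolve_left (by positivity))

/-- A radial weak solution for which the norm is optimal in the embedding of `E` into `L^p`. -/
theorem exists_radial_solution : ∃ Φ : Space N → ℝ, IsRadial Φ ∧ IsWeakSolution s p Φ ∧
    0 < mixedNorm s Φ ∧ ∀ u : Space N → ℝ, MemE s u →
      mixedNorm s Φ ^ (p - 2) * ∫ x, |u x| ^ p ≤ mixedNorm s u ^ p := by
  have h2 := two_lt_fracCritExp hN hs₀ hs₁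
  have hp0 : 0 < p := by linarith
  obtain ⟨v, hv, hrad, hint, hmin⟩ := exists_minimizer hN hs₀ hs₁ hp₁ hp₂
  have hκ : 0 < mixedNorm s v := by
    refine (mixedNorm_nonneg s v).lt_of_ne fun h0 => ?_
    have h3 := hv.ae_eq_zero_of_mixedNorm_eq_zero hN hs₀ h0.symm
    have h4 : ∫ x, |v x| ^ p = 0 := by
      rw [integral_congr_ae (g := fun _ => (0 : ℝ)) (h3.mono fun x hx => ?_), integral_zero]
      simp only [hx, Pi.zero_apply, abs_zero, Real.zero_rpow hp0.ne']
    rw [hint] at h4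
    exact one_ne_zero h4
  set κ := mixedNorm s v with hκdef
  -- Chosen so that `τ^(p-2) = κ²`, which turns the multiplier `κ²` into 1.
  set τ : ℝ := κ ^ (2 / (p - 2)) with hτ
  have hτ0 : 0 < τ := by positivity
  have hτp : τ ^ (p - 2) = κ ^ 2 := by
    rw [hτ, ← Real.rpow_mul hκ.le, div_mul_cancel₀ _ (by linarith), Real.rpow_two]
  have hn : mixedNorm s (τ • v) = τ * κ := by
    rw [mixedNorm_smul s hs₀ (hv.exists_jet hs₀), abs_of_pos hτ0]
  have hvE := hv.smul (by omega) hs₀ hs₁ τ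
  refine ⟨τ • v, fun x y hxy => ?_, ⟨hvE, fun φ hφ => ?_⟩, ?_, fun u hu => ?_⟩
  · simp only [Pi.smul_apply, hrad x y hxy]
  · obtain ⟨h, hh⟩ := hv.exists_jet hs₀
    obtain ⟨k, hk⟩ := hφ.exists_jet hs₀
    have h3 := form_eq_of_minimizer hN hs₀ hs₁ hp₁ hp₂ hv hint hκ hmin hφ
    rw [hh.form_eq hs₀ hk] at h3
    rw [energyDeriv, (hh.smul τ).form_eq hs₀ hk, real_inner_smul_left, h3]
    have h4 : ∫ x, |(τ • v) x| ^ (p - 2) * (τ • v) x * φ x =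
        τ ^ (p - 2) * τ * ∫ x, |v x| ^ (p - 2) * v x * φ x := by
      rw [← integral_const_mul]
      refine integral_congr_ae (Eventually.of_forall fun x => ?_)
      simp only [Pi.smul_apply, smul_eq_mul, abs_mul, abs_of_pos hτ0]
      rw [Real.mul_rpow hτ0.le (abs_nonneg _)]
      ring
    rw [h4, hτp]
    ring
  · rw [hn]; positivity
  · rw [hn, Real.mul_rpow hτ0.le hκ.le, hτp, ← Real.rpow_two, ← Real.rpow_add hκ]
    have e : 2 + (p - 2) = p := by ring
    rw [e]
    exact hmin u hu

/-! ### The Nehari level and the mountain pass level -/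

omit hp₂ in
-- On the manifold `∫ |u|^p = ‖u‖²`, so the embedding inequality reduces to `ρ^(p-2) ≤ ‖u‖^(p-2)`.
theorem mixedNorm_le_of_mem_nehari {ρ : ℝ} (hρ : 0 < ρ)
    (hS : ∀ u : Space N → ℝ, MemE s u → ρ ^ (p - 2) * ∫ x, |u x| ^ p ≤ mixedNorm s u ^ p)
    {u : Space N → ℝ} (hu : u ∈ nehari N s p) :
    ρ ≤ mixedNorm s u ∧ energy s p u = (1 / 2 - 1 / p) * mixedNorm s u ^ 2 := by
  have h2 := two_lt_fracCritExp hN hs₀ hs₁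
  obtain ⟨hE, hne, hd⟩ := hu
  rw [energyDeriv_self hs₀ (by linarith) hE, sub_eq_zero] at hd
  have hpos : 0 < mixedNorm s u := (mixedNorm_nonneg s u).lt_of_ne fun h0 =>
    hne (hE.ae_eq_zero_of_mixedNorm_eq_zero hN hs₀ h0.symm)
  refine ⟨?_, by rw [energy_eq hs₀ hE, ← hd]; ring⟩
  have h3 := hS u hE
  have e : mixedNorm s u ^ p = mixedNorm s u ^ (p - 2) * mixedNorm s u ^ 2 := by
    rw [← Real.rpow_two, ← Real.rpow_add hpos]; congr 1; ring
  rw [← hd, e] at h3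
  exact (Real.rpow_le_rpow_iff hρ.le hpos.le (by linarith)).1
    (le_of_mul_le_mul_right h3 (by positivity))

omit hp₂ in
/-- Every admissible path crosses the sphere of radius `ρ`, where the energy is large. -/
theorem exists_le_energy_of_mem_admissiblePaths {ρ : ℝ} (hρ : 0 < ρ)
    (hS : ∀ u : Space N → ℝ, MemE s u → ρ ^ (p - 2) * ∫ x, |u x| ^ p ≤ mixedNorm s u ^ p)
    {γ : unitInterval → Space N → ℝ} (hγ : γ ∈ admissiblePaths N s p) :
    ∃ t, (1 / 2 - 1 / p) * ρ ^ 2 ≤ energy s p (γ t) := by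
  have h2 := two_lt_fracCritExp hN hs₀ hs₁
  have hp0 : 0 < p := by linarith
  have hρp : 0 < ρ ^ (p - 2) := by positivity
  have hsplit : ∀ {r : ℝ}, 0 ≤ r → r ^ p = r ^ (p - 2) * r ^ 2 := fun {r} hr => by
    rw [← Real.rpow_two, ← Real.rpow_add_of_nonneg hr (by linarith) (by norm_num)]
    congr 1; ring
  obtain ⟨hE, hcont, hγ0, hγ1⟩ := hγ
  have hc : Continuous fun t => mixedNorm s (γ t) := by
    rw [continuous_iff_continuousAt]
    intro t₀
    rw [ContinuousAt, tendsto_iff_dist_tendsto_zero]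
    refine squeeze_zero (fun _ => dist_nonneg) (fun t => ?_) (hcont t₀)
    exact (hE t).abs_mixedNorm_sub_le hs₀ (hE t₀)
  have h0 : mixedNorm s (γ 0) = 0 := by
    rw [← ((hE 0).congr hs₀ hγ0).2]
    exact mixedNorm_zero s hs₀
  -- Inside the sphere `∫ |u|^p ≤ ‖u‖²`, so the energy is nonnegative; an endpoint of negative
  -- energy lies outside.
  have h1 : ρ ≤ mixedNorm s (γ 1) := by
    by_contra! hlt
    have hn0 := mixedNorm_nonneg s (γ 1)
    have h3 : ∫ x, |γ 1 x| ^ p ≤ mixedNorm s (γ 1) ^ 2 := by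
      refine le_of_mul_le_mul_left ((hS _ (hE 1)).trans ?_) hρp
      rw [hsplit hn0]
      exact mul_le_mul_of_nonneg_right (Real.rpow_le_rpow hn0 hlt.le (by linarith)) (sq_nonneg _)
    rw [energy_eq hs₀ (hE 1)] at hγ1
    have h4 : 1 / p ≤ 1 / 2 := one_div_le_one_div_of_le two_pos (by linarith)
    have h5 := mul_le_mul_of_nonneg_left h3 (one_div_pos.2 hp0).le
    have h6 := mul_le_mul_of_nonneg_right h4 (sq_nonneg (mixedNorm s (γ 1)))
    linarith
  obtain ⟨t, ht⟩ := mem_range_of_exists_le_of_exists_ge hc ⟨0, h0.le.trans hρ.le⟩ ⟨1, h1⟩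
  refine ⟨t, ?_⟩
  have ht : mixedNorm s (γ t) = ρ := ht
  have h3 := hS _ (hE t)
  rw [ht, hsplit hρ.le] at h3
  have h4 := mul_le_mul_of_nonneg_left (le_of_mul_le_mul_left h3 hρp) (one_div_pos.2 hp0).le
  rw [energy_eq hs₀ (hE t), ht]
  linarith

omit hp₂ in
/-- A straight path through an element of the Nehari manifold realizes its energy. -/
theorem exists_mem_admissiblePaths_energy_le {Φ : Space N → ℝ} (hΦ : Φ ∈ nehari N s p)
    (hpos : 0 < mixedNorm s Φ) : ∃ γ ∈ admissiblePaths N s p,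
      ∀ t, energy s p (γ t) ≤ (1 / 2 - 1 / p) * mixedNorm s Φ ^ 2 := by
  have h2 := two_lt_fracCritExp hN hs₀ hs₁
  have hp : 2 < p := by linarith
  obtain ⟨hE, -, hd⟩ := hΦ
  rw [energyDeriv_self hs₀ hp hE, sub_eq_zero] at hd
  have hEa : ∀ a : ℝ, MemE s (a • Φ) := fun a => hE.smul (by omega) hs₀ hs₁ a
  have hen : ∀ a : ℝ, 0 ≤ a → energy s p (a • Φ) =
      (1 / 2 * a ^ 2 - 1 / p * a ^ p) * mixedNorm s Φ ^ 2 := fun a ha => by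
    rw [energy_eq hs₀ (hEa a), mixedNorm_smul s hs₀ (hE.exists_jet hs₀), integral_abs_smul_rpow,
      ← hd, abs_of_nonneg ha]
    ring
  -- With `T^(p-2) = p` the endpoint `T Φ` has energy `-(1/2) T² ‖Φ‖²`.
  set T : ℝ := p ^ (1 / (p - 2)) with hT
  have hT0 : 0 < T := by positivity
  have hTp : T ^ p = p * T ^ 2 := by
    have e1 : T ^ (p - 2) = p := by
      rw [hT, ← Real.rpow_mul (by linarith), one_div_mul_cancel (by linarith), Real.rpow_one]
    rw [← e1, ← Real.rpow_two, ← Real.rpow_add hT0, e1]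
    congr 1; ring
  refine ⟨fun t => ((t : ℝ) * T) • Φ, ⟨fun t => hEa _, fun t₀ => ?_, ?_, ?_⟩, fun t => ?_⟩
  · have e : ∀ t : unitInterval, mixedNorm s (((t : ℝ) * T) • Φ - ((t₀ : ℝ) * T) • Φ) =
        |(t : ℝ) * T - t₀ * T| * mixedNorm s Φ := fun t => by
      rw [← sub_smul, mixedNorm_smul s hs₀ (hE.exists_jet hs₀)]
    simp only [e]
    have hc : Continuous fun t : unitInterval => |(t : ℝ) * T - t₀ * T| * mixedNorm s Φ := by
      fun_prop
    simpa using hc.tendsto t₀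
  · simp
  · simp only [Set.Icc.coe_one, one_mul]
    rw [hen T hT0.le, hTp]
    have e : 1 / 2 * T ^ 2 - 1 / p * (p * T ^ 2) = -(1 / 2 * T ^ 2) := by field_simp; ring
    rw [e, neg_mul]
    exact neg_neg_of_pos (by positivity)
  · have ht : 0 ≤ (t : ℝ) * T := mul_nonneg t.2.1 hT0.le
    simp only
    rw [hen _ ht]
    exact mul_le_mul_of_nonneg_right (one_half_mul_sq_sub_le hp ht) (sq_nonneg _)

end Subcritical

end MixedLaplacian

/-! ### The ground state and the two levels -/

theorem theorem1p2 (N : ℕ) (hN : 3 ≤ N) (s : ℝ) (hs₀ : 0 < s) (hs₁ : s < 1) (p : ℝ)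
    (hp₁ : MixedLaplacian.fracCritExp N s < p) (hp₂ : p < MixedLaplacian.critExp N) :
    ∃ Φ : MixedLaplacian.Space N → ℝ,
      MixedLaplacian.MemE s Φ ∧
      MixedLaplacian.IsRadial Φ ∧
      MixedLaplacian.IsGroundState s p Φ ∧
      Φ ∈ MixedLaplacian.nehari N s p ∧
      (MixedLaplacian.energy s p Φ : EReal) = MixedLaplacian.nehariLevel N s p ∧
      MixedLaplacian.nehariLevel N s p = MixedLaplacian.mountainPassLevel N s p := by
  have h2 := MixedLaplacian.two_lt_fracCritExp hN hs₀ hs₁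
  obtain ⟨Φ, hrad, hsol, hpos, hS⟩ :=
    MixedLaplacian.exists_radial_solution hN hs₀ hs₁ hp₁ hp₂
  have hne : ¬ Φ =ᵐ[MeasureTheory.volume] 0 := fun h0 => by
    rw [← (hsol.1.congr hs₀ h0).2] at hpos
    exact hpos.ne' (MixedLaplacian.mixedNorm_zero s hs₀)
  have hΦ : Φ ∈ MixedLaplacian.nehari N s p := ⟨hsol.1, hne, hsol.2 Φ hsol.1⟩
  have hen := (MixedLaplacian.mixedNorm_le_of_mem_nehari hN hs₀ hs₁ hp₁ hpos hS hΦ).2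
  have hp : 0 ≤ 1 / 2 - 1 / p :=
    sub_nonneg.2 (one_div_le_one_div_of_le two_pos (by linarith))
  have hle : ∀ u ∈ MixedLaplacian.nehari N s p,
      MixedLaplacian.energy s p Φ ≤ MixedLaplacian.energy s p u := fun u hu => by
    obtain ⟨h3, h4⟩ := MixedLaplacian.mixedNorm_le_of_mem_nehari hN hs₀ hs₁ hp₁ hpos hS hu
    rw [hen, h4]
    exact mul_le_mul_of_nonneg_left (pow_le_pow_left₀ hpos.le h3 2) hp
  have hlevel : (MixedLaplacian.energy s p Φ : EReal) = MixedLaplacian.nehariLevel N s p :=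
    le_antisymm (le_iInf₂ fun u hu => EReal.coe_le_coe_iff.2 (hle u hu)) (iInf₂_le Φ hΦ)
  refine ⟨Φ, hsol.1, hrad, ⟨hsol, hne, fun v hv hv0 => hle v ⟨hv.1, hv0, hv.2 v hv.1⟩⟩, hΦ,
    hlevel, ?_⟩
  -- Both levels are now compared with `(1/2 - 1/p) ‖Φ‖²`: below by crossing the sphere of radius
  -- `‖Φ‖`, above by the segment through `Φ`.
  rw [← hlevel, hen]
  refine le_antisymm (le_iInf₂ fun γ hγ => ?_) ?_
  · obtain ⟨t, ht⟩ := MixedLaplacian.exists_le_energy_of_mem_admissiblePaths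
      hN hs₀ hs₁ hp₁ hpos hS hγ
    exact (EReal.coe_le_coe_iff.2 ht).trans
      (le_iSup (fun t => (MixedLaplacian.energy s p (γ t) : EReal)) t)
  · obtain ⟨γ, hγ, hγe⟩ := MixedLaplacian.exists_mem_admissiblePaths_energy_le
      hN hs₀ hs₁ hp₁ hΦ hpos
    exact (iInf₂_le γ hγ).trans (iSup_le fun t => EReal.coe_le_coe_iff.2 (hγe t))
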